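/- Let $d\ge 1$, $\ell\ge 0$ and let $s\in\mathbb N$ with $s>d/2$. Write $\mathbb R^+=(0,\infty)$, let $e_1$ be the first standard basis vector of $\mathbb R^d$, and let $\mathcal H^{r}(\mathbb R^d)$ be the space of real tempered distributions $f$ whose Fourier transform $\hat f$ (unitary, with frequency variable $\xi$) is locally integrable and satisfies $$\|f\|_{\mathcal H^r}^2=\int_{|\xi|<1}|\xi|^{-2}(\xi_1^2+|\xi|^4)|\hat f(\xi)|^2\,d\xi+\int_{|\xi|\ge 1}(1+|\xi|^2)^{r}|\hat f(\xi)|^2\,d\xi<\infty .$$ Then there exist an open set $$(\mathbb R^+)^3\times\{0\}^{\ell+1}\times\{0\}^{\ell+1}\subset\mathscr U_s\subset(\mathbb R^+)^3\times\big(H^s(\mathbb R^d;\mathbb R^{d\times d})\big)^{\ell+1}\times\big(H^s(\mathbb R^d;\mathbb R^d)\big)^{\ell+1},$$ open sets $$0\in\mathscr V_s(\mathbf p)\subset H^{2+s}(\mathbb R^d;\mathbb R^d)\times\mathcal H^{3+s}(\mathbb R^d)\quad\text{for each }\mathbf p\in(\mathbb R^+)^3,$$ and a smooth ($C^\infty$)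 map $$\mathscr U_s\ni(\gamma,\mu,\sigma,\{\tau_i\}_{i=0}^\ell,\{\varphi_i\}_{i=0}^\ell)\mapsto(v,\eta)\in H^{2+s}(\mathbb R^d;\mathbb R^d)\times\mathcal H^{3+s}(\mathbb R^d)$$ such that for every $(\gamma,\mu,\sigma,\{\tau_i\},\{\varphi_i\})\in\mathscr U_s$ the associated pair $(v,\eta)$ lies in $\mathscr V_s(\gamma,\mu,\sigma)$ and is the unique element of $\mathscr V_s(\gamma,\mu,\sigma)$ that solves, in the classical sense (pointwise, with $v$ of class $C^2$, $\eta$ of class $C^3$ and the continuous representatives of the data), the traveling shallow water system $$\begin{cases}\nabla\cdot\big((1+\eta)(v-\gamma e_1)\big)=0,\\ (1+\eta)(v-\gamma e_1)\cdot\nabla v+v-\mu^2\nabla\cdot\big((1+\eta)\mathbb S v\big)+(1+\eta)(I-\sigma^2\Delta)\nabla\eta+\mathcal F=0,\end{cases}$$ where $\mathbb S v=\nabla v+(\nabla v)^{\mathrm t}+2(\nabla\cdot v)I$ and $$\mathcal F=\sum_{i=0}^\ell\eta^i(\tau_i\nabla\eta+\varphi_i).$$ -/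

import Mathlib

open MeasureTheory SchwartzMap TemperedDistribution
open scoped FourierTransform ContDiff ENNReal

noncomputable section

namespace ShallowWater

/-- The Euclidean space `ℝᵈ`. -/
abbrev Space (d : ℕ) : Type := EuclideanSpace ℝ (Fin d)

/-! ### Tempered distributions -/

/-- A tempered distribution is real if it takes real values on real-valued Schwartz functions. -/
def IsRealDist {d : ℕ} (u : 𝓢'(Space d, ℂ)) : Prop :=
  ∀ φ : 𝓢(Space d, ℂ), (∀ x, (φ x).im = 0) → (u φ).im = 0

/-- The tempered distribution `u` is (integration against) the locally integrable function `g`.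
The integrability of `φ g` holds automatically for the `g` of finite weighted `L²` norm below. -/
def IsGivenBy {d : ℕ} (u : 𝓢'(Space d, ℂ)) (g : Space d → ℂ) : Prop :=
  LocallyIntegrable g ∧
    ∀ φ : 𝓢(Space d, ℂ), Integrable (fun x => φ x * g x) ∧ u φ = ∫ x, φ x * g x

theorem IsRealDist.zero {d : ℕ} : IsRealDist (0 : 𝓢'(Space d, ℂ)) := by
  intro φ _
  simp

theorem IsRealDist.add {d : ℕ} {u v : 𝓢'(Space d, ℂ)} (hu : IsRealDist u) (hv : IsRealDist v) :
    IsRealDist (u + v) := by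
  intro φ hφ
  simp [hu φ hφ, hv φ hφ]

theorem IsRealDist.smul {d : ℕ} {u : 𝓢'(Space d, ℂ)} (hu : IsRealDist u) (c : ℝ) :
    IsRealDist (c • u) := by
  intro φ hφ
  simp [hu φ hφ]

theorem IsGivenBy.zero {d : ℕ} : IsGivenBy (0 : 𝓢'(Space d, ℂ)) 0 :=
  ⟨locallyIntegrable_zero, fun φ => by simp⟩

theorem IsGivenBy.add {d : ℕ} {u v : 𝓢'(Space d, ℂ)} {f g : Space d → ℂ}
    (hu : IsGivenBy u f) (hv : IsGivenBy v g) : IsGivenBy (u + v) (f + g) := by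
  refine ⟨hu.1.add hv.1, fun φ => ?_⟩
  have h : (fun x => φ x * (f + g) x) = (fun x => φ x * f x) + fun x => φ x * g x := by
    funext x
    simp [mul_add]
  rw [h]
  refine ⟨(hu.2 φ).1.add (hv.2 φ).1, ?_⟩
  rw [integral_add' (hu.2 φ).1 (hv.2 φ).1, ← (hu.2 φ).2, ← (hv.2 φ).2]
  rfl

theorem IsGivenBy.smul {d : ℕ} {u : 𝓢'(Space d, ℂ)} {f : Space d → ℂ}
    (hu : IsGivenBy u f) (c : ℝ) : IsGivenBy (c • u) (c • f) := by
  refine ⟨hu.1.smul c, fun φ => ?_⟩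
  have h : (fun x => φ x * (c • f) x) = c • fun x => φ x * f x := by
    funext x
    simp [mul_left_comm]
  rw [h]
  refine ⟨(hu.2 φ).1.smul c, ?_⟩
  have e : ∫ x, (c • fun x => φ x * f x) x = c • ∫ x, φ x * f x := integral_smul c _
  rw [e, ← (hu.2 φ).2]
  rfl

theorem IsGivenBy.ae_eq {d : ℕ} {u : 𝓢'(Space d, ℂ)} {f g : Space d → ℂ}
    (hf : IsGivenBy u f) (hg : IsGivenBy u g) : f =ᵐ[volume] g := by
  refine ae_eq_of_integral_contDiff_smul_eq hf.1 hg.1 fun φ hφ hc => ?_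
  have h₁ : HasCompactSupport (Complex.ofRealCLM ∘ φ) := hc.comp_left rfl
  have h₂ : ContDiff ℝ ∞ (Complex.ofRealCLM ∘ φ) := by fun_prop
  have e₁ := (hf.2 (h₁.toSchwartzMap h₂)).2
  have e₂ := (hg.2 (h₁.toSchwartzMap h₂)).2
  simpa using e₁.symm.trans e₂

theorem fourier_real_smul {d : ℕ} (c : ℝ) (u : 𝓢'(Space d, ℂ)) : 𝓕 (c • u) = c • 𝓕 u := by
  ext φ
  simp [TemperedDistribution.fourier_apply]

/-! ### The real Sobolev space `Hˢ(ℝᵈ)` -/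

/-- The real tempered distributions in the `L²`-based Sobolev space of order `s`. -/
def sobolevSubmodule (d : ℕ) (s : ℝ) : Submodule ℝ 𝓢'(Space d, ℂ) where
  carrier := {u | IsRealDist u ∧ MemSobolev s 2 u}
  add_mem' hu hv := ⟨hu.1.add hv.1, hu.2.add hv.2⟩
  zero_mem' := ⟨IsRealDist.zero, memSobolev_fun_zero _ _ s 2⟩
  smul_mem' c u hu := ⟨hu.1.smul c, by
    have h := hu.2.smul (c : ℂ)
    have e : (c : ℂ) • u = c • u := by
      ext φ
      simp
    rwa [e] at h⟩

/-- The space `Hˢ(ℝᵈ)` of real-valued functions (or distributions). -/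
def Sobolev (d : ℕ) (s : ℝ) : Type := sobolevSubmodule d s

instance (d : ℕ) (s : ℝ) : AddCommGroup (Sobolev d s) :=
  inferInstanceAs (AddCommGroup (sobolevSubmodule d s))

instance (d : ℕ) (s : ℝ) : Module ℝ (Sobolev d s) :=
  inferInstanceAs (Module ℝ (sobolevSubmodule d s))

/-- The underlying tempered distribution. -/
def Sobolev.dist {d : ℕ} {s : ℝ} (u : Sobolev d s) : 𝓢'(Space d, ℂ) := u.1

theorem toTemperedDistribution_injective {d : ℕ} :
    Function.Injective
      (Lp.toTemperedDistributionCLM ℂ (volume : Measure (Space d)) 2) :=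
  LinearMap.ker_eq_bot.1 Lp.ker_toTemperedDistributionCLM_eq_bot

/-- The `L²` function `⟨D⟩ˢ u`. -/
def Sobolev.bessel {d : ℕ} {s : ℝ} : Sobolev d s →ₗ[ℝ] Lp ℂ 2 (volume : Measure (Space d)) where
  toFun u := u.2.2.choose
  map_add' u v := by
    apply toTemperedDistribution_injective
    simp only [map_add, Lp.toTemperedDistributionCLM_apply]
    rw [← (u + v).2.2.choose_spec, ← u.2.2.choose_spec, ← v.2.2.choose_spec, ← map_add]
    rfl
  map_smul' c u := by
    apply toTemperedDistribution_injective
    simp only [RingHom.id_apply]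
    rw [ContinuousLinearMap.map_smul_of_tower]
    simp only [Lp.toTemperedDistributionCLM_apply]
    rw [← (c • u).2.2.choose_spec, ← u.2.2.choose_spec,
      ← ContinuousLinearMap.map_smul_of_tower]
    rfl

theorem Sobolev.bessel_spec {d : ℕ} {s : ℝ} (u : Sobolev d s) :
    besselPotential (Space d) ℂ s u.dist = (Sobolev.bessel u : 𝓢'(Space d, ℂ)) :=
  u.2.2.choose_spec

theorem Sobolev.bessel_injective {d : ℕ} {s : ℝ} :
    Function.Injective (Sobolev.bessel : Sobolev d s →ₗ[ℝ] _) := by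
  intro u v h
  have e : besselPotential (Space d) ℂ s u.dist = besselPotential (Space d) ℂ s v.dist := by
    rw [Sobolev.bessel_spec, Sobolev.bessel_spec, h]
  apply Subtype.ext
  have e' := congrArg (besselPotential (Space d) ℂ (-s)) e
  simp only [besselPotential_besselPotential_apply, add_neg_cancel, besselPotential_zero,
    ContinuousLinearMap.id_apply] at e'
  exact e'

/-- The Sobolev norm `‖u‖ = ‖⟨D⟩ˢ u‖` in `L²`. -/
instance (d : ℕ) (s : ℝ) : NormedAddCommGroup (Sobolev d s) :=
  NormedAddCommGroup.induced _ _ (Sobolev.bessel : Sobolev d s →ₗ[ℝ] _) Sobolev.bessel_injective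

instance (d : ℕ) (s : ℝ) : NormedSpace ℝ (Sobolev d s) :=
  NormedSpace.induced ℝ _ _ (Sobolev.bessel : Sobolev d s →ₗ[ℝ] _)

/-! ### The anisotropic Sobolev space `ℋˢ(ℝᵈ)` -/

open scoped Classical in
/-- The weight `|ξ|⁻² (ξ₁² + |ξ|⁴)` for `|ξ| < 1` and `⟨ξ⟩²ˢ` for `|ξ| ≥ 1`. -/
def anisoWeight (d : ℕ) [NeZero d] (s : ℝ) (ξ : Space d) : ℝ :=
  if ‖ξ‖ < 1 then (‖ξ‖ ^ 2)⁻¹ * ((ξ 0) ^ 2 + ‖ξ‖ ^ 4) else (1 + ‖ξ‖ ^ 2) ^ s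

theorem anisoWeight_nonneg (d : ℕ) [NeZero d] (s : ℝ) (ξ : Space d) : 0 ≤ anisoWeight d s ξ := by
  unfold anisoWeight
  split_ifs <;> positivity

theorem anisoWeight_pos (d : ℕ) [NeZero d] (s : ℝ) {ξ : Space d} (hξ : ξ ≠ 0) :
    0 < anisoWeight d s ξ := by
  have : 0 < ‖ξ‖ := norm_pos_iff.2 hξ
  unfold anisoWeight
  split_ifs <;> positivity

/-- The real tempered distributions `u` whose Fourier transform is a locally integrable function
`g` with `∫ w |g|² < ∞`, where `w` is the anisotropic weight. -/
def anisoSubmodule (d : ℕ) [NeZero d] (s : ℝ) : Submodule ℝ 𝓢'(Space d, ℂ) where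
  carrier := {u | IsRealDist u ∧ ∃ g : Space d → ℂ, IsGivenBy (𝓕 u) g ∧
    MemLp (fun ξ => (√(anisoWeight d s ξ) : ℂ) * g ξ) 2 volume}
  add_mem' := by
    rintro u v ⟨hu, f, hf, hf'⟩ ⟨hv, g, hg, hg'⟩
    refine ⟨hu.add hv, f + g, ?_, ?_⟩
    · rw [FourierTransform.fourier_add]
      exact hf.add hg
    · convert hf'.add hg' using 1
      funext ξ
      simp [mul_add]
  zero_mem' := by
    refine ⟨IsRealDist.zero, 0, ?_, ?_⟩
    · rw [FourierTransform.fourier_zero]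
      exact IsGivenBy.zero
    · simp
  smul_mem' := by
    rintro c u ⟨hu, f, hf, hf'⟩
    refine ⟨hu.smul c, c • f, ?_, ?_⟩
    · rw [fourier_real_smul]
      exact hf.smul c
    · convert hf'.const_smul c using 1
      funext ξ
      simp [mul_left_comm]

/-- The anisotropic Sobolev space `ℋˢ(ℝᵈ)` of real-valued functions. -/
def Aniso (d : ℕ) [NeZero d] (s : ℝ) : Type := anisoSubmodule d s

instance (d : ℕ) [NeZero d] (s : ℝ) : AddCommGroup (Aniso d s) :=
  inferInstanceAs (AddCommGroup (anisoSubmodule d s))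

instance (d : ℕ) [NeZero d] (s : ℝ) : Module ℝ (Aniso d s) :=
  inferInstanceAs (Module ℝ (anisoSubmodule d s))

/-- The underlying tempered distribution. -/
def Aniso.dist {d : ℕ} [NeZero d] {s : ℝ} (u : Aniso d s) : 𝓢'(Space d, ℂ) := u.1

/-- The Fourier transform of `u`, as a function. -/
def Aniso.fourier {d : ℕ} [NeZero d] {s : ℝ} (u : Aniso d s) : Space d → ℂ := u.2.2.choose

theorem Aniso.fourier_spec {d : ℕ} [NeZero d] {s : ℝ} (u : Aniso d s) :
    IsGivenBy (𝓕 u.dist) u.fourier := u.2.2.choose_spec.1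

theorem Aniso.memLp {d : ℕ} [NeZero d] {s : ℝ} (u : Aniso d s) :
    MemLp (fun ξ => (√(anisoWeight d s ξ) : ℂ) * u.fourier ξ) 2 volume :=
  u.2.2.choose_spec.2

theorem Aniso.fourier_add {d : ℕ} [NeZero d] {s : ℝ} (u v : Aniso d s) :
    (u + v).fourier =ᵐ[volume] u.fourier + v.fourier := by
  have h := u.fourier_spec.add v.fourier_spec
  rw [← FourierTransform.fourier_add] at h
  exact (u + v).fourier_spec.ae_eq h

theorem Aniso.fourier_smul {d : ℕ} [NeZero d] {s : ℝ} (c : ℝ) (u : Aniso d s) :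
    (c • u).fourier =ᵐ[volume] c • u.fourier := by
  have h := u.fourier_spec.smul c
  rw [← fourier_real_smul] at h
  exact (c • u).fourier_spec.ae_eq h

/-- The `L²` function `√w 𝓕u`. -/
def Aniso.weighted {d : ℕ} [NeZero d] {s : ℝ} :
    Aniso d s →ₗ[ℝ] Lp ℂ 2 (volume : Measure (Space d)) where
  toFun u := u.memLp.toLp _
  map_add' u v := by
    rw [← MemLp.toLp_add, MemLp.toLp_eq_toLp_iff]
    filter_upwards [Aniso.fourier_add u v] with ξ h
    simp [h, mul_add]
  map_smul' c u := by
    rw [RingHom.id_apply, ← MemLp.toLp_const_smul, MemLp.toLp_eq_toLp_iff]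
    filter_upwards [Aniso.fourier_smul c u] with ξ h
    simp [h, mul_left_comm]

theorem Aniso.weighted_injective {d : ℕ} [NeZero d] {s : ℝ} :
    Function.Injective (Aniso.weighted : Aniso d s →ₗ[ℝ] _) := by
  intro u v h
  have h' := (MemLp.toLp_eq_toLp_iff u.memLp v.memLp).1 h
  have h0 : ∀ᵐ ξ : Space d, ξ ≠ 0 := by simp [ae_iff]
  have e : u.fourier =ᵐ[volume] v.fourier := by
    filter_upwards [h', h0] with ξ h₁ h₂
    have : (√(anisoWeight d s ξ) : ℂ) ≠ 0 := by
      exact_mod_cast (Real.sqrt_pos.2 (anisoWeight_pos d s h₂)).ne'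
    exact mul_left_cancel₀ this h₁
  apply Subtype.ext
  have e' : 𝓕 u.dist = 𝓕 v.dist := by
    ext φ
    rw [(u.fourier_spec.2 φ).2, (v.fourier_spec.2 φ).2]
    apply integral_congr_ae
    filter_upwards [e] with ξ h₁
    rw [h₁]
  have := congrArg (fun z => 𝓕⁻ z) e'
  simp only [FourierTransform.fourierInv_fourier_eq] at this
  exact this

/-- The anisotropic norm `‖u‖ = (∫ w |𝓕u|²)^{1/2}`. -/
instance (d : ℕ) [NeZero d] (s : ℝ) : NormedAddCommGroup (Aniso d s) :=
  NormedAddCommGroup.induced _ _ (Aniso.weighted : Aniso d s →ₗ[ℝ] _) Aniso.weighted_injective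

instance (d : ℕ) [NeZero d] (s : ℝ) : NormedSpace ℝ (Aniso d s) :=
  NormedSpace.induced ℝ _ _ (Aniso.weighted : Aniso d s →ₗ[ℝ] _)

theorem Aniso.norm_sq_eq {d : ℕ} [NeZero d] {s : ℝ} (u : Aniso d s) :
    ‖u‖ ^ 2 = ∫ ξ, anisoWeight d s ξ * ‖u.fourier ξ‖ ^ 2 := by
  have h : ‖u‖ = ‖Aniso.weighted u‖ := rfl
  have h2 : ‖Aniso.weighted u‖ ^ 2 = ∫ ξ, ‖Aniso.weighted u ξ‖ ^ 2 := by
    have := L2.inner_def (𝕜 := ℂ) (Aniso.weighted u) (Aniso.weighted u)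
    have e := congrArg Complex.re this
    rw [inner_self_eq_norm_sq_to_K] at e
    have e2 : (∫ ξ, inner ℂ (Aniso.weighted u ξ) (Aniso.weighted u ξ)) =
        ((∫ ξ, ‖Aniso.weighted u ξ‖ ^ 2 : ℝ) : ℂ) := by
      rw [← integral_complex_ofReal]
      congr 1
      funext ξ
      rw [inner_self_eq_norm_sq_to_K]
      simp
    rw [e2] at e
    simpa [← Complex.ofReal_pow] using e
  rw [h, h2]
  apply integral_congr_ae
  filter_upwards [u.memLp.coeFn_toLp] with ξ hξ
  have hξ' : Aniso.weighted u ξ = (√(anisoWeight d s ξ) : ℂ) * u.fourier ξ := hξ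
  rw [hξ', norm_mul, mul_pow, Complex.norm_real, Real.norm_eq_abs, sq_abs,
    Real.sq_sqrt (anisoWeight_nonneg d s ξ)]

/-! ### Data, unknowns, and the traveling shallow water system -/

/-- The physical parameters `(γ, μ, σ)`. -/
abbrev Params : Type := ℝ × ℝ × ℝ

/-- The data `(γ, μ, σ, {τᵢ}, {φᵢ})` with `τᵢ ∈ Hˢ(ℝᵈ; ℝᵈˣᵈ)`, `φᵢ ∈ Hˢ(ℝᵈ; ℝᵈ)`, `0 ≤ i ≤ ℓ`. -/
abbrev Data (d ℓ : ℕ) (s : ℝ) : Type :=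
  Params × (Fin (ℓ + 1) → Fin d → Fin d → Sobolev d s) × (Fin (ℓ + 1) → Fin d → Sobolev d s)

/-- The unknowns `(v, η) ∈ H²⁺ˢ(ℝᵈ; ℝᵈ) × ℋ³⁺ˢ(ℝᵈ)`. -/
abbrev Unknowns (d : ℕ) [NeZero d] (s : ℝ) : Type :=
  (Fin d → Sobolev d (2 + s)) × Aniso d (3 + s)

/-- The partial derivative `∂ⱼ f`. -/
def pd {d : ℕ} (j : Fin d) (f : Space d → ℝ) (x : Space d) : ℝ :=
  fderiv ℝ f x (EuclideanSpace.single j 1)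

/-- The divergence `∇·X`. -/
def div {d : ℕ} (X : Fin d → Space d → ℝ) (x : Space d) : ℝ := ∑ j, pd j (X j) x

/-- The Laplacian `Δf`. -/
def lap {d : ℕ} (f : Space d → ℝ) (x : Space d) : ℝ := ∑ j, pd j (pd j f) x

/-- The `(i, j)` entry of the viscous stress `𝕊v = ∇v + ∇vᵗ + 2(∇·v)I`. -/
def stress {d : ℕ} (v : Fin d → Space d → ℝ) (i j : Fin d) (x : Space d) : ℝ :=
  pd j (v i) x + pd i (v j) x + if i = j then 2 * div v x else 0

/-- The components of the relative velocity `v - γe₁`. -/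
def relVel {d : ℕ} [NeZero d] (γ : ℝ) (v : Fin d → Space d → ℝ) (j : Fin d) (x : Space d) : ℝ :=
  v j x - if j = 0 then γ else 0

/-- The `i`-th component of the forcing `∑ₖ ηᵏ(τₖ∇η + φₖ)`. -/
def forcing {d ℓ : ℕ} (τ : Fin (ℓ + 1) → Fin d → Fin d → Space d → ℝ)
    (φ : Fin (ℓ + 1) → Fin d → Space d → ℝ) (η : Space d → ℝ) (i : Fin d) (x : Space d) : ℝ :=
  ∑ k : Fin (ℓ + 1), η x ^ (k : ℕ) * (∑ j, τ k i j x * pd j η x + φ k i x)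

/-- The traveling shallow water system holds at every point:
`∇·((1+η)(v-γe₁)) = 0` and
`(1+η)(v-γe₁)·∇v + v - μ²∇·((1+η)𝕊v) + (1+η)(I-σ²Δ)∇η + ∑ₖ ηᵏ(τₖ∇η + φₖ) = 0`. -/
def System {d ℓ : ℕ} [NeZero d] (γ μ σ : ℝ) (τ : Fin (ℓ + 1) → Fin d → Fin d → Space d → ℝ)
    (φ : Fin (ℓ + 1) → Fin d → Space d → ℝ) (v : Fin d → Space d → ℝ) (η : Space d → ℝ) : Prop :=
  (∀ x, div (fun j y => (1 + η y) * relVel γ v j y) x = 0) ∧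
  ∀ i x, (1 + η x) * ∑ j, relVel γ v j x * pd j (v i) x + v i x
    - μ ^ 2 * div (fun j y => (1 + η y) * stress v i j y) x
    + (1 + η x) * (pd i η x - σ ^ 2 * lap (pd i η) x)
    + forcing τ φ η i x = 0

/-- The continuous real function `f` represents the distribution `u`. -/
def Represents {d : ℕ} (f : Space d → ℝ) (u : 𝓢'(Space d, ℂ)) : Prop :=
  Continuous f ∧ IsGivenBy u fun x => (f x : ℂ)

/-- `(v, η)` is a classical solution of the traveling shallow water system with the data `D`:
the distributions are represented by functions `v` of class `C²`, `η` of class `C³`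
and continuous `τᵢ`, `φᵢ`, for which the system holds pointwise. -/
def IsClassicalSolution {d ℓ : ℕ} [NeZero d] {s : ℝ} (D : Data d ℓ s) (w : Unknowns d s) : Prop :=
  ∃ (τ : Fin (ℓ + 1) → Fin d → Fin d → Space d → ℝ) (φ : Fin (ℓ + 1) → Fin d → Space d → ℝ)
    (v : Fin d → Space d → ℝ) (η : Space d → ℝ),
    (∀ k i j, Represents (τ k i j) (D.2.1 k i j).dist) ∧
    (∀ k i, Represents (φ k i) (D.2.2 k i).dist) ∧
    (∀ i, Represents (v i) (w.1 i).dist ∧ ContDiff ℝ 2 (v i)) ∧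
    (Represents η w.2.dist ∧ ContDiff ℝ 3 η) ∧
    System D.1.1 D.1.2.1 D.1.2.2 τ φ v η

/-- The set `(ℝ⁺)³` of admissible parameters `(γ, μ, σ)`. -/
def posParams : Set Params := {p | 0 < p.1 ∧ 0 < p.2.1 ∧ 0 < p.2.2}

end ShallowWater

end

/-!
The system is solved by the implicit function theorem around the rest state `(v, η) = 0`, for all
positive `(γ, μ, σ)` at once.

**Encoding.** All spaces are handled on the Fourier side. A `Weight` is an even function `k` with
`1/k ∈ L²`; the space attached to it consists of the real functions `f` with `k 𝓕f ∈ L²`, and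
`f ↦ k 𝓕f` identifies it with one fixed real Hilbert space `Herm d`, the Hermitian functions in `L²`.
For `r > d/2` both `Hʳ` (`Sobolev.equiv`) and `ℋʳ` (`Aniso.equiv`) are of this kind. For `ℋʳ` in low
dimension the singularity of the weight at the origin has to be integrated, see
`norm_sq_mul_prod_le`. Since `1/k ∈ L²`, the transforms are integrable, an element is represented by
exactly one continuous function `fn k h` (`represents_iff`), and this function is as smooth as the
weight permits (`contDiff_fn`). Hence a classical solution is the same as a zero of an operator
between copies of `Herm d` (`systemH_eq_zero_iff`, `isClassicalSolution_iff`).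

**Smoothness.** Derivatives are Fourier multipliers (`mult`), and products are convolutions, which
are bounded when `kc(x+y) ≤ C (ka(x) + kb(y))` (`conv`). So the operator is a polynomial in bounded
linear and bilinear maps and in `γ, μ, σ`, and is analytic (`contDiff_systemH`).

**Linearization.** The continuity equation takes values in a space of divergences, of weight
`|ξ|⁻¹⟨ξ⟩^{2+s}`. With `D = ∇·v` the linearization at rest reads
`(1 - γ∂₁ - μ²Δ)v - 3μ²∇D + (1 - σ²Δ)∇η = f`, `D - γ∂₁η = g`. Taking the divergence and eliminating
`D` leaves `Mη = ∇·f - (1 - γ∂₁ - 4μ²Δ)g`, where the symbol of `M` is `detSym`. This symbol satisfies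
`|M| ≳ |ξ₁| + |ξ|² + |ξ|⁴`: the anisotropic norm of `η` is exactly what it controls
(`exists_anisoSqrtWeight_mul_norm_le`). The factor `1 - γ∂₁ - μ²Δ` is elliptic, so `v` follows, and
the linearization is an isomorphism (`bijective_linSystem`).

**Gluing.** The implicit function theorem gives branches of solutions near each rest state. They
agree with each other because the solution is unique within a ball whose radius depends continuously
on `(γ, μ, σ)` (`uniqRadius`), and they form one map (`exists_solution_map`).
-/

noncomputable section

namespace ShallowWater

section

open Filter ComplexConjugate

variable {d : ℕ}

/-! ### Hermitian functions on the Fourier side -/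

/-- A function on frequency space is Hermitian if `g(-ξ)` is the conjugate of `g(ξ)` for almost
every `ξ`; these are the Fourier transforms of real-valued functions. -/
def IsHermitianFun (g : Space d → ℂ) : Prop := ∀ᵐ ξ, g (-ξ) = conj (g ξ)

theorem measurePreserving_neg_space :
    MeasurePreserving (fun ξ : Space d => -ξ) volume volume :=
  Measure.measurePreserving_neg volume

theorem ae_neg_of_ae {p : Space d → Prop} (h : ∀ᵐ ξ, p ξ) : ∀ᵐ ξ, p (-ξ) :=
  measurePreserving_neg_space.quasiMeasurePreserving.ae h

theorem IsHermitianFun.congr {f g : Space d → ℂ} (hf : IsHermitianFun f) (h : f =ᵐ[volume] g) :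
    IsHermitianFun g := by
  filter_upwards [hf, h, ae_neg_of_ae h] with ξ h1 h2 h3
  rw [← h3, ← h2, h1]

theorem IsHermitianFun.mul {f g : Space d → ℂ} (hf : IsHermitianFun f) (hg : IsHermitianFun g) :
    IsHermitianFun fun ξ => f ξ * g ξ := by
  filter_upwards [hf, hg] with ξ h1 h2
  rw [h1, h2, map_mul]

/-- The reflection `h ↦ conj (h (-·))` of `L²`. -/
def reflectL2 (d : ℕ) : Lp ℂ 2 (volume : Measure (Space d)) →L[ℝ]
    Lp ℂ 2 (volume : Measure (Space d)) :=
  (Complex.conjCLE : ℂ →L[ℝ] ℂ).compLpL 2 volume ∘L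
    (Lp.compMeasurePreservingₗᵢ ℝ _ (measurePreserving_neg_space (d := d))).toContinuousLinearMap

theorem coeFn_reflectL2 (h : Lp ℂ 2 (volume : Measure (Space d))) :
    reflectL2 d h =ᵐ[volume] fun ξ => conj (h (-ξ)) := by
  have h1 := (Complex.conjCLE : ℂ →L[ℝ] ℂ).coeFn_compLpL (p := 2)
    (Lp.compMeasurePreserving _ (measurePreserving_neg_space (d := d)) h)
  have h2 := Lp.coeFn_compMeasurePreserving h (measurePreserving_neg_space (d := d))
  filter_upwards [h1, h2] with ξ h1 h2
  refine h1.trans ?_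
  rw [h2]
  rfl

/-- The subspace of Hermitian functions. -/
def hermSubmodule (d : ℕ) : Submodule ℝ (Lp ℂ 2 (volume : Measure (Space d))) :=
  (reflectL2 d - ContinuousLinearMap.id ℝ _).ker

theorem mem_hermSubmodule_iff {h : Lp ℂ 2 (volume : Measure (Space d))} :
    h ∈ hermSubmodule d ↔ IsHermitianFun h := by
  have e : h ∈ hermSubmodule d ↔ reflectL2 d h = h := by
    simp [hermSubmodule, sub_eq_zero]
  rw [e, Lp.ext_iff]
  constructor
  · intro H
    filter_upwards [H, coeFn_reflectL2 h] with ξ h1 h2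
    rw [← h1, h2, Complex.conj_conj]
  · intro H
    filter_upwards [H, coeFn_reflectL2 h] with ξ h1 h2
    rw [h2, h1, Complex.conj_conj]

/-- The real Hilbert space of Hermitian square-integrable functions. All function spaces of the
problem are identified with it by multiplying the Fourier transform with a weight. -/
def Herm (d : ℕ) : Type := hermSubmodule d

instance : NormedAddCommGroup (Herm d) := inferInstanceAs (NormedAddCommGroup (hermSubmodule d))

instance : NormedSpace ℝ (Herm d) := inferInstanceAs (NormedSpace ℝ (hermSubmodule d))

instance : CompleteSpace (Herm d) :=
  (ContinuousLinearMap.isClosed_ker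
    (reflectL2 d - ContinuousLinearMap.id ℝ _)).completeSpace_coe

instance : CoeOut (Herm d) (Lp ℂ 2 (volume : Measure (Space d))) := ⟨Subtype.val⟩

theorem isHermitianFun_coe (h : Herm d) :
    IsHermitianFun (h : Lp ℂ 2 (volume : Measure (Space d))) :=
  mem_hermSubmodule_iff.1 h.2

/-- The element of `Herm d` with a given Hermitian representative. -/
def Herm.mk {g : Space d → ℂ} (hg : MemLp g 2 volume) (hs : IsHermitianFun g) : Herm d :=
  ⟨hg.toLp g, mem_hermSubmodule_iff.2 (hs.congr hg.coeFn_toLp.symm)⟩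

theorem Herm.coeFn_mk {g : Space d → ℂ} (hg : MemLp g 2 volume) (hs : IsHermitianFun g) :
    ((Herm.mk hg hs : Herm d) : Lp ℂ 2 (volume : Measure (Space d))) =ᵐ[volume] g :=
  hg.coeFn_toLp

theorem Herm.ext_ae {h h' : Herm d} (e : (h : Lp ℂ 2 (volume : Measure (Space d))) =ᵐ[volume]
    (h' : Lp ℂ 2 (volume : Measure (Space d)))) : h = h' :=
  Subtype.ext (Lp.ext e)

theorem Herm.coe_add (h h' : Herm d) :
    ((h + h' : Herm d) : Lp ℂ 2 (volume : Measure (Space d))) = h + h' := rfl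

theorem Herm.coe_smul (c : ℝ) (h : Herm d) :
    ((c • h : Herm d) : Lp ℂ 2 (volume : Measure (Space d))) =
      c • (h : Lp ℂ 2 (volume : Measure (Space d))) := rfl

theorem Herm.coe_zero : ((0 : Herm d) : Lp ℂ 2 (volume : Measure (Space d))) = 0 := rfl

theorem ae_ne_zero [NeZero d] : ∀ᵐ ξ : Space d, ξ ≠ 0 := by simp [ae_iff]

/-! ### Weights and the associated function spaces -/

/-- An even weight `k` on frequency space with `1/k ∈ L²`. The space attached to it consists of the
functions `f` with `k 𝓕f ∈ L²`; it embeds into the continuous functions as `1/k ∈ L²`. The weight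
may be `0` or singular at the origin. -/
structure Weight (d : ℕ) where
  /-- The underlying function. -/
  toFun : Space d → ℝ
  measurable : Measurable toFun
  even : ∀ ξ, toFun (-ξ) = toFun ξ
  pos : ∀ ξ, ξ ≠ 0 → 0 < toFun ξ
  nonneg : ∀ ξ, 0 ≤ toFun ξ
  memLp_inv : MemLp (fun ξ => (toFun ξ)⁻¹) 2 volume

instance : CoeFun (Weight d) fun _ => Space d → ℝ := ⟨Weight.toFun⟩

/-- The Fourier transform `h / k` of the function encoded by `h` in the space of weight `k`. -/
def hat (k : Weight d) (h : Herm d) (ξ : Space d) : ℂ :=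
  ((k ξ)⁻¹ : ℝ) * (h : Lp ℂ 2 (volume : Measure (Space d))) ξ

theorem integrable_hat (k : Weight d) (h : Herm d) : Integrable (hat k h) := by
  have h1 : MemLp (fun ξ => (((k ξ)⁻¹ : ℝ) : ℂ)) 2 volume := k.memLp_inv.ofReal
  exact h1.integrable_mul (Lp.memLp (h : Lp ℂ 2 (volume : Measure (Space d))))

theorem isHermitianFun_hat (k : Weight d) (h : Herm d) : IsHermitianFun (hat k h) := by
  refine IsHermitianFun.mul (f := fun ξ => (((k ξ)⁻¹ : ℝ) : ℂ)) ?_ (isHermitianFun_coe h)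
  refine Eventually.of_forall fun ξ => ?_
  simp only [k.even, Complex.conj_ofReal]

theorem hat_add (k : Weight d) (h h' : Herm d) :
    hat k (h + h') =ᵐ[volume] fun ξ => hat k h ξ + hat k h' ξ := by
  filter_upwards [Lp.coeFn_add (h : Lp ℂ 2 (volume : Measure (Space d))) h'] with ξ e
  simp only [hat, Herm.coe_add]
  rw [e, Pi.add_apply, mul_add]

theorem hat_smul (k : Weight d) (c : ℝ) (h : Herm d) :
    hat k (c • h) =ᵐ[volume] fun ξ => c * hat k h ξ := by
  filter_upwards [Lp.coeFn_smul c (h : Lp ℂ 2 (volume : Measure (Space d)))] with ξ e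
  simp only [hat, Herm.coe_smul]
  rw [e, Pi.smul_apply, Complex.real_smul]
  ring

theorem hat_zero (k : Weight d) : hat k 0 =ᵐ[volume] 0 := by
  filter_upwards [Lp.coeFn_zero ℂ 2 (volume : Measure (Space d))] with ξ e
  simp only [hat, Herm.coe_zero]
  rw [e]
  simp

theorem hat_injective [NeZero d] (k : Weight d) {h h' : Herm d}
    (e : hat k h =ᵐ[volume] hat k h') : h = h' := by
  apply Herm.ext_ae
  filter_upwards [e, ae_ne_zero] with ξ h1 h2
  have := (k.pos ξ h2).ne'
  refine mul_left_cancel₀ ?_ h1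
  exact_mod_cast inv_ne_zero this

/-! ### Inverse Fourier transforms of integrable functions -/

theorem fourierInv_neg_eq (g : Space d → ℂ) (x : Space d) : 𝓕⁻ g x = 𝓕 g (-x) :=
  Real.fourierInv_eq_fourier_neg g x

theorem continuous_fourierInv {g : Space d → ℂ} (hg : Integrable g) : Continuous (𝓕⁻ g) := by
  have e : 𝓕⁻ g = fun x => 𝓕 g (-x) := funext (fourierInv_neg_eq g)
  rw [e]
  have : Continuous (𝓕 g) :=
    VectorFourier.fourierIntegral_continuous Real.continuous_fourierChar
      (by simpa using continuous_inner) hg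
  exact this.comp continuous_neg

theorem conj_fourierChar (t : ℝ) :
    conj ((Real.fourierChar t : Circle) : ℂ) = ((Real.fourierChar (-t) : Circle) : ℂ) := by
  rw [Real.fourierChar.map_neg_eq_inv, Circle.coe_inv_eq_conj]

theorem IsHermitianFun.conj_fourierInv {g : Space d → ℂ} (hs : IsHermitianFun g) (x : Space d) :
    conj (𝓕⁻ g x) = 𝓕⁻ g x := by
  rw [Real.fourierInv_eq, ← integral_conj, ← integral_neg_eq_self]
  apply integral_congr_ae
  filter_upwards [hs] with ξ h
  simp only [Circle.smul_def, smul_eq_mul, map_mul, inner_neg_left, conj_fourierChar, neg_neg, h,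
    Complex.conj_conj]

theorem fourierInv_add {f g : Space d → ℂ} (hf : Integrable f) (hg : Integrable g) (x : Space d) :
    𝓕⁻ (fun ξ => f ξ + g ξ) x = 𝓕⁻ f x + 𝓕⁻ g x := by
  simp only [Real.fourierInv_eq, smul_add]
  refine integral_add ?_ ?_
  · simpa using (Real.fourierIntegral_convergent_iff (-x)).2 hf
  · simpa using (Real.fourierIntegral_convergent_iff (-x)).2 hg

theorem fourierInv_const_mul (c : ℂ) (f : Space d → ℂ) (x : Space d) :
    𝓕⁻ (fun ξ => c * f ξ) x = c * 𝓕⁻ f x := by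
  simp only [Real.fourierInv_eq, ← integral_const_mul, Circle.smul_def, smul_eq_mul]
  congr 1
  funext ξ
  ring

/-- The real function with Fourier transform `h / k`, as a linear function of `h`. -/
def fn (k : Weight d) : Herm d →ₗ[ℝ] Space d → ℝ where
  toFun h x := (𝓕⁻ (hat k h) x).re
  map_add' h h' := by
    funext x
    rw [Real.fourierInv_congr_ae (hat_add k h h'), fourierInv_add (integrable_hat k h)
      (integrable_hat k h'), Complex.add_re, Pi.add_apply]
  map_smul' c h := by
    funext x
    rw [Real.fourierInv_congr_ae (hat_smul k c h), fourierInv_const_mul, Complex.re_ofReal_mul]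
    rfl

theorem ofReal_fn (k : Weight d) (h : Herm d) (x : Space d) : (fn k h x : ℂ) = 𝓕⁻ (hat k h) x :=
  Complex.conj_eq_iff_re.1 ((isHermitianFun_hat k h).conj_fourierInv x)

theorem continuous_fn (k : Weight d) (h : Herm d) : Continuous (fn k h) :=
  Complex.continuous_re.comp (continuous_fourierInv (integrable_hat k h))

/-- The exchange formula `∫ φ 𝓕⁻g = ∫ 𝓕⁻φ g` for integrable `g` and Schwartz `φ`. -/
theorem integral_mul_fourierInv {g : Space d → ℂ} (hg : Integrable g) (φ : 𝓢(Space d, ℂ)) :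
    ∫ x, φ x * 𝓕⁻ g x = ∫ ξ, (𝓕⁻ φ : 𝓢(Space d, ℂ)) ξ * g ξ := by
  have h := VectorFourier.integral_fourierIntegral_smul_eq_flip (μ := (volume : Measure (Space d)))
    (ν := (volume : Measure (Space d))) (L := -innerₗ (Space d))
    Real.continuous_fourierChar (by simpa [Pi.neg_def] using continuous_inner.neg) φ.integrable hg
  have e : (-innerₗ (Space d)).flip = -innerₗ (Space d) := by
    ext x y
    simp [real_inner_comm]
  rw [e] at h
  simp only [smul_eq_mul] at h
  rw [SchwartzMap.fourierInv_coe]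
  exact h.symm

theorem integrable_schwartz_mul {g : Space d → ℂ} (hg : Integrable g) (φ : 𝓢(Space d, ℂ)) :
    Integrable fun x => φ x * g x := by
  obtain ⟨C, hC⟩ := φ.toBoundedContinuousFunction.isBounded_range.exists_norm_le
  refine hg.bdd_mul φ.continuous.aestronglyMeasurable (c := C) (Eventually.of_forall fun x => ?_)
  exact hC _ ⟨x, rfl⟩

/-- If `𝓕u` is the integrable function `g`, then `u` is the continuous function `𝓕⁻g`. -/
theorem IsGivenBy.fourierInv {u : 𝓢'(Space d, ℂ)} {g : Space d → ℂ} (hg : Integrable g)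
    (h : IsGivenBy (𝓕 u) g) : IsGivenBy u (𝓕⁻ g) := by
  have hc := continuous_fourierInv hg
  refine ⟨hc.locallyIntegrable, fun φ => ⟨?_, ?_⟩⟩
  · refine φ.integrable.mul_bdd hc.aestronglyMeasurable (c := ∫ ξ, ‖g ξ‖)
      (Eventually.of_forall fun x => ?_)
    exact VectorFourier.norm_fourierIntegral_le_integral_norm _ _ _ _ _
  · rw [integral_mul_fourierInv hg, ← (h.2 _).2, TemperedDistribution.fourier_apply,
      FourierTransform.fourier_fourierInv_eq]

theorem IsGivenBy.congr {u : 𝓢'(Space d, ℂ)} {f g : Space d → ℂ} (hf : IsGivenBy u f)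
    (h : f =ᵐ[volume] g) : IsGivenBy u g := by
  refine ⟨hf.1.congr h, fun φ => ?_⟩
  have e : (fun x => φ x * f x) =ᵐ[volume] fun x => φ x * g x := by
    filter_upwards [h] with x hx
    rw [hx]
  exact ⟨(hf.2 φ).1.congr e, (hf.2 φ).2.trans (integral_congr_ae e)⟩

/-- An integrable function whose inverse Fourier transform vanishes is zero. -/
theorem ae_eq_zero_of_fourierInv_eq_zero {g : Space d → ℂ} (hg : Integrable g)
    (h : ∀ x, 𝓕⁻ g x = 0) : g =ᵐ[volume] 0 := by
  have h1 : IsGivenBy (0 : 𝓢'(Space d, ℂ)) g := by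
    refine ⟨hg.locallyIntegrable, fun φ => ⟨integrable_schwartz_mul hg φ, ?_⟩⟩
    have := integral_mul_fourierInv hg (𝓕 φ)
    simp only [h, mul_zero, integral_zero, FourierTransform.fourierInv_fourier_eq] at this
    rw [← this]
    rfl
  exact h1.ae_eq IsGivenBy.zero

theorem fn_eq_zero_iff [NeZero d] (k : Weight d) {h : Herm d} : (∀ x, fn k h x = 0) ↔ h = 0 := by
  constructor
  · intro H
    refine hat_injective k (EventuallyEq.trans ?_ (hat_zero k).symm)
    refine ae_eq_zero_of_fourierInv_eq_zero (integrable_hat k h) fun x => ?_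
    rw [← ofReal_fn, H, Complex.ofReal_zero]
  · rintro rfl x
    rw [map_zero, Pi.zero_apply]

/-- A distribution whose Fourier transform is `h / k` is represented by `fn k h` only. -/
theorem represents_iff {u : 𝓢'(Space d, ℂ)} {k : Weight d} {h : Herm d}
    (hu : IsGivenBy (𝓕 u) (hat k h)) {f : Space d → ℝ} : Represents f u ↔ f = fn k h := by
  have h1 : IsGivenBy u fun x => (fn k h x : ℂ) := by
    simp only [ofReal_fn]
    exact hu.fourierInv (integrable_hat k h)
  constructor
  · rintro ⟨hc, hf⟩
    have e := hf.ae_eq h1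
    have e' := Continuous.ae_eq_iff_eq volume (Complex.continuous_ofReal.comp hc)
      (Complex.continuous_ofReal.comp (continuous_fn k h)) |>.1 e
    funext x
    exact Complex.ofReal_injective (congrFun e' x)
  · rintro rfl
    exact ⟨continuous_fn k h, h1⟩

end

section

open Filter ComplexConjugate

variable {d : ℕ}

/-! ### Fourier multipliers -/

/-- `m` is the symbol of a bounded real Fourier multiplier from the space of weight `k` to the space
of weight `k'`. -/
structure IsMult (k k' : Weight d) (m : Space d → ℂ) : Prop where
  measurable : Measurable m
  herm : ∀ ξ, m (-ξ) = conj (m ξ)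
  bound : ∃ C, ∀ ξ, ξ ≠ 0 → k' ξ * ‖m ξ‖ ≤ C * k ξ

theorem memLp_mult [NeZero d] {k k' : Weight d} {m : Space d → ℂ} (hm : IsMult k k' m)
    (h : Herm d) : MemLp (fun ξ => (k' ξ : ℂ) * (m ξ * hat k h ξ)) 2 volume := by
  obtain ⟨C, hC⟩ := hm.bound
  refine MemLp.of_le_mul (c := C) (Lp.memLp (h : Lp ℂ 2 (volume : Measure (Space d)))) ?_ ?_
  · exact (Complex.measurable_ofReal.comp k'.measurable).aestronglyMeasurable.mul
      (hm.measurable.aestronglyMeasurable.mul (integrable_hat k h).1)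
  · filter_upwards [ae_ne_zero] with ξ hξ
    have hk := k.pos ξ hξ
    rw [hat, norm_mul, norm_mul, norm_mul, Complex.norm_real, Complex.norm_real, norm_inv,
      Real.norm_of_nonneg (k'.nonneg ξ), Real.norm_of_nonneg hk.le]
    calc k' ξ * (‖m ξ‖ * ((k ξ)⁻¹ * ‖(h : Lp ℂ 2 (volume : Measure (Space d))) ξ‖))
        = (k' ξ * ‖m ξ‖) * ((k ξ)⁻¹ * ‖(h : Lp ℂ 2 (volume : Measure (Space d))) ξ‖) := by ring
      _ ≤ (C * k ξ) * ((k ξ)⁻¹ * ‖(h : Lp ℂ 2 (volume : Measure (Space d))) ξ‖) :=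
        mul_le_mul_of_nonneg_right (hC ξ hξ) (by positivity)
      _ = _ := by field_simp

theorem isHermitianFun_mult {k k' : Weight d} {m : Space d → ℂ} (hm : IsMult k k' m)
    (h : Herm d) : IsHermitianFun fun ξ => m ξ * hat k h ξ :=
  IsHermitianFun.mul (Eventually.of_forall hm.herm) (isHermitianFun_hat k h)

theorem isHermitianFun_weight_mul (k : Weight d) {g : Space d → ℂ} (hg : IsHermitianFun g) :
    IsHermitianFun fun ξ => (k ξ : ℂ) * g ξ :=
  IsHermitianFun.mul (f := fun ξ => (k ξ : ℂ))
    (Eventually.of_forall fun ξ => by simp only [k.even, Complex.conj_ofReal]) hg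

/-- The element `k' m hat k h` of `Herm d`. -/
def multFun [NeZero d] {k k' : Weight d} {m : Space d → ℂ} (hm : IsMult k k' m) (h : Herm d) :
    Herm d :=
  Herm.mk (memLp_mult hm h) (isHermitianFun_weight_mul k' (isHermitianFun_mult hm h))

theorem hat_multFun [NeZero d] {k k' : Weight d} {m : Space d → ℂ} (hm : IsMult k k' m)
    (h : Herm d) : hat k' (multFun hm h) =ᵐ[volume] fun ξ => m ξ * hat k h ξ := by
  filter_upwards [Herm.coeFn_mk (memLp_mult hm h)
    (isHermitianFun_weight_mul k' (isHermitianFun_mult hm h)), ae_ne_zero] with ξ h1 h2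
  have : (k' ξ : ℂ) ≠ 0 := by exact_mod_cast (k'.pos ξ h2).ne'
  rw [hat, multFun, h1, Complex.ofReal_inv, inv_mul_cancel_left₀ this]

theorem exists_norm_multFun_le [NeZero d] {k k' : Weight d} {m : Space d → ℂ}
    (hm : IsMult k k' m) : ∃ C, ∀ h, ‖multFun hm h‖ ≤ C * ‖h‖ := by
  obtain ⟨C, hC⟩ := hm.bound
  refine ⟨C, fun h => ?_⟩
  refine Lp.norm_le_mul_norm_of_ae_le_mul ?_
  filter_upwards [Herm.coeFn_mk (memLp_mult hm h)
    (isHermitianFun_weight_mul k' (isHermitianFun_mult hm h)), ae_ne_zero] with ξ h1 hξ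
  have hk := k.pos ξ hξ
  change ‖(multFun hm h : Lp ℂ 2 (volume : Measure (Space d))) ξ‖ ≤
    C * ‖(h : Lp ℂ 2 (volume : Measure (Space d))) ξ‖
  rw [multFun, h1, hat, norm_mul, norm_mul, norm_mul, Complex.norm_real, Complex.norm_real,
    norm_inv, Real.norm_of_nonneg (k'.nonneg ξ), Real.norm_of_nonneg hk.le]
  calc k' ξ * (‖m ξ‖ * ((k ξ)⁻¹ * ‖(h : Lp ℂ 2 (volume : Measure (Space d))) ξ‖))
      = (k' ξ * ‖m ξ‖) * ((k ξ)⁻¹ * ‖(h : Lp ℂ 2 (volume : Measure (Space d))) ξ‖) := by ring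
    _ ≤ (C * k ξ) * ((k ξ)⁻¹ * ‖(h : Lp ℂ 2 (volume : Measure (Space d))) ξ‖) :=
      mul_le_mul_of_nonneg_right (hC ξ hξ) (by positivity)
    _ = _ := by field_simp

/-- The Fourier multiplier with symbol `m` from the space of weight `k` to that of weight `k'`. -/
def mult [NeZero d] {k k' : Weight d} {m : Space d → ℂ} (hm : IsMult k k' m) :
    Herm d →L[ℝ] Herm d :=
  LinearMap.mkContinuousOfExistsBound
    { toFun := multFun hm
      map_add' := fun h h' => by
        apply hat_injective k'
        filter_upwards [hat_multFun hm (h + h'), hat_multFun hm h, hat_multFun hm h', hat_add k h h',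
          hat_add k' (multFun hm h) (multFun hm h')] with ξ h1 h2 h3 h4 h5
        rw [h1, h5, h2, h3, h4, mul_add]
      map_smul' := fun c h => by
        apply hat_injective k'
        filter_upwards [hat_multFun hm (c • h), hat_multFun hm h, hat_smul k c h,
          hat_smul k' c (multFun hm h)] with ξ h1 h2 h3 h4
        rw [RingHom.id_apply, h1, h4, h2, h3, mul_left_comm] }
    (exists_norm_multFun_le hm)

theorem hat_mult [NeZero d] {k k' : Weight d} {m : Space d → ℂ} (hm : IsMult k k' m)
    (h : Herm d) : hat k' (mult hm h) =ᵐ[volume] fun ξ => m ξ * hat k h ξ :=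
  hat_multFun hm h

/-- The symbol `2πiξⱼ` of `∂ⱼ`. -/
def dsym (j : Fin d) (ξ : Space d) : ℂ := (2 * Real.pi * ξ j : ℝ) * Complex.I

theorem measurable_dsym (j : Fin d) : Measurable (dsym (d := d) j) := by
  have : Continuous (dsym (d := d) j) := by
    unfold dsym
    fun_prop
  exact this.measurable

theorem dsym_neg (j : Fin d) (ξ : Space d) : dsym j (-ξ) = conj (dsym j ξ) := by
  simp only [dsym, PiLp.neg_apply, map_mul, Complex.conj_I, Complex.conj_ofReal]
  push_cast
  ring

theorem norm_dsym (j : Fin d) (ξ : Space d) : ‖dsym j ξ‖ = 2 * Real.pi * |ξ j| := by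
  rw [dsym, norm_mul, Complex.norm_I, mul_one, Complex.norm_real, Real.norm_eq_abs, abs_mul,
    abs_of_pos Real.two_pi_pos]

theorem abs_apply_le_norm (ξ : Space d) (j : Fin d) : |ξ j| ≤ ‖ξ‖ := by
  simpa using PiLp.norm_apply_le ξ j

theorem isMult_dsym {k k' : Weight d} {C : ℝ} (h : ∀ ξ, ξ ≠ 0 → k' ξ * ‖ξ‖ ≤ C * k ξ)
    (j : Fin d) : IsMult k k' (dsym j) := by
  refine ⟨measurable_dsym j, dsym_neg j, 2 * Real.pi * C, fun ξ hξ => ?_⟩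
  rw [norm_dsym]
  calc k' ξ * (2 * Real.pi * |ξ j|) = 2 * Real.pi * (k' ξ * |ξ j|) := by ring
    _ ≤ 2 * Real.pi * (k' ξ * ‖ξ‖) := by
      have := mul_le_mul_of_nonneg_left (abs_apply_le_norm ξ j) (k'.nonneg ξ)
      exact mul_le_mul_of_nonneg_left this Real.two_pi_pos.le
    _ ≤ _ := by
      have := mul_le_mul_of_nonneg_left (h ξ hξ) Real.two_pi_pos.le
      linarith

theorem isMult_one {k k' : Weight d} {C : ℝ} (h : ∀ ξ, ξ ≠ 0 → k' ξ ≤ C * k ξ) :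
    IsMult k k' fun _ => 1 :=
  ⟨measurable_const, fun _ => by simp, C, fun ξ hξ => by simpa using h ξ hξ⟩

theorem fn_mult_one [NeZero d] {k k' : Weight d} (hm : IsMult k k' fun _ => 1) (h : Herm d) :
    fn k' (mult hm h) = fn k h := by
  funext x
  apply Complex.ofReal_injective
  rw [ofReal_fn, ofReal_fn]
  refine Real.fourierInv_congr_ae ?_ x
  filter_upwards [hat_mult hm h] with ξ hξ
  rw [hξ, one_mul]

/-! ### Smoothness and derivatives -/

/-- The functions of the space of weight `k` have `n` continuous derivatives, because `|ξ|ᵐ 𝓕f` is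
integrable for all `m ≤ n`. -/
def Weight.IsSmooth (k : Weight d) (n : ℕ) : Prop :=
  ∀ h : Herm d, ∀ m ≤ n, Integrable fun ξ => ‖ξ‖ ^ m * ‖hat k h ξ‖

theorem Weight.IsSmooth.mono {k : Weight d} {n n' : ℕ} (h : k.IsSmooth n) (hn : n' ≤ n) :
    k.IsSmooth n' := fun g m hm => h g m (hm.trans hn)

theorem Weight.isSmooth [NeZero d] {k : Weight d} {n : ℕ} (k' : Weight d)
    (H : ∀ m, 1 ≤ m → m ≤ n → ∃ C, ∀ ξ, ξ ≠ 0 → k' ξ * ‖ξ‖ ^ m ≤ C * k ξ) : k.IsSmooth n := by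
  intro h m hm
  rcases Nat.eq_zero_or_pos m with rfl | h0
  · simpa using (integrable_hat k h).norm
  · obtain ⟨C, hC⟩ := H m h0 hm
    have hmul : IsMult k k' fun ξ => ((‖ξ‖ ^ m : ℝ) : ℂ) := by
      refine ⟨by fun_prop, fun ξ => by rw [norm_neg, Complex.conj_ofReal], C, fun ξ hξ => ?_⟩
      rw [Complex.norm_real, Real.norm_of_nonneg (by positivity)]
      exact hC ξ hξ
    refine (integrable_hat k' (mult hmul h)).norm.congr ?_
    filter_upwards [hat_mult hmul h] with ξ hξ
    rw [hξ, norm_mul, Complex.norm_real, Real.norm_of_nonneg (by positivity)]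

theorem fn_eq_comp (k : Weight d) (h : Herm d) :
    fn k h = fun x => (𝓕 (hat k h) (-x)).re := by
  funext x
  rw [← fourierInv_neg_eq]
  rfl

theorem contDiff_fn {k : Weight d} {n : ℕ} (hk : k.IsSmooth n) (h : Herm d) :
    ContDiff ℝ n (fn k h) := by
  rw [fn_eq_comp]
  have h1 : ContDiff ℝ n (𝓕 (hat k h)) := by
    refine Real.contDiff_fourier (N := n) fun m hm => hk h m ?_
    exact_mod_cast hm
  exact Complex.reCLM.contDiff.comp (h1.comp contDiff_neg)

theorem differentiable_fn {k : Weight d} (hk : k.IsSmooth 1) (h : Herm d) :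
    Differentiable ℝ (fn k h) :=
  (contDiff_fn hk h).differentiable (by norm_num)

theorem pd_fn [NeZero d] {k k' : Weight d} (hk : k.IsSmooth 1) {j : Fin d}
    (hm : IsMult k k' (dsym j)) (h : Herm d) : pd j (fn k h) = fn k' (mult hm h) := by
  funext x
  have hi : Integrable fun ξ => ‖ξ‖ * ‖hat k h ξ‖ := by simpa using hk h 1 le_rfl
  have h1 := Real.hasFDerivAt_fourier (integrable_hat k h) hi (-x)
  have h2 := Complex.reCLM.hasFDerivAt.comp x (h1.comp x (hasFDerivAt_id x).neg)
  have e : fn k h = Complex.reCLM ∘ 𝓕 (hat k h) ∘ Neg.neg := fn_eq_comp k h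
  have hi' : Integrable (VectorFourier.fourierSMulRight (innerSL ℝ) (hat k h)) := by
    refine (hi.const_mul (2 * Real.pi * ‖(innerSL ℝ : Space d →L[ℝ] Space d →L[ℝ] ℝ)‖)).mono'
      (integrable_hat k h).1.fourierSMulRight (Eventually.of_forall fun ξ => ?_)
    refine (VectorFourier.norm_fourierSMulRight_le _ _ _).trans_eq ?_
    ring
  rw [pd, e, h2.fderiv]
  simp only [ContinuousLinearMap.comp_apply, neg_apply,
    ContinuousLinearMap.id_apply, Complex.reCLM_apply]
  rw [Real.fourier_continuousLinearMap_apply hi', ← fourierInv_neg_eq]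
  change _ = (𝓕⁻ (hat k' (mult hm h)) x).re
  congr 1
  refine Real.fourierInv_congr_ae ?_ x
  filter_upwards [hat_mult hm h] with ξ hξ
  rw [hξ, VectorFourier.fourierSMulRight_apply]
  have hj : innerSL ℝ ξ (EuclideanSpace.single j 1) = ξ j := by
    rw [innerSL_apply_apply]
    simp [EuclideanSpace.inner_single_right]
  simp only [map_neg, hj, dsym, neg_smul, Complex.real_smul, smul_eq_mul]
  push_cast
  ring

end

section

open Filter ComplexConjugate Convolution

variable {d : ℕ}

/-! ### Products -/

/-- The subadditivity of the weights that makes the pointwise product of functions of the spaces of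
weights `ka` and `kb` an element of the space of weight `kc`. -/
def IsProd (ka kb kc : Weight d) : Prop := ∃ C, ∀ x y, kc (x + y) ≤ C * (ka x + kb y)

/-- The convolution of two transforms, which is the transform of the product. -/
def hatConv (ka kb : Weight d) (f g : Herm d) : Space d → ℂ :=
  hat ka f ⋆[ContinuousLinearMap.mul ℂ ℂ, volume] hat kb g

theorem hatConv_apply (ka kb : Weight d) (f g : Herm d) (z : Space d) :
    hatConv ka kb f g z = ∫ x, hat ka f x * hat kb g (z - x) := rfl

theorem integrable_hatConv (ka kb : Weight d) (f g : Herm d) : Integrable (hatConv ka kb f g) :=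
  (integrable_hat ka f).integrable_convolution _ (integrable_hat kb g)

theorem isHermitianFun_hatConv (ka kb : Weight d) (f g : Herm d) :
    IsHermitianFun (hatConv ka kb f g) := by
  refine Eventually.of_forall fun z => ?_
  rw [hatConv_apply, hatConv_apply, ← integral_conj, ← integral_neg_eq_self]
  apply integral_congr_ae
  have h2 : ∀ᵐ x, hat kb g (-(z - x)) = conj (hat kb g (z - x)) :=
    (quasiMeasurePreserving_sub_left volume z).ae (isHermitianFun_hat kb g)
  filter_upwards [isHermitianFun_hat ka f, h2] with x h1 h2
  rw [h1, map_mul, ← h2]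
  congr 2
  abel

theorem lintegral_inv_sq_lt_top (k : Weight d) : ∫⁻ x, ‖(k x)⁻¹‖ₑ ^ 2 < ⊤ := by
  have := k.memLp_inv.2
  rw [eLpNorm_lt_top_iff_lintegral_rpow_enorm_lt_top (by norm_num) (by norm_num)] at this
  simpa using this

theorem sq_lintegral_mul_le {α : Type*} [MeasurableSpace α] {μ : Measure α} {P Q : α → ℝ≥0∞}
    (hP : AEMeasurable P μ) (hQ : AEMeasurable Q μ) :
    (∫⁻ x, P x * Q x ∂μ) ^ 2 ≤ (∫⁻ x, P x ^ 2 ∂μ) * ∫⁻ x, Q x ^ 2 ∂μ := by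
  have h := ENNReal.lintegral_mul_le_Lp_mul_Lq μ Real.HolderConjugate.two_two hP hQ
  have e : ∀ a : ℝ≥0∞, (a ^ (1 / 2 : ℝ)) ^ 2 = a := fun a => by
    rw [← ENNReal.rpow_natCast, ← ENNReal.rpow_mul]
    norm_num
  calc (∫⁻ x, P x * Q x ∂μ) ^ 2 ≤ _ := pow_le_pow_left' h 2
    _ = _ := by
      rw [mul_pow, e, e]
      simp

theorem kernel_le {ka kb kc : Weight d} {C : ℝ} (hC : 0 ≤ C)
    (h : ∀ x y, kc (x + y) ≤ C * (ka x + kb y)) (x y : Space d) :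
    kc (x + y) * ((ka x)⁻¹ * (kb y)⁻¹) ≤ C * ((ka x)⁻¹ + (kb y)⁻¹) := by
  have ha := ka.nonneg x
  have hb := kb.nonneg y
  rcases ha.eq_or_lt with ha | ha
  · rw [← ha]
    simp only [inv_zero, zero_mul, mul_zero, zero_add]
    positivity
  rcases hb.eq_or_lt with hb | hb
  · rw [← hb]
    simp only [inv_zero, mul_zero, add_zero]
    positivity
  calc kc (x + y) * ((ka x)⁻¹ * (kb y)⁻¹)
      ≤ C * (ka x + kb y) * ((ka x)⁻¹ * (kb y)⁻¹) :=
        mul_le_mul_of_nonneg_right (h x y) (by positivity)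
    _ = _ := by
      field_simp
      ring

theorem enorm_le_ofReal_mul {a b C : ℝ} (ha : 0 ≤ a) (h : a ≤ C * b) (hC : 0 ≤ C) :
    ‖a‖ₑ ≤ ENNReal.ofReal C * ENNReal.ofReal b := by
  rw [← ENNReal.ofReal_mul hC, Real.enorm_of_nonneg ha]
  exact ENNReal.ofReal_le_ofReal h

/-- Cauchy–Schwarz with the kernel `K(x, y) = kc(x+y)/(ka(x)kb(y)) ≤ C (1/ka(x) + 1/kb(y))` and
Tonelli give the boundedness of products. -/
theorem exists_lintegral_conv_le {ka kb kc : Weight d} (h : IsProd ka kb kc) :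
    ∃ C : ℝ≥0∞, C < ⊤ ∧ ∀ f g : Herm d,
      ∫⁻ z, ‖(kc z : ℂ) * hatConv ka kb f g z‖ₑ ^ 2 ≤
        C * ((∫⁻ x, ‖(f : Lp ℂ 2 (volume : Measure (Space d))) x‖ₑ ^ 2) *
          ∫⁻ x, ‖(g : Lp ℂ 2 (volume : Measure (Space d))) x‖ₑ ^ 2) := by
  obtain ⟨C', hC'⟩ := h
  obtain ⟨C, hC0, hC⟩ : ∃ C : ℝ, 0 ≤ C ∧ ∀ x y, kc (x + y) ≤ C * (ka x + kb y) :=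
    ⟨max C' 0, le_max_right _ _, fun x y => (hC' x y).trans
      (mul_le_mul_of_nonneg_right (le_max_left _ _) (add_nonneg (ka.nonneg x) (kb.nonneg y)))⟩
  set A : Space d → ℝ≥0∞ := fun x => ‖(ka x)⁻¹‖ₑ with hA
  set B : Space d → ℝ≥0∞ := fun x => ‖(kb x)⁻¹‖ₑ with hB
  have hAm : Measurable A := ka.measurable.inv.enorm
  have hBm : Measurable B := kb.measurable.inv.enorm
  set c := ENNReal.ofReal C
  refine ⟨c ^ 2 * (2 * ((∫⁻ x, A x ^ 2) + ∫⁻ x, B x ^ 2)), ?_, fun f g => ?_⟩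
  · have h1 := lintegral_inv_sq_lt_top ka
    have h2 := lintegral_inv_sq_lt_top kb
    refine ENNReal.mul_lt_top (by simp [c]) (ENNReal.mul_lt_top (by simp) ?_)
    exact ENNReal.add_lt_top.2 ⟨h1, h2⟩
  set F : Space d → ℝ≥0∞ := fun x => ‖(f : Lp ℂ 2 (volume : Measure (Space d))) x‖ₑ with hF
  set G : Space d → ℝ≥0∞ := fun x => ‖(g : Lp ℂ 2 (volume : Measure (Space d))) x‖ₑ with hG
  have hFm : Measurable F := (Lp.stronglyMeasurable _).measurable.enorm
  have hGm : Measurable G := (Lp.stronglyMeasurable _).measurable.enorm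
  have key : ∀ z, ‖(kc z : ℂ) * hatConv ka kb f g z‖ₑ ^ 2 ≤
      c ^ 2 * (2 * ((∫⁻ x, A x ^ 2) + ∫⁻ x, B x ^ 2)) * ∫⁻ x, F x ^ 2 * G (z - x) ^ 2 := by
    intro z
    have hsub : Measurable fun x : Space d => z - x := measurable_const.sub measurable_id
    have h1 : ‖(kc z : ℂ) * hatConv ka kb f g z‖ₑ ≤
        c * ∫⁻ x, (A x + B (z - x)) * (F x * G (z - x)) := by
      rw [hatConv_apply, ← integral_const_mul]
      refine (enorm_integral_le_lintegral_enorm _).trans ?_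
      rw [← lintegral_const_mul _ (by fun_prop)]
      refine lintegral_mono fun x => ?_
      have e : (kc z : ℂ) * (hat ka f x * hat kb g (z - x)) =
          ((kc z * ((ka x)⁻¹ * (kb (z - x))⁻¹) : ℝ) : ℂ) *
            ((f : Lp ℂ 2 (volume : Measure (Space d))) x *
              (g : Lp ℂ 2 (volume : Measure (Space d))) (z - x)) := by
        simp only [hat]
        push_cast
        ring
      rw [e, enorm_mul, enorm_mul, ← mul_assoc c]
      refine mul_le_mul_left ?_ _
      have h3 := kernel_le hC0 hC x (z - x)
      rw [add_sub_cancel] at h3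
      have hx := ka.nonneg x
      have hy := kb.nonneg (z - x)
      have hz := kc.nonneg z
      have h4 := enorm_le_ofReal_mul (by positivity) h3 hC0
      rw [ENNReal.ofReal_add (by positivity) (by positivity),
        ← Real.enorm_of_nonneg (inv_nonneg.2 hx), ← Real.enorm_of_nonneg (inv_nonneg.2 hy)] at h4
      rwa [← enorm_eq_iff_norm_eq.2 (Complex.norm_real _)] at h4
    calc ‖(kc z : ℂ) * hatConv ka kb f g z‖ₑ ^ 2
        ≤ (c * ∫⁻ x, (A x + B (z - x)) * (F x * G (z - x))) ^ 2 := pow_le_pow_left' h1 2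
      _ ≤ c ^ 2 * ((∫⁻ x, (A x + B (z - x)) ^ 2) * ∫⁻ x, (F x * G (z - x)) ^ 2) := by
        rw [mul_pow]
        gcongr
        exact sq_lintegral_mul_le (by fun_prop) (by fun_prop)
      _ ≤ c ^ 2 * ((2 * ((∫⁻ x, A x ^ 2) + ∫⁻ x, B x ^ 2)) * ∫⁻ x, F x ^ 2 * G (z - x) ^ 2) := by
        simp only [mul_pow]
        gcongr
        calc ∫⁻ x, (A x + B (z - x)) ^ 2 ≤ ∫⁻ x, 2 * (A x ^ 2 + B (z - x) ^ 2) := by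
              refine lintegral_mono fun x => ?_
              have := ENNReal.rpow_add_le_mul_rpow_add_rpow (A x) (B (z - x))
                (p := 2) (by norm_num)
              norm_num at this
              exact this
          _ = _ := by
            rw [lintegral_const_mul _ (by fun_prop), lintegral_add_left (by fun_prop),
              lintegral_sub_left_eq_self (fun y => B y ^ 2) z]
      _ = _ := by ring
  calc ∫⁻ z, ‖(kc z : ℂ) * hatConv ka kb f g z‖ₑ ^ 2
      ≤ ∫⁻ z, c ^ 2 * (2 * ((∫⁻ x, A x ^ 2) + ∫⁻ x, B x ^ 2)) *
          ∫⁻ x, F x ^ 2 * G (z - x) ^ 2 := lintegral_mono key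
    _ = c ^ 2 * (2 * ((∫⁻ x, A x ^ 2) + ∫⁻ x, B x ^ 2)) *
          ∫⁻ z, ∫⁻ x, F x ^ 2 * G (z - x) ^ 2 := by
      rw [lintegral_const_mul]
      exact Measurable.lintegral_prod_right (f := fun z x => F x ^ 2 * G (z - x) ^ 2)
        (by fun_prop)
    _ = _ := by
      congr 1
      rw [lintegral_lintegral_swap (by fun_prop)]
      simp_rw [fun x => lintegral_const_mul (μ := volume) (F x ^ 2)
        (f := fun z => G (z - x) ^ 2) (by fun_prop)]
      simp_rw [fun x => lintegral_sub_right_eq_self (μ := volume) (fun y => G y ^ 2) x]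
      rw [lintegral_mul_const _ (by fun_prop)]

theorem lintegral_enorm_sq (h : Lp ℂ 2 (volume : Measure (Space d))) :
    ∫⁻ x, ‖h x‖ₑ ^ 2 = ‖h‖ₑ ^ 2 := by
  rw [Lp.enorm_def, eLpNorm_eq_lintegral_rpow_enorm_toReal (by norm_num) (by norm_num)]
  rw [← ENNReal.rpow_natCast, ← ENNReal.rpow_mul]
  simp

theorem memLp_hatConv {ka kb kc : Weight d} (h : IsProd ka kb kc) (f g : Herm d) :
    MemLp (fun z => (kc z : ℂ) * hatConv ka kb f g z) 2 volume := by
  refine ⟨(Complex.measurable_ofReal.comp kc.measurable).aestronglyMeasurable.mul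
    (integrable_hatConv ka kb f g).1, ?_⟩
  rw [eLpNorm_lt_top_iff_lintegral_rpow_enorm_lt_top (by norm_num) (by norm_num)]
  obtain ⟨C, hC, H⟩ := exists_lintegral_conv_le h
  have := H f g
  rw [lintegral_enorm_sq, lintegral_enorm_sq] at this
  simp only [ENNReal.toReal_ofNat, ENNReal.rpow_ofNat]
  refine this.trans_lt (ENNReal.mul_lt_top hC (ENNReal.mul_lt_top ?_ ?_)) <;> simp

/-- The element of `Herm d` that encodes the product in the space of weight `kc`. -/
def convFun {ka kb kc : Weight d} (h : IsProd ka kb kc) (f g : Herm d) : Herm d :=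
  Herm.mk (memLp_hatConv h f g) (isHermitianFun_weight_mul kc (isHermitianFun_hatConv ka kb f g))

theorem hat_convFun [NeZero d] {ka kb kc : Weight d} (h : IsProd ka kb kc) (f g : Herm d) :
    hat kc (convFun h f g) =ᵐ[volume] hatConv ka kb f g := by
  filter_upwards [Herm.coeFn_mk (memLp_hatConv h f g)
    (isHermitianFun_weight_mul kc (isHermitianFun_hatConv ka kb f g)), ae_ne_zero] with ξ h1 h2
  have : (kc ξ : ℂ) ≠ 0 := by exact_mod_cast (kc.pos ξ h2).ne'
  rw [hat, convFun, h1, Complex.ofReal_inv, inv_mul_cancel_left₀ this]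

theorem fn_convFun [NeZero d] {ka kb kc : Weight d} (h : IsProd ka kb kc) (f g : Herm d) :
    fn kc (convFun h f g) = fn ka f * fn kb g := by
  funext x
  apply Complex.ofReal_injective
  rw [Pi.mul_apply, Complex.ofReal_mul, ofReal_fn, ofReal_fn, ofReal_fn,
    Real.fourierInv_congr_ae (hat_convFun h f g), fourierInv_neg_eq, fourierInv_neg_eq,
    fourierInv_neg_eq]
  exact Real.fourier_mul_convolution_eq (integrable_hat ka f) (integrable_hat kb g) (-x)

theorem exists_norm_convFun_le {ka kb kc : Weight d} (h : IsProd ka kb kc) :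
    ∃ C, ∀ f g, ‖convFun h f g‖ ≤ C * ‖f‖ * ‖g‖ := by
  obtain ⟨C, hC, H⟩ := exists_lintegral_conv_le h
  refine ⟨√C.toReal, fun f g => ?_⟩
  have h1 := H f g
  have e : ∫⁻ z, ‖(kc z : ℂ) * hatConv ka kb f g z‖ₑ ^ 2 =
      ‖(convFun h f g : Lp ℂ 2 (volume : Measure (Space d)))‖ₑ ^ 2 := by
    rw [← lintegral_enorm_sq]
    apply lintegral_congr_ae
    filter_upwards [Herm.coeFn_mk (memLp_hatConv h f g)
      (isHermitianFun_weight_mul kc (isHermitianFun_hatConv ka kb f g))] with ξ h1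
    rw [convFun, h1]
  rw [e, lintegral_enorm_sq, lintegral_enorm_sq] at h1
  have h2 := ENNReal.toReal_mono (by finiteness) h1
  simp only [ENNReal.toReal_mul, ENNReal.toReal_pow, toReal_enorm] at h2
  refine abs_le_of_sq_le_sq' ?_ (by positivity) |>.2
  rw [mul_pow, mul_pow, Real.sq_sqrt ENNReal.toReal_nonneg, mul_assoc]
  exact h2

/-- A function is determined by its encoding. -/
theorem fn_injective [NeZero d] (k : Weight d) : Function.Injective (fn k) := by
  rw [← LinearMap.ker_eq_bot, LinearMap.ker_eq_bot']
  intro h hh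
  exact (fn_eq_zero_iff k).1 fun x => congrFun hh x

/-- The pointwise product as a bounded bilinear map. -/
def conv [NeZero d] {ka kb kc : Weight d} (h : IsProd ka kb kc) :
    Herm d →L[ℝ] Herm d →L[ℝ] Herm d :=
  LinearMap.mkContinuous₂
    (LinearMap.mk₂ ℝ (convFun h)
      (fun f f' g => fn_injective kc (by simp only [map_add, fn_convFun, add_mul]))
      (fun c f g => fn_injective kc (by simp only [map_smul, fn_convFun, smul_mul_assoc]))
      (fun f g g' => fn_injective kc (by simp only [map_add, fn_convFun, mul_add]))
      (fun c f g => fn_injective kc (by simp only [map_smul, fn_convFun, mul_smul_comm])))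
    (exists_norm_convFun_le h).choose (exists_norm_convFun_le h).choose_spec

theorem fn_conv [NeZero d] {ka kb kc : Weight d} (h : IsProd ka kb kc) (f g : Herm d) :
    fn kc (conv h f g) = fn ka f * fn kb g :=
  fn_convFun h f g

end

section

open Filter ComplexConjugate

variable {d : ℕ}

/-! ### The Japanese bracket -/

/-- The power `⟨ξ⟩ʳ = (1 + |ξ|²)^{r/2}`. -/
def jp (r : ℝ) (ξ : Space d) : ℝ := (1 + ‖ξ‖ ^ 2) ^ (r / 2)

theorem jp_pos (r : ℝ) (ξ : Space d) : 0 < jp r ξ := by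
  unfold jp
  positivity

theorem jp_add (r r' : ℝ) (ξ : Space d) : jp (r + r') ξ = jp r ξ * jp r' ξ := by
  unfold jp
  rw [← Real.rpow_add (by positivity)]
  ring_nf

theorem jp_two (ξ : Space d) : jp 2 ξ = 1 + ‖ξ‖ ^ 2 := by
  simp [jp]

theorem jp_neg (r : ℝ) (ξ : Space d) : jp (-r) ξ = (jp r ξ)⁻¹ := by
  unfold jp
  rw [← Real.rpow_neg (by positivity)]
  ring_nf

theorem jp_sq (r : ℝ) (ξ : Space d) : jp r ξ ^ 2 = (1 + ‖ξ‖ ^ 2) ^ r := by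
  unfold jp
  rw [← Real.rpow_natCast, ← Real.rpow_mul (by positivity)]
  congr 1
  push_cast
  ring

theorem jp_mono {r r' : ℝ} (h : r ≤ r') (ξ : Space d) : jp r ξ ≤ jp r' ξ := by
  refine Real.rpow_le_rpow_of_exponent_le ?_ (by linarith)
  linarith [sq_nonneg ‖ξ‖]

theorem jp_zero (ξ : Space d) : jp 0 ξ = 1 := by simp [jp]

theorem one_le_jp {r : ℝ} (h : 0 ≤ r) (ξ : Space d) : 1 ≤ jp r ξ :=
  (jp_zero ξ).symm.le.trans (jp_mono h ξ)

theorem norm_pow_le_jp (m : ℕ) (ξ : Space d) : ‖ξ‖ ^ m ≤ jp m ξ := by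
  refine abs_le_of_sq_le_sq' ?_ (jp_pos _ _).le |>.2
  rw [jp_sq, Real.rpow_natCast, ← pow_mul, mul_comm, pow_mul]
  gcongr
  linarith

theorem norm_le_jp_one (ξ : Space d) : ‖ξ‖ ≤ jp 1 ξ := by
  simpa using norm_pow_le_jp 1 ξ

theorem jp_mul_norm_pow_le {r r' : ℝ} {m : ℕ} (h : r + m ≤ r') (ξ : Space d) :
    jp r ξ * ‖ξ‖ ^ m ≤ jp r' ξ :=
  calc jp r ξ * ‖ξ‖ ^ m ≤ jp r ξ * jp m ξ :=
        mul_le_mul_of_nonneg_left (norm_pow_le_jp m ξ) (jp_pos _ _).le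
    _ = jp (r + m) ξ := (jp_add _ _ _).symm
    _ ≤ _ := jp_mono h ξ

theorem jp_le_of_norm_lt_one {r : ℝ} (hr : 0 ≤ r) {ξ : Space d} (h : ‖ξ‖ < 1) :
    jp r ξ ≤ 2 ^ (r / 2) := by
  refine Real.rpow_le_rpow (by positivity) ?_ (by linarith)
  nlinarith [norm_nonneg ξ]

theorem jp_neg_symm (r : ℝ) (ξ : Space d) : jp r (-ξ) = jp r ξ := by simp [jp]

theorem continuous_jp (r : ℝ) : Continuous (jp (d := d) r) := by
  unfold jp
  refine Continuous.rpow_const (by fun_prop) fun ξ => Or.inl ?_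
  positivity

theorem jp_add_le_of_le {r : ℝ} (hr : 0 ≤ r) {x y : Space d} (h : ‖x‖ ≤ 1 ∨ ‖x‖ ≤ ‖y‖) :
    jp r (x + y) ≤ 4 ^ (r / 2) * jp r y := by
  unfold jp
  rw [← Real.mul_rpow (by norm_num) (by positivity)]
  refine Real.rpow_le_rpow (by positivity) ?_ (by linarith)
  have h1 : ‖x + y‖ ^ 2 ≤ (‖x‖ + ‖y‖) ^ 2 := by
    gcongr
    exact norm_add_le x y
  have hx := norm_nonneg x
  have hy := norm_nonneg y
  rcases h with h | h
  · nlinarith [sq_nonneg (‖x‖ - ‖y‖)]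
  · nlinarith [sq_nonneg (‖x‖ - ‖y‖)]

theorem memLp_two_of_integrable_sq {f : Space d → ℝ} (hf : AEStronglyMeasurable f volume)
    (h : Integrable fun ξ => f ξ ^ 2) : MemLp f 2 volume :=
  (memLp_two_iff_integrable_sq hf).2 h

theorem integrable_jp {r : ℝ} (hr : (d : ℝ) < r) : Integrable fun ξ : Space d => jp (-r) ξ := by
  have := integrable_rpow_neg_one_add_norm_sq (E := Space d) (μ := volume) (r := r)
    (by simpa using hr)
  exact this

theorem memLp_jp_inv {r : ℝ} (hr : (d : ℝ) / 2 < r) :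
    MemLp (fun ξ : Space d => (jp r ξ)⁻¹) 2 volume := by
  refine memLp_two_of_integrable_sq
    ((continuous_jp r).measurable.inv.aestronglyMeasurable) ?_
  refine (integrable_jp (d := d) (r := 2 * r) (by linarith)).congr (Eventually.of_forall fun ξ => ?_)
  simp only
  rw [two_mul, neg_add, jp_add, jp_neg, sq]

/-- The weight `⟨ξ⟩ʳ` of the Sobolev space `Hʳ`. -/
def sobWeight (r : ℝ) (hr : (d : ℝ) / 2 < r) : Weight d where
  toFun := jp r
  measurable := (continuous_jp r).measurable
  even := jp_neg_symm r
  pos ξ _ := jp_pos r ξ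
  nonneg ξ := (jp_pos r ξ).le
  memLp_inv := memLp_jp_inv hr

/-- The weight `|ξ|⁻¹ ⟨ξ⟩ʳ` of the divergences of vector fields of class `Hʳ`. -/
def divWeight (r : ℝ) (hr : (d : ℝ) / 2 < r - 1) : Weight d where
  toFun ξ := ‖ξ‖⁻¹ * jp r ξ
  measurable := measurable_norm.inv.mul (continuous_jp r).measurable
  even ξ := by rw [norm_neg, jp_neg_symm]
  pos ξ hξ := mul_pos (inv_pos.2 (norm_pos_iff.2 hξ)) (jp_pos r ξ)
  nonneg ξ := mul_nonneg (inv_nonneg.2 (norm_nonneg _)) (jp_pos r ξ).le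
  memLp_inv := by
    refine (memLp_jp_inv hr).mono
      (measurable_norm.inv.mul (continuous_jp r).measurable).inv.aestronglyMeasurable
      (Eventually.of_forall fun ξ => ?_)
    have h0 := jp_pos r ξ
    have h1 := jp_pos (r - 1) ξ
    rw [norm_inv, norm_inv, Real.norm_of_nonneg (by positivity), Real.norm_of_nonneg h1.le, mul_inv,
      inv_inv]
    have h2 : jp r ξ = jp (r - 1) ξ * jp 1 ξ := by rw [← jp_add, sub_add_cancel]
    rw [h2, mul_inv, mul_left_comm]
    refine mul_le_of_le_one_right (inv_nonneg.2 h1.le) ?_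
    rw [← div_eq_mul_inv]
    exact div_le_one_of_le₀ (norm_le_jp_one ξ) (jp_pos 1 ξ).le

/-! ### The anisotropic weight -/

/-- On the unit ball the inverse of the anisotropic weight is at most `∏ᵢ |ξᵢ|^{-3/4}`, a product of
integrable functions of one variable. This gives its integrability in every dimension. -/
theorem norm_sq_mul_prod_le [NeZero d] {ξ : Space d} (h : ‖ξ‖ < 1) :
    ‖ξ‖ ^ 2 * ∏ i, |ξ i| ^ (3 / 4 : ℝ) ≤ ξ 0 ^ 2 + ‖ξ‖ ^ 4 := by
  set t := ‖ξ‖ with ht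
  have hle : ∀ i, |ξ i| ≤ t := fun i => abs_apply_le_norm ξ i
  have ht0 : 0 ≤ t := norm_nonneg ξ
  have hprod : ∀ s : Finset (Fin d), ∏ i ∈ s, |ξ i| ^ (3 / 4 : ℝ) ≤ 1 := fun s =>
    Finset.prod_le_one (fun i _ => by positivity) fun i _ =>
      Real.rpow_le_one (abs_nonneg _) ((hle i).trans h.le) (by norm_num)
  have hnn : ∀ s : Finset (Fin d), 0 ≤ ∏ i ∈ s, |ξ i| ^ (3 / 4 : ℝ) := fun s =>
    Finset.prod_nonneg fun i _ => by positivity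
  set a := |ξ 0| with ha
  have ha0 : 0 ≤ a := abs_nonneg _
  have e0 : ξ 0 ^ 2 = a ^ 2 := (sq_abs _).symm
  rw [e0]
  by_cases hd : ∃ i : Fin d, i ≠ 0
  · obtain ⟨i, hi⟩ := hd
    -- two factors of the product suffice
    have h1 : ∏ i, |ξ i| ^ (3 / 4 : ℝ) ≤ a ^ (3 / 4 : ℝ) * t ^ (3 / 4 : ℝ) := by
      rw [← Finset.mul_prod_erase _ _ (Finset.mem_univ 0),
        ← Finset.mul_prod_erase _ _ (Finset.mem_erase.2 ⟨hi, Finset.mem_univ i⟩)]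
      refine mul_le_mul_of_nonneg_left ?_ (by positivity)
      refine (mul_le_of_le_one_right (by positivity) (hprod _)).trans ?_
      exact Real.rpow_le_rpow (abs_nonneg _) (hle i) (by norm_num)
    have h2 : t ^ 2 * ∏ i, |ξ i| ^ (3 / 4 : ℝ) ≤ t ^ 2 * (a ^ (3 / 4 : ℝ) * t ^ (3 / 4 : ℝ)) :=
      mul_le_mul_of_nonneg_left h1 (by positivity)
    refine h2.trans ?_
    -- with `b = max a t²` the left side is at most `b^{1 + 3/4 + 3/8} ≤ b²`
    set b := max a (t ^ 2) with hb
    have hb0 : 0 ≤ b := le_max_of_le_left ha0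
    have hb1 : b ≤ 1 := max_le ((hle 0).trans h.le) (by nlinarith)
    have htb : t ^ (3 / 4 : ℝ) ≤ b ^ (3 / 8 : ℝ) := by
      have : t ^ (3 / 4 : ℝ) = (t ^ 2) ^ (3 / 8 : ℝ) := by
        rw [← Real.rpow_natCast, ← Real.rpow_mul ht0]
        norm_num
      rw [this]
      exact Real.rpow_le_rpow (by positivity) (le_max_right _ _) (by norm_num)
    have hab : a ^ (3 / 4 : ℝ) ≤ b ^ (3 / 4 : ℝ) :=
      Real.rpow_le_rpow ha0 (le_max_left _ _) (by norm_num)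
    have h3 : a ^ (3 / 4 : ℝ) * t ^ (3 / 4 : ℝ) ≤ b := by
      calc a ^ (3 / 4 : ℝ) * t ^ (3 / 4 : ℝ) ≤ b ^ (3 / 4 : ℝ) * b ^ (3 / 8 : ℝ) :=
            mul_le_mul hab htb (by positivity) (by positivity)
        _ = b ^ (9 / 8 : ℝ) := by
          rw [← Real.rpow_add_of_nonneg hb0 (by norm_num) (by norm_num)]
          norm_num
        _ ≤ b ^ (1 : ℝ) := 
          Real.rpow_le_rpow_of_exponent_ge_of_imp hb0 hb1 (by norm_num) (by norm_num)
        _ = b := Real.rpow_one b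
    have h4 : t ^ 2 * (a ^ (3 / 4 : ℝ) * t ^ (3 / 4 : ℝ)) ≤ b * b :=
      mul_le_mul (le_max_right _ _) h3 (by positivity) hb0
    refine h4.trans ?_
    rcases max_cases a (t ^ 2) with ⟨h5, _⟩ | ⟨h5, _⟩
    · rw [hb, h5]
      nlinarith [pow_nonneg ht0 4]
    · rw [hb, h5]
      nlinarith [sq_nonneg a]
  · push Not at hd
    have hta : t = a := by
      have : (Finset.univ : Finset (Fin d)) = {0} :=
        Finset.eq_singleton_iff_unique_mem.2 ⟨Finset.mem_univ _, fun i _ => hd i⟩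
      rw [ht, EuclideanSpace.norm_eq, this, Finset.sum_singleton, Real.norm_eq_abs,
        Real.sqrt_sq (abs_nonneg _)]
    rw [hta]
    have := mul_le_of_le_one_right (sq_nonneg a) (hprod Finset.univ)
    nlinarith [pow_nonneg ha0 4]

theorem integrable_indicator_rpow :
    Integrable fun x : ℝ => Set.indicator (Set.Iio (1 : ℝ)) (fun t => t ^ (-(3 / 4) : ℝ)) ‖x‖ := by
  rw [integrable_fun_norm_addHaar volume
    (f := Set.indicator (Set.Iio (1 : ℝ)) fun t => t ^ (-(3 / 4) : ℝ))]
  simp only [Module.finrank_self, Nat.sub_self, pow_zero, one_smul]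
  rw [integrableOn_indicator_iff measurableSet_Iio]
  have e : Set.Iio (1 : ℝ) ∩ Set.Ioi 0 = Set.Ioo 0 1 := by
    ext x
    simp [and_comm]
  rw [e]
  exact (intervalIntegral.integrableOn_Ioo_rpow_iff one_pos).2 (by norm_num)

theorem ae_apply_ne_zero (i : Fin d) : ∀ᵐ ξ : Space d, ξ i ≠ 0 := by
  have h := Measure.addHaar_submodule (volume : Measure (Space d))
    (LinearMap.ker (EuclideanSpace.proj i : Space d →L[ℝ] ℝ).toLinearMap) ?_
  · rw [ae_iff]
    convert h using 2
    ext ξ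
    simp
  · intro h
    have : (EuclideanSpace.single i (1 : ℝ) : Space d) ∈
        LinearMap.ker (EuclideanSpace.proj i : Space d →L[ℝ] ℝ).toLinearMap := h ▸ trivial
    simp at this

theorem measurable_anisoWeight [NeZero d] (r : ℝ) : Measurable (anisoWeight d r) := by
  classical
  unfold anisoWeight
  refine Measurable.ite (measurableSet_lt (by fun_prop) (by fun_prop)) (by fun_prop) ?_
  exact ((by fun_prop : Measurable fun ξ : Space d => 1 + ‖ξ‖ ^ 2)).pow_const r

theorem integrable_inv_anisoWeight [NeZero d] {r : ℝ} (hr : (d : ℝ) / 2 < r) :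
    Integrable fun ξ : Space d => (anisoWeight d r ξ)⁻¹ := by
  classical
  set g : ℝ → ℝ := fun x => Set.indicator (Set.Iio (1 : ℝ)) (fun t => t ^ (-(3 / 4) : ℝ)) ‖x‖
  have h1 : Integrable fun ξ : Space d => ∏ i, g (ξ i) := by
    have h := Integrable.fintype_prod (μ := fun _ : Fin d => (volume : Measure ℝ))
      (f := fun _ : Fin d => g) fun _ => integrable_indicator_rpow
    exact ((EuclideanSpace.volume_preserving_symm_measurableEquiv_toLp (Fin d)).integrable_comp_emb
      (MeasurableEquiv.measurableEmbedding _)).2 h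
  have h2 : Integrable fun ξ : Space d => jp (-(2 * r)) ξ := integrable_jp (by linarith)
  refine (h1.add h2).mono' (measurable_anisoWeight r).inv.aestronglyMeasurable ?_
  have hae : ∀ᵐ ξ : Space d, ∀ i, ξ i ≠ 0 := ae_all_iff.2 ae_apply_ne_zero
  filter_upwards [hae, ae_ne_zero] with ξ hξ hξ0
  have hn : 0 < ‖ξ‖ := norm_pos_iff.2 hξ0
  have hg : ∀ x, 0 ≤ g x := fun x =>
    Set.indicator_apply_nonneg fun _ => Real.rpow_nonneg (norm_nonneg _) _
  rw [norm_inv, Real.norm_of_nonneg (anisoWeight_nonneg d r ξ), Pi.add_apply]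
  by_cases h : ‖ξ‖ < 1
  · refine le_add_of_le_of_nonneg ?_ (jp_pos _ _).le
    have e : ∏ i, g (ξ i) = (∏ i, |ξ i| ^ (3 / 4 : ℝ))⁻¹ := by
      rw [← Finset.prod_inv_distrib]
      refine Finset.prod_congr rfl fun i _ => ?_
      have hi : |ξ i| < 1 := (abs_apply_le_norm ξ i).trans_lt h
      simp only [g, Real.norm_eq_abs]
      rw [Set.indicator_of_mem (Set.mem_Iio.2 hi), Real.rpow_neg (abs_nonneg _)]
    have hp : 0 < ∏ i, |ξ i| ^ (3 / 4 : ℝ) :=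
      Finset.prod_pos fun i _ => Real.rpow_pos_of_pos (abs_pos.2 (hξ i)) _
    rw [e, anisoWeight, if_pos h]
    refine inv_anti₀ hp ?_
    rw [← div_eq_inv_mul, le_div_iff₀ (by positivity), mul_comm]
    exact norm_sq_mul_prod_le h
  · refine le_add_of_nonneg_of_le (Finset.prod_nonneg fun i _ => hg _) ?_
    rw [anisoWeight, if_neg h, ← jp_sq, two_mul, neg_add, jp_add, jp_neg, sq, mul_inv]

/-- The weight of the anisotropic Sobolev space `ℋʳ`. -/
def anisoSqrtWeight [NeZero d] (r : ℝ) (hr : (d : ℝ) / 2 < r) : Weight d where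
  toFun ξ := √(anisoWeight d r ξ)
  measurable := (measurable_anisoWeight r).sqrt
  even ξ := by simp [anisoWeight]
  pos ξ hξ := Real.sqrt_pos.2 (anisoWeight_pos d r hξ)
  nonneg ξ := Real.sqrt_nonneg _
  memLp_inv := by
    refine memLp_two_of_integrable_sq (measurable_anisoWeight r).sqrt.inv.aestronglyMeasurable ?_
    refine (integrable_inv_anisoWeight hr).congr (Eventually.of_forall fun ξ => ?_)
    simp only
    rw [inv_pow, Real.sq_sqrt (anisoWeight_nonneg d r ξ)]

section anisotropic

variable [NeZero d] {r : ℝ} (hr : (d : ℝ) / 2 < r)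

theorem anisoSqrtWeight_of_one_le {ξ : Space d} (h : 1 ≤ ‖ξ‖) :
    anisoSqrtWeight r hr ξ = jp r ξ := by
  change √(anisoWeight d r ξ) = _
  rw [anisoWeight, if_neg (not_lt.2 h), ← jp_sq, Real.sqrt_sq (jp_pos _ _).le]

theorem anisoSqrtWeight_sq_of_lt_one {ξ : Space d} (h : ‖ξ‖ < 1) (h0 : ξ ≠ 0) :
    (anisoSqrtWeight r hr ξ * ‖ξ‖) ^ 2 = ξ 0 ^ 2 + ‖ξ‖ ^ 4 := by
  change (√(anisoWeight d r ξ) * ‖ξ‖) ^ 2 = _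
  have : 0 < ‖ξ‖ := norm_pos_iff.2 h0
  rw [mul_pow, Real.sq_sqrt (anisoWeight_nonneg d r ξ), anisoWeight, if_pos h]
  field_simp

theorem norm_le_anisoSqrtWeight {ξ : Space d} (h : ‖ξ‖ < 1) (h0 : ξ ≠ 0) :
    ‖ξ‖ ≤ anisoSqrtWeight r hr ξ := by
  have h1 := anisoSqrtWeight_sq_of_lt_one hr h h0
  have hn : 0 < ‖ξ‖ := norm_pos_iff.2 h0
  have hk := (anisoSqrtWeight r hr).nonneg ξ
  have : ‖ξ‖ * ‖ξ‖ ≤ anisoSqrtWeight r hr ξ * ‖ξ‖ := by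
    refine abs_le_of_sq_le_sq' ?_ (by positivity) |>.2
    rw [h1]
    nlinarith [sq_nonneg (ξ 0)]
  exact le_of_mul_le_mul_right this hn

theorem abs_le_anisoSqrtWeight_mul_norm {ξ : Space d} (h : ‖ξ‖ < 1) (h0 : ξ ≠ 0) :
    |ξ 0| ≤ anisoSqrtWeight r hr ξ * ‖ξ‖ := by
  have h1 := anisoSqrtWeight_sq_of_lt_one hr h h0
  have hk := (anisoSqrtWeight r hr).nonneg ξ
  refine abs_le_of_sq_le_sq' ?_ (by positivity) |>.2
  rw [h1, sq_abs]
  nlinarith [pow_nonneg (norm_nonneg ξ) 4]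

end anisotropic

end

section

open Filter ComplexConjugate

variable {d : ℕ}

/-! ### Products and derivatives in the Sobolev spaces -/

theorem order_nonneg {r : ℝ} (hr : (d : ℝ) / 2 < r) : 0 ≤ r :=
  (by positivity : (0 : ℝ) ≤ (d : ℝ) / 2).trans hr.le

/-- `Hʳ` is an algebra for `r > d/2`. -/
theorem isProd_sobWeight {r : ℝ} (hr : (d : ℝ) / 2 < r) :
    IsProd (sobWeight r hr) (sobWeight r hr) (sobWeight r hr) := by
  refine ⟨4 ^ (r / 2), fun x y => ?_⟩
  change jp r (x + y) ≤ 4 ^ (r / 2) * (jp r x + jp r y)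
  have h4 : (0 : ℝ) ≤ 4 ^ (r / 2) := by positivity
  rcases le_total ‖x‖ ‖y‖ with h | h
  · refine (jp_add_le_of_le (order_nonneg hr) (Or.inr h)).trans ?_
    exact mul_le_mul_of_nonneg_left (le_add_of_nonneg_left (jp_pos _ _).le) h4
  · rw [add_comm x y]
    refine (jp_add_le_of_le (order_nonneg hr) (Or.inr h)).trans ?_
    exact mul_le_mul_of_nonneg_left (le_add_of_nonneg_right (jp_pos _ _).le) h4

/-- `ℋʳ` acts by multiplication on `Hʳ'` for `d/2 < r' ≤ r`. -/
theorem isProd_anisoSqrtWeight [NeZero d] {r r' : ℝ} (hr : (d : ℝ) / 2 < r)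
    (hr' : (d : ℝ) / 2 < r') (h : r' ≤ r) :
    IsProd (anisoSqrtWeight r hr) (sobWeight r' hr') (sobWeight r' hr') := by
  refine ⟨4 ^ (r' / 2), fun x y => ?_⟩
  have h4 : (0 : ℝ) ≤ 4 ^ (r' / 2) := by positivity
  have hk := (anisoSqrtWeight r hr).nonneg x
  change jp r' (x + y) ≤ 4 ^ (r' / 2) * (anisoSqrtWeight r hr x + jp r' y)
  by_cases h1 : ‖x‖ ≤ 1 ∨ ‖x‖ ≤ ‖y‖
  · refine (jp_add_le_of_le (order_nonneg hr') h1).trans ?_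
    exact mul_le_mul_of_nonneg_left (le_add_of_nonneg_left hk) h4
  · push Not at h1
    rw [add_comm x y]
    refine (jp_add_le_of_le (order_nonneg hr') (Or.inr h1.2.le)).trans ?_
    refine mul_le_mul_of_nonneg_left (le_add_of_le_of_nonneg ?_ (jp_pos _ _).le) h4
    rw [anisoSqrtWeight_of_one_le hr h1.1.le]
    exact jp_mono h x

theorem isMult_one_sobWeight {r r' : ℝ} (hr : (d : ℝ) / 2 < r) (hr' : (d : ℝ) / 2 < r')
    (h : r' ≤ r) : IsMult (sobWeight r hr) (sobWeight r' hr') fun _ => 1 :=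
  isMult_one (C := 1) fun ξ _ => by
    rw [one_mul]
    exact jp_mono h ξ

theorem sobWeight_mul_norm_pow_le {r r' : ℝ} (hr : (d : ℝ) / 2 < r) (hr' : (d : ℝ) / 2 < r')
    {m : ℕ} (h : r' + m ≤ r) (ξ : Space d) :
    sobWeight r' hr' ξ * ‖ξ‖ ^ m ≤ 1 * sobWeight r hr ξ := by
  rw [one_mul]
  exact jp_mul_norm_pow_le h ξ

theorem isMult_dsym_sobWeight {r r' : ℝ} (hr : (d : ℝ) / 2 < r) (hr' : (d : ℝ) / 2 < r')
    (h : r' + 1 ≤ r) (j : Fin d) : IsMult (sobWeight r hr) (sobWeight r' hr') (dsym j) :=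
  isMult_dsym (C := 1) (fun ξ _ => by
    simpa using sobWeight_mul_norm_pow_le hr hr' (m := 1) (by simpa using h) ξ) j

theorem isMult_dsym_divWeight {r : ℝ} (hr : (d : ℝ) / 2 < r) (hr' : (d : ℝ) / 2 < r - 1)
    (j : Fin d) : IsMult (sobWeight r hr) (divWeight r hr') (dsym j) :=
  isMult_dsym (C := 1) (fun ξ hξ => by
    have : ‖ξ‖ ≠ 0 := norm_ne_zero_iff.2 hξ
    change ‖ξ‖⁻¹ * jp r ξ * ‖ξ‖ ≤ 1 * jp r ξ
    field_simp
    exact le_rfl) j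

theorem isSmooth_sobWeight [NeZero d] {r : ℝ} (hr : (d : ℝ) / 2 < r) {n : ℕ}
    (h : (d : ℝ) / 2 < r - n) : (sobWeight r hr).IsSmooth n :=
  Weight.isSmooth (sobWeight (r - n) h) fun m _ hm => ⟨1, fun ξ _ => by
    refine sobWeight_mul_norm_pow_le hr h ?_ ξ
    have : (m : ℝ) ≤ n := by exact_mod_cast hm
    linarith⟩

section anisotropic

variable [NeZero d] {r r' : ℝ} (hr : (d : ℝ) / 2 < r)

theorem sobWeight_mul_norm_pow_le_anisoSqrtWeight (hr' : (d : ℝ) / 2 < r') {m : ℕ} (hm : 1 ≤ m)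
    (h : r' + m ≤ r) {ξ : Space d} (h0 : ξ ≠ 0) :
    sobWeight r' hr' ξ * ‖ξ‖ ^ m ≤ 2 ^ (r' / 2) * anisoSqrtWeight r hr ξ := by
  have hr0 := order_nonneg hr'
  change jp r' ξ * ‖ξ‖ ^ m ≤ _
  rcases lt_or_ge ‖ξ‖ 1 with h1 | h1
  · refine mul_le_mul (jp_le_of_norm_lt_one hr0 h1) ?_ (by positivity) (by positivity)
    refine (pow_le_of_le_one (norm_nonneg _) h1.le (by omega)).trans ?_
    exact norm_le_anisoSqrtWeight hr h1 h0
  · rw [anisoSqrtWeight_of_one_le hr h1]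
    refine (jp_mul_norm_pow_le h ξ).trans (le_mul_of_one_le_left (jp_pos _ _).le ?_)
    exact Real.one_le_rpow (by norm_num) (by positivity)

theorem isMult_dsym_anisoSqrtWeight (hr' : (d : ℝ) / 2 < r') (h : r' + 1 ≤ r) (j : Fin d) :
    IsMult (anisoSqrtWeight r hr) (sobWeight r' hr') (dsym j) :=
  isMult_dsym (C := 2 ^ (r' / 2)) (fun ξ h0 => by
    simpa using sobWeight_mul_norm_pow_le_anisoSqrtWeight hr hr' (m := 1) le_rfl
      (by simpa using h) h0) j

/-- The term `γ∂₁η` of the continuity equation is a divergence: this is what the anisotropic weight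
is made for. -/
theorem isMult_dsym_zero_divWeight (hr' : (d : ℝ) / 2 < r' - 1) (h : r' ≤ r) :
    IsMult (anisoSqrtWeight r hr) (divWeight r' hr') (dsym 0) := by
  have hr0 : 0 ≤ r' := by linarith [order_nonneg hr']
  refine ⟨measurable_dsym 0, dsym_neg 0, 2 * Real.pi * 2 ^ (r' / 2), fun ξ h0 => ?_⟩
  rw [norm_dsym]
  have hn : 0 < ‖ξ‖ := norm_pos_iff.2 h0
  have key : jp r' ξ * (‖ξ‖⁻¹ * |ξ 0|) ≤ 2 ^ (r' / 2) * anisoSqrtWeight r hr ξ := by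
    rcases lt_or_ge ‖ξ‖ 1 with h1 | h1
    · refine mul_le_mul (jp_le_of_norm_lt_one hr0 h1) ?_ (by positivity) (by positivity)
      rw [inv_mul_le_iff₀ hn, mul_comm]
      exact abs_le_anisoSqrtWeight_mul_norm hr h1 h0
    · rw [anisoSqrtWeight_of_one_le hr h1]
      have h2 : ‖ξ‖⁻¹ * |ξ 0| ≤ 1 := by
        rw [inv_mul_le_iff₀ hn, mul_one]
        exact abs_apply_le_norm ξ 0
      refine (mul_le_of_le_one_right (jp_pos _ _).le h2).trans ((jp_mono h ξ).trans ?_)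
      exact le_mul_of_one_le_left (jp_pos _ _).le (Real.one_le_rpow (by norm_num) (by positivity))
  change ‖ξ‖⁻¹ * jp r' ξ * (2 * Real.pi * |ξ 0|) ≤ _
  calc ‖ξ‖⁻¹ * jp r' ξ * (2 * Real.pi * |ξ 0|)
      = 2 * Real.pi * (jp r' ξ * (‖ξ‖⁻¹ * |ξ 0|)) := by ring
    _ ≤ 2 * Real.pi * (2 ^ (r' / 2) * anisoSqrtWeight r hr ξ) :=
      mul_le_mul_of_nonneg_left key Real.two_pi_pos.le
    _ = _ := by ring

theorem isSmooth_anisoSqrtWeight {n : ℕ} (h : (d : ℝ) / 2 < r - n) :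
    (anisoSqrtWeight r hr).IsSmooth n :=
  Weight.isSmooth (sobWeight (r - n) h) fun m hm hn => ⟨2 ^ ((r - n) / 2), fun ξ h0 => by
    refine sobWeight_mul_norm_pow_le_anisoSqrtWeight hr h hm ?_ h0
    have : (m : ℝ) ≤ n := by exact_mod_cast hn
    linarith⟩

end anisotropic

end

section

open Filter ComplexConjugate

variable {d : ℕ}

/-! ### Real distributions -/

/-- The complex conjugate of a Schwartz function. -/
def conjSchwartz (φ : 𝓢(Space d, ℂ)) : 𝓢(Space d, ℂ) :=
  φ.postcompCLM (Complex.conjCLE : ℂ →L[ℝ] ℂ)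

@[simp]
theorem conjSchwartz_apply (φ : 𝓢(Space d, ℂ)) (x : Space d) :
    conjSchwartz φ x = conj (φ x) := rfl

theorem IsRealDist.apply_conj {u : 𝓢'(Space d, ℂ)} (hu : IsRealDist u) (φ : 𝓢(Space d, ℂ)) :
    u (conjSchwartz φ) = conj (u φ) := by
  have h1 := hu (φ + conjSchwartz φ) fun x => by simp
  have h2 := hu (Complex.I • (φ - conjSchwartz φ)) fun x => by simp
  rw [map_add, Complex.add_im] at h1
  rw [map_smul, map_sub, smul_eq_mul, Complex.I_mul_im, Complex.sub_re] at h2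
  apply Complex.ext
  · rw [Complex.conj_re]
    linarith
  · rw [Complex.conj_im]
    linarith

theorem fourier_conjSchwartz_apply (φ : 𝓢(Space d, ℂ)) (ξ : Space d) :
    (𝓕 (conjSchwartz φ) : 𝓢(Space d, ℂ)) ξ = conj ((𝓕 φ : 𝓢(Space d, ℂ)) (-ξ)) := by
  rw [SchwartzMap.fourier_coe, SchwartzMap.fourier_coe, Real.fourier_eq, Real.fourier_eq,
    ← integral_conj]
  congr 1
  funext x
  simp only [Circle.smul_def, smul_eq_mul, map_mul, conj_fourierChar, inner_neg_right, neg_neg,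
    conjSchwartz_apply]

theorem fourierInv_conjSchwartz_apply (φ : 𝓢(Space d, ℂ)) (ξ : Space d) :
    (𝓕⁻ (conjSchwartz φ) : 𝓢(Space d, ℂ)) ξ = conj ((𝓕⁻ φ : 𝓢(Space d, ℂ)) (-ξ)) := by
  rw [SchwartzMap.fourierInv_coe, SchwartzMap.fourierInv_coe, fourierInv_neg_eq, fourierInv_neg_eq,
    ← SchwartzMap.fourier_coe, ← SchwartzMap.fourier_coe, fourier_conjSchwartz_apply]

/-- The Fourier transform of a real distribution is Hermitian. -/
theorem IsRealDist.isHermitianFun {u : 𝓢'(Space d, ℂ)} (hu : IsRealDist u) {g : Space d → ℂ}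
    (hi : Integrable g) (hg : IsGivenBy (𝓕 u) g) : IsHermitianFun g := by
  have hi' : Integrable fun ξ => conj (g (-ξ)) :=
    (Complex.conjCLE : ℂ →L[ℝ] ℂ).integrable_comp hi.comp_neg
  have h : IsGivenBy (𝓕 u) fun ξ => conj (g (-ξ)) := by
    refine ⟨hi'.locallyIntegrable, fun φ => ⟨integrable_schwartz_mul hi' φ, ?_⟩⟩
    have h1 := (hg.2 (𝓕⁻ (conjSchwartz (𝓕 φ)))).2
    rw [TemperedDistribution.fourier_apply, FourierTransform.fourier_fourierInv_eq,
      hu.apply_conj, ← TemperedDistribution.fourier_apply] at h1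
    rw [← Complex.conj_conj (𝓕 u φ), h1, ← integral_conj, ← integral_neg_eq_self]
    congr 1
    funext ξ
    rw [fourierInv_conjSchwartz_apply, FourierTransform.fourierInv_fourier_eq, neg_neg, map_mul,
      Complex.conj_conj]
  filter_upwards [ae_neg_of_ae (hg.ae_eq h)] with ξ h1
  rw [h1, neg_neg]

/-- A distribution with Hermitian Fourier transform is real. -/
theorem isRealDist_of_isHermitianFun {u : 𝓢'(Space d, ℂ)} {g : Space d → ℂ}
    (hg : IsGivenBy (𝓕 u) g) (hs : IsHermitianFun g) : IsRealDist u := by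
  intro φ hφ
  have e : conjSchwartz φ = φ := by
    ext x
    rw [conjSchwartz_apply]
    exact Complex.conj_eq_iff_im.2 (hφ x)
  have h1 : u φ = ∫ ξ, (𝓕⁻ φ : 𝓢(Space d, ℂ)) ξ * g ξ := by
    rw [← (hg.2 _).2, TemperedDistribution.fourier_apply, FourierTransform.fourier_fourierInv_eq]
  apply Complex.conj_eq_iff_im.1
  rw [h1, ← integral_conj, ← integral_neg_eq_self]
  apply integral_congr_ae
  filter_upwards [hs] with ξ h
  rw [map_mul, ← fourierInv_conjSchwartz_apply, e, h, Complex.conj_conj]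

/-! ### Encoding of the function spaces -/

/-- The distribution with Fourier transform `h / k`. -/
def distOf (k : Weight d) (h : Herm d) : 𝓢'(Space d, ℂ) :=
  𝓕⁻ (((memLp_one_iff_integrable.2 (integrable_hat k h)).toLp (hat k h) :
    Lp ℂ 1 (volume : Measure (Space d))) : 𝓢'(Space d, ℂ))

theorem isGivenBy_fourier_distOf (k : Weight d) (h : Herm d) :
    IsGivenBy (𝓕 (distOf k h)) (hat k h) := by
  have hi := integrable_hat k h
  refine ⟨hi.locallyIntegrable, fun φ => ⟨integrable_schwartz_mul hi φ, ?_⟩⟩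
  rw [distOf, FourierTransform.fourier_fourierInv_eq, Lp.toTemperedDistribution_apply]
  apply integral_congr_ae
  filter_upwards [(memLp_one_iff_integrable.2 hi).coeFn_toLp] with x hx
  rw [hx, smul_eq_mul]

theorem isRealDist_distOf (k : Weight d) (h : Herm d) : IsRealDist (distOf k h) :=
  isRealDist_of_isHermitianFun (isGivenBy_fourier_distOf k h) (isHermitianFun_hat k h)

section sobolev

variable {r : ℝ}

theorem hasTemperateGrowth_jp (r : ℝ) :
    (fun ξ : Space d => ((jp r ξ : ℝ) : ℂ)).HasTemperateGrowth := by
  unfold jp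
  fun_prop

theorem jp_mul_jp_neg (r : ℝ) (ξ : Space d) : jp r ξ * jp (-r) ξ = 1 := by
  rw [jp_neg, mul_inv_cancel₀ (jp_pos r ξ).ne']

/-- A distribution is given by `H / ⟨ξ⟩ʳ` as soon as `⟨ξ⟩ʳ` times it is the `L²` function `H`. -/
theorem isGivenBy_of_smulLeftCLM_eq {w : 𝓢'(Space d, ℂ)}
    {H : Lp ℂ 2 (volume : Measure (Space d))}
    (h : TemperedDistribution.smulLeftCLM ℂ (fun ξ => ((jp r ξ : ℝ) : ℂ)) w = (H : 𝓢'(Space d, ℂ)))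
    (hi : Integrable fun ξ => (((jp r ξ)⁻¹ : ℝ) : ℂ) * H ξ) :
    IsGivenBy w fun ξ => (((jp r ξ)⁻¹ : ℝ) : ℂ) * H ξ := by
  refine ⟨hi.locallyIntegrable, fun φ => ⟨integrable_schwartz_mul hi φ, ?_⟩⟩
  have h1 := congrArg
    (fun z : 𝓢'(Space d, ℂ) => z (SchwartzMap.smulLeftCLM ℂ (fun ξ => ((jp (-r) ξ : ℝ) : ℂ)) φ)) h
  simp only [TemperedDistribution.smulLeftCLM_apply_apply, Lp.toTemperedDistribution_apply] at h1
  rw [SchwartzMap.smulLeftCLM_smulLeftCLM_apply (hasTemperateGrowth_jp r)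
    (hasTemperateGrowth_jp (-r))] at h1
  have e : ((fun ξ : Space d => ((jp r ξ : ℝ) : ℂ)) * fun ξ => ((jp (-r) ξ : ℝ) : ℂ)) =
      fun _ => 1 := by
    funext ξ
    rw [Pi.mul_apply, ← Complex.ofReal_mul, jp_mul_jp_neg, Complex.ofReal_one]
  rw [e, SchwartzMap.smulLeftCLM_const, one_smul] at h1
  refine h1.trans ?_
  congr 1
  funext ξ
  rw [SchwartzMap.smulLeftCLM_apply_apply (hasTemperateGrowth_jp (-r)), jp_neg, smul_eq_mul,
    smul_eq_mul]
  ring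

theorem smulLeftCLM_fourier_dist (u : Sobolev d r) :
    TemperedDistribution.smulLeftCLM ℂ (fun ξ => ((jp r ξ : ℝ) : ℂ)) (𝓕 u.dist) =
      ((𝓕 (Sobolev.bessel u) : Lp ℂ 2 (volume : Measure (Space d))) : 𝓢'(Space d, ℂ)) := by
  rw [← Lp.fourier_toTemperedDistribution_eq, ← Sobolev.bessel_spec,
    fourier_besselPotential_eq_smulLeftCLM_fourier_apply]
  rfl

theorem integrable_jp_inv_mul (hr : (d : ℝ) / 2 < r) (H : Lp ℂ 2 (volume : Measure (Space d))) :
    Integrable fun ξ => (((jp r ξ)⁻¹ : ℝ) : ℂ) * H ξ :=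
  MemLp.integrable_mul (memLp_jp_inv hr).ofReal (Lp.memLp H)

theorem Sobolev.isGivenBy_fourier (hr : (d : ℝ) / 2 < r) (u : Sobolev d r) : IsGivenBy (𝓕 u.dist)
    fun ξ => (((jp r ξ)⁻¹ : ℝ) : ℂ) * (𝓕 (Sobolev.bessel u) : Lp ℂ 2 volume) ξ :=
  isGivenBy_of_smulLeftCLM_eq (smulLeftCLM_fourier_dist u) (integrable_jp_inv_mul hr _)

theorem Sobolev.isHermitianFun (hr : (d : ℝ) / 2 < r) (u : Sobolev d r) :
    IsHermitianFun (𝓕 (Sobolev.bessel u) : Lp ℂ 2 (volume : Measure (Space d))) := by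
  have h := u.2.1.isHermitianFun (integrable_jp_inv_mul hr _) (Sobolev.isGivenBy_fourier hr u)
  refine (isHermitianFun_weight_mul (sobWeight r hr) h).congr (Eventually.of_forall fun ξ => ?_)
  have : (jp r ξ : ℂ) ≠ 0 := by exact_mod_cast (jp_pos r ξ).ne'
  change (jp r ξ : ℂ) * _ = _
  rw [Complex.ofReal_inv, mul_inv_cancel_left₀ this]

/-- The isometry `u ↦ ⟨ξ⟩ʳ 𝓕u`. -/
def Sobolev.toHerm (hr : (d : ℝ) / 2 < r) : Sobolev d r →ₗᵢ[ℝ] Herm d where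
  toFun u := ⟨𝓕 (Sobolev.bessel u), mem_hermSubmodule_iff.2 (Sobolev.isHermitianFun hr u)⟩
  map_add' u v := Subtype.ext (by
    simp only [map_add, FourierTransform.fourier_add]
    rfl)
  map_smul' c u := Subtype.ext (by
    simp only [map_smul, RingHom.id_apply]
    exact (Lp.fourierTransformₗᵢ (Space d) ℂ).toLinearMap.map_smul_of_tower c (Sobolev.bessel u))
  norm_map' u := by
    change ‖(𝓕 (Sobolev.bessel u) : Lp ℂ 2 (volume : Measure (Space d)))‖ = ‖Sobolev.bessel u‖
    exact Lp.norm_fourier_eq _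

theorem Sobolev.isGivenBy_hat (hr : (d : ℝ) / 2 < r) (u : Sobolev d r) :
    IsGivenBy (𝓕 u.dist) (hat (sobWeight r hr) (Sobolev.toHerm hr u)) :=
  Sobolev.isGivenBy_fourier hr u

theorem Sobolev.toHerm_surjective [NeZero d] (hr : (d : ℝ) / 2 < r) :
    Function.Surjective (Sobolev.toHerm hr) := by
  intro h
  set u := distOf (sobWeight r hr) h with hu
  have hg := isGivenBy_fourier_distOf (sobWeight r hr) h
  have h1 : TemperedDistribution.smulLeftCLM ℂ (fun ξ => ((jp r ξ : ℝ) : ℂ)) (𝓕 u) =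
      ((h : Lp ℂ 2 (volume : Measure (Space d))) : 𝓢'(Space d, ℂ)) := by
    ext φ
    rw [TemperedDistribution.smulLeftCLM_apply_apply, (hg.2 _).2, Lp.toTemperedDistribution_apply]
    congr 1
    funext ξ
    have : (jp r ξ : ℂ) ≠ 0 := by exact_mod_cast (jp_pos r ξ).ne'
    rw [SchwartzMap.smulLeftCLM_apply_apply (hasTemperateGrowth_jp r), smul_eq_mul, smul_eq_mul,
      hat, Complex.ofReal_inv]
    change (jp r ξ : ℂ) * φ ξ * ((jp r ξ : ℂ)⁻¹ * _) = _
    field_simp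
  have hmem : MemSobolev r 2 u := memSobolev_iff_exists_smulLeftCLM_fourier.2 ⟨_, h1⟩
  refine ⟨⟨u, isRealDist_distOf _ _, hmem⟩, ?_⟩
  exact hat_injective (sobWeight r hr) ((Sobolev.isGivenBy_hat hr _).ae_eq hg)

/-- The identification of `Hʳ` with `Herm d`. -/
def Sobolev.equiv [NeZero d] (hr : (d : ℝ) / 2 < r) : Sobolev d r ≃ₗᵢ[ℝ] Herm d :=
  LinearIsometryEquiv.ofSurjective (Sobolev.toHerm hr) (Sobolev.toHerm_surjective hr)

theorem Sobolev.isGivenBy_equiv [NeZero d] (hr : (d : ℝ) / 2 < r) (u : Sobolev d r) :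
    IsGivenBy (𝓕 u.dist) (hat (sobWeight r hr) (Sobolev.equiv hr u)) :=
  Sobolev.isGivenBy_hat hr u

end sobolev

section aniso

variable [NeZero d] {r : ℝ}

theorem Aniso.fourier_ae_eq (hr : (d : ℝ) / 2 < r) (u : Aniso d r) : u.fourier =ᵐ[volume]
    fun ξ => (((anisoSqrtWeight r hr ξ)⁻¹ : ℝ) : ℂ) * Aniso.weighted u ξ := by
  filter_upwards [u.memLp.coeFn_toLp, ae_ne_zero] with ξ h1 h2
  have h : (anisoSqrtWeight r hr ξ : ℂ) ≠ 0 := by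
    exact_mod_cast ((anisoSqrtWeight r hr).pos ξ h2).ne'
  have h3 : Aniso.weighted u ξ = (anisoSqrtWeight r hr ξ : ℂ) * u.fourier ξ := h1
  rw [h3, Complex.ofReal_inv, inv_mul_cancel_left₀ h]

theorem Aniso.integrable_fourier (hr : (d : ℝ) / 2 < r) (u : Aniso d r) : Integrable u.fourier := by
  refine Integrable.congr ?_ (Aniso.fourier_ae_eq hr u).symm
  exact MemLp.integrable_mul (anisoSqrtWeight r hr).memLp_inv.ofReal (Lp.memLp _)

theorem Aniso.isHermitianFun (hr : (d : ℝ) / 2 < r) (u : Aniso d r) :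
    IsHermitianFun (Aniso.weighted u) := by
  have h := u.2.1.isHermitianFun (Aniso.integrable_fourier hr u) u.fourier_spec
  exact (isHermitianFun_weight_mul (anisoSqrtWeight r hr) h).congr u.memLp.coeFn_toLp.symm

/-- The isometry `u ↦ √w 𝓕u`. -/
def Aniso.toHerm (hr : (d : ℝ) / 2 < r) : Aniso d r →ₗᵢ[ℝ] Herm d where
  toFun u := ⟨Aniso.weighted u, mem_hermSubmodule_iff.2 (Aniso.isHermitianFun hr u)⟩
  map_add' u v := Subtype.ext (map_add _ u v)
  map_smul' c u := Subtype.ext (map_smul _ c u)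
  norm_map' _ := rfl

theorem Aniso.isGivenBy_hat (hr : (d : ℝ) / 2 < r) (u : Aniso d r) :
    IsGivenBy (𝓕 u.dist) (hat (anisoSqrtWeight r hr) (Aniso.toHerm hr u)) :=
  u.fourier_spec.congr (Aniso.fourier_ae_eq hr u)

theorem Aniso.toHerm_surjective (hr : (d : ℝ) / 2 < r) :
    Function.Surjective (Aniso.toHerm (d := d) hr) := by
  intro h
  have hg := isGivenBy_fourier_distOf (anisoSqrtWeight r hr) h
  refine ⟨⟨distOf (anisoSqrtWeight r hr) h, isRealDist_distOf _ _, _, hg, ?_⟩, ?_⟩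
  · refine (memLp_congr_ae ?_).1 (Lp.memLp (h : Lp ℂ 2 (volume : Measure (Space d))))
    filter_upwards [ae_ne_zero] with ξ h0
    have h : (anisoSqrtWeight r hr ξ : ℂ) ≠ 0 := by
      exact_mod_cast ((anisoSqrtWeight r hr).pos ξ h0).ne'
    change _ = (anisoSqrtWeight r hr ξ : ℂ) * _
    rw [hat, Complex.ofReal_inv, mul_inv_cancel_left₀ h]
  · exact hat_injective (anisoSqrtWeight r hr) ((Aniso.isGivenBy_hat hr _).ae_eq hg)

/-- The identification of `ℋʳ` with `Herm d`. -/
def Aniso.equiv (hr : (d : ℝ) / 2 < r) : Aniso d r ≃ₗᵢ[ℝ] Herm d :=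
  LinearIsometryEquiv.ofSurjective (Aniso.toHerm hr) (Aniso.toHerm_surjective hr)

theorem Aniso.isGivenBy_equiv (hr : (d : ℝ) / 2 < r) (u : Aniso d r) :
    IsGivenBy (𝓕 u.dist) (hat (anisoSqrtWeight r hr) (Aniso.equiv hr u)) :=
  Aniso.isGivenBy_hat hr u

end aniso

end

section

/-! ### A parametrized implicit function theorem -/

section implicitFunction

open Filter Topology

variable {P X W Y : Type*} [NormedAddCommGroup P] [NormedAddCommGroup X] [NormedAddCommGroup W]
  [NormedAddCommGroup Y]

/-- Triples consisting of a datum and two small distinct solutions, together with the data of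
inadmissible parameters. The distance to this set is a radius of uniqueness that depends
continuously on the parameters. -/
def conflictSet (F : (P × X) × W → Y) (S : Set P) : Set ((P × X) × W × W) :=
  {z | z.1.1 ∉ S ∨ (F (z.1, z.2.1) = 0 ∧ F (z.1, z.2.2) = 0 ∧ z.2.1 ≠ z.2.2)}

/-- The radius of uniqueness at the parameter `p`. If the conflict set is empty this is the junk
value `0`, which is why inadmissible parameters are required to exist in what follows. -/
def uniqRadius (F : (P × X) × W → Y) (S : Set P) (p : P) : ℝ :=
  Metric.infDist (((p, 0), 0, 0) : (P × X) × W × W) (conflictSet F S)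

theorem continuous_uniqRadius (F : (P × X) × W → Y) (S : Set P) : Continuous (uniqRadius F S) :=
  (Metric.continuous_infDist_pt _).comp (by fun_prop)

theorem eq_of_lt_uniqRadius {F : (P × X) × W → Y} {S : Set P} {D : P × X} {w w' : W}
    (hD : ‖D.2‖ < uniqRadius F S D.1) (hw : ‖w‖ < uniqRadius F S D.1)
    (hw' : ‖w'‖ < uniqRadius F S D.1) (h : F (D, w) = 0) (h' : F (D, w') = 0) : w = w' := by
  by_contra hne
  have hmem : (D, w, w') ∈ conflictSet F S := Or.inr ⟨h, h', hne⟩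
  have h1 := Metric.infDist_le_dist_of_mem (x := ((D.1, 0), 0, 0)) hmem
  have h2 : dist (((D.1, 0), 0, 0) : (P × X) × W × W) (D, w, w') < uniqRadius F S D.1 := by
    rw [dist_comm, dist_eq_norm]
    simp only [Prod.norm_def, Prod.fst_sub, Prod.snd_sub, sub_self, sub_zero, norm_zero]
    have := (norm_nonneg w).trans_lt hw
    exact max_lt (max_lt this hD) (max_lt hw hw')
  exact absurd h1 (not_le.2 h2)

theorem uniqRadius_pos {F : (P × X) × W → Y} {S : Set P} (hS : IsOpen S) (hne : Sᶜ.Nonempty)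
    {p : P} (hp : p ∈ S) {f : P × X → W}
    (hf : ∀ᶠ v in 𝓝 (((p, 0) : P × X), (0 : W)), F v = 0 ↔ f v.1 = v.2) :
    0 < uniqRadius F S p := by
  obtain ⟨q, hq⟩ := hne
  have hB : (conflictSet F S).Nonempty := ⟨((q, 0), 0, 0), Or.inl hq⟩
  refine (Metric.infDist_pos_iff_notMem_closure hB).1 fun hcl => ?_
  rw [mem_closure_iff_frequently] at hcl
  have c1 : Tendsto (fun z : (P × X) × W × W => (z.1, z.2.1)) (𝓝 ((p, 0), 0, 0))
      (𝓝 ((p, 0), 0)) := (by fun_prop : Continuous fun z : (P × X) × W × W => (z.1, z.2.1)).tendsto _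
  have c2 : Tendsto (fun z : (P × X) × W × W => (z.1, z.2.2)) (𝓝 ((p, 0), 0, 0))
      (𝓝 ((p, 0), 0)) := (by fun_prop : Continuous fun z : (P × X) × W × W => (z.1, z.2.2)).tendsto _
  have c3 : ∀ᶠ z : (P × X) × W × W in 𝓝 ((p, 0), 0, 0), z.1.1 ∈ S :=
    (by fun_prop : Continuous fun z : (P × X) × W × W => z.1.1).tendsto _ (hS.mem_nhds hp)
  refine hcl ?_
  filter_upwards [c1.eventually hf, c2.eventually hf, c3] with z h1 h2 h3 h4
  rcases h4 with h4 | ⟨h5, h6, h7⟩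
  · exact h4 h3
  · exact h7 ((h1.1 h5).symm.trans (h2.1 h6))

variable [NormedSpace ℝ P] [CompleteSpace P] [NormedSpace ℝ X] [CompleteSpace X]
  [NormedSpace ℝ W] [CompleteSpace W] [NormedSpace ℝ Y] [CompleteSpace Y]

/-- A local branch of solutions. Analyticity at a point, unlike `C^∞` at a point in the sense of
`ContDiffAt`, holds on a neighborhood; for this reason the regularity is `ω`. -/
theorem exists_implicit_branch {F : (P × X) × W → Y} (hF : ContDiff ℝ ω F) {D₀ : P × X}
    (h0 : F (D₀, 0) = 0) {L : W ≃L[ℝ] Y}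
    (hL : HasFDerivAt (fun w => F (D₀, w)) (L : W →L[ℝ] Y) 0) :
    ∃ f : P × X → W, f D₀ = 0 ∧ (∀ᶠ D in 𝓝 D₀, ContDiffAt ℝ ω f D) ∧
      ∀ᶠ v in 𝓝 (D₀, (0 : W)), F v = 0 ↔ f v.1 = v.2 := by
  have hd : DifferentiableAt ℝ F (D₀, 0) := hF.differentiable (by simp) _
  have hinr : HasFDerivAt (fun w : W => (D₀, w)) (.inr ℝ (P × X) W) 0 :=
    hasFDerivAt_prodMk_right D₀ 0
  have e : fderiv ℝ F (D₀, 0) ∘L .inr ℝ (P × X) W = L :=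
    (hd.hasFDerivAt.comp 0 hinr).unique hL
  have hinv : (fderiv ℝ F (D₀, 0) ∘L .inr ℝ (P × X) W).IsInvertible := ⟨L, e.symm⟩
  have cdf : ContDiffAt ℝ ω F (D₀, 0) := hF.contDiffAt
  refine ⟨cdf.implicitFunction (by simp) hinv, cdf.implicitFunction_apply_self (by simp) hinv,
    (cdf.contDiffAt_implicitFunction (by simp) hinv).eventually (by simp), ?_⟩
  have := cdf.eventually_apply_eq_iff_implicitFunction (by simp) hinv
  rwa [h0] at this

/-- The implicit function theorem along a family `((p, 0), 0)` of zeros, with the local branches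
glued to one solution map. -/
theorem exists_solution_map {F : (P × X) × W → Y} (hF : ContDiff ℝ ω F) {S : Set P}
    (hS : IsOpen S) (hne : Sᶜ.Nonempty) (h0 : ∀ p ∈ S, F ((p, 0), 0) = 0)
    (hL : ∀ p ∈ S, ∃ L : W ≃L[ℝ] Y,
      HasFDerivAt (fun w => F ((p, 0), w)) (L : W →L[ℝ] Y) 0) :
    ∃ (U : Set (P × X)) (V : P → Set W) (sol : P × X → W),
      IsOpen U ∧ (∀ p ∈ S, (p, 0) ∈ U) ∧ (∀ D ∈ U, D.1 ∈ S) ∧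
      (∀ p ∈ S, IsOpen (V p) ∧ 0 ∈ V p) ∧ ContDiffOn ℝ (⊤ : ℕ∞) sol U ∧
      ∀ D ∈ U, sol D ∈ V D.1 ∧ F (D, sol D) = 0 ∧ ∀ w ∈ V D.1, F (D, w) = 0 → w = sol D := by
  classical
  set R := uniqRadius F S with hR
  have hRc : Continuous R := continuous_uniqRadius F S
  -- `f` is a solution branch at `D` within the radius of uniqueness
  let good : (P × X → W) → P × X → Prop := fun f D =>
    ContDiffAt ℝ ω f D ∧ D.1 ∈ S ∧ ‖D.2‖ < R D.1 ∧ ‖f D‖ < R D.1 ∧ F (D, f D) = 0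
  let U : Set (P × X) := {D | ∃ f, ∀ᶠ D' in 𝓝 D, good f D'}
  -- defined from `F` alone, so that it agrees with every branch
  let sol : P × X → W := fun D =>
    if h : ∃ w, ‖w‖ < R D.1 ∧ F (D, w) = 0 then h.choose else 0
  have hsol : ∀ f D, good f D → sol D = f D := by
    intro f D hg
    have h : ∃ w, ‖w‖ < R D.1 ∧ F (D, w) = 0 := ⟨f D, hg.2.2.2⟩
    have e : sol D = h.choose := dif_pos h
    rw [e]
    exact eq_of_lt_uniqRadius hg.2.2.1 h.choose_spec.1 hg.2.2.2.1 h.choose_spec.2 hg.2.2.2.2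
  refine ⟨U, fun p => Metric.ball 0 (R p), sol, ?_, ?_, ?_, ?_, ?_, ?_⟩
  · rw [isOpen_iff_eventually]
    rintro D ⟨f, hf⟩
    filter_upwards [hf.eventually_nhds] with D' hD'
    exact ⟨f, hD'⟩
  · intro p hp
    obtain ⟨L, hL⟩ := hL p hp
    obtain ⟨f, hf0, hfs, hf⟩ := exists_implicit_branch hF (h0 p hp) hL
    have hpos : 0 < R p := uniqRadius_pos hS hne hp hf
    have hfc : ContinuousAt f (p, 0) := hfs.self_of_nhds.continuousAt
    have hgr : Tendsto (fun D => (D, f D)) (𝓝 ((p, 0) : P × X)) (𝓝 ((p, 0), 0)) := by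
      have := continuousAt_id.prodMk hfc
      rwa [ContinuousAt, hf0] at this
    refine ⟨f, ?_⟩
    have c1 : ∀ᶠ D : P × X in 𝓝 (p, 0), D.1 ∈ S :=
      continuous_fst.tendsto _ (hS.mem_nhds hp)
    have c2 : ∀ᶠ D : P × X in 𝓝 (p, 0), ‖D.2‖ < R D.1 := by
      refine (continuous_snd.norm.continuousAt).eventually_lt
        (hRc.comp continuous_fst).continuousAt ?_
      simpa using hpos
    have c3 : ∀ᶠ D : P × X in 𝓝 (p, 0), ‖f D‖ < R D.1 := by
      refine hfc.norm.eventually_lt (hRc.comp continuous_fst).continuousAt ?_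
      simpa [hf0] using hpos
    filter_upwards [hfs, c1, c2, c3, hgr.eventually hf] with D h1 h2 h3 h4 h5
    exact ⟨h1, h2, h3, h4, h5.2 rfl⟩
  · rintro D ⟨f, hf⟩
    exact hf.self_of_nhds.2.1
  · intro p hp
    obtain ⟨L, hL⟩ := hL p hp
    obtain ⟨f, hf0, hfs, hf⟩ := exists_implicit_branch hF (h0 p hp) hL
    exact ⟨Metric.isOpen_ball, Metric.mem_ball_self (uniqRadius_pos hS hne hp hf)⟩
  · rintro D ⟨f, hf⟩
    have e : sol =ᶠ[𝓝 D] f := hf.mono fun D' h => hsol f D' h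
    exact ((hf.self_of_nhds.1.congr_of_eventuallyEq e).of_le (by simp)).contDiffWithinAt
  · rintro D ⟨f, hf⟩
    have hg := hf.self_of_nhds
    rw [hsol f D hg]
    refine ⟨by simpa using hg.2.2.2.1, hg.2.2.2.2, fun w hw h => ?_⟩
    exact eq_of_lt_uniqRadius hg.2.2.1 (by simpa using hw) hg.2.2.2.1 h hg.2.2.2.2

end implicitFunction

end

section

variable {d : ℕ} {ℓ : ℕ} {s : ℝ}

/-! ### The operator of the traveling shallow water system -/

theorem lt_one_add (hs : (d : ℝ) / 2 < s) : (d : ℝ) / 2 < 1 + s := by linarith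

theorem lt_two_add (hs : (d : ℝ) / 2 < s) : (d : ℝ) / 2 < 2 + s := by linarith

theorem lt_three_add (hs : (d : ℝ) / 2 < s) : (d : ℝ) / 2 < 3 + s := by linarith

theorem lt_two_add_sub_one (hs : (d : ℝ) / 2 < s) : (d : ℝ) / 2 < 2 + s - 1 := by linarith

theorem pd_sub_mul_sub_const {a b : Space d → ℝ} (ha : Differentiable ℝ a)
    (hb : Differentiable ℝ b) (j : Fin d) (c : ℝ) :
    pd j (fun y => a y - c * b y - c) = fun x => pd j a x - c * pd j b x := by
  funext x
  have h1 : HasFDerivAt (fun y => a y - c * b y - c) (fderiv ℝ a x - c • fderiv ℝ b x) x :=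
    ((ha x).hasFDerivAt.sub ((hb x).hasFDerivAt.const_mul c)).sub_const c
  rw [pd, h1.fderiv]
  simp [pd]

variable [NeZero d]

/-- The weight of `Hˢ`, the space of the data and of the momentum equation. -/
abbrev w0 (hs : (d : ℝ) / 2 < s) : Weight d := sobWeight s hs

/-- The weight of `H¹⁺ˢ`, the space of the viscous stress. -/
abbrev w1 (hs : (d : ℝ) / 2 < s) : Weight d := sobWeight (1 + s) (lt_one_add hs)

/-- The weight of `H²⁺ˢ`, the space of the velocity. -/
abbrev w2 (hs : (d : ℝ) / 2 < s) : Weight d := sobWeight (2 + s) (lt_two_add hs)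

/-- The weight of `ℋ³⁺ˢ`, the space of the free surface. -/
abbrev wη (hs : (d : ℝ) / 2 < s) : Weight d := anisoSqrtWeight (3 + s) (lt_three_add hs)

/-- The weight of the space of the continuity equation, whose left side is a divergence: the term
`γ∂₁η` is one by the choice of the anisotropic weight. -/
abbrev wdiv (hs : (d : ℝ) / 2 < s) : Weight d := divWeight (2 + s) (lt_two_add_sub_one hs)

variable (hs : (d : ℝ) / 2 < s)

/-- `∂ⱼ : H²⁺ˢ → H¹⁺ˢ`. -/
def d21 (j : Fin d) : Herm d →L[ℝ] Herm d :=
  mult (isMult_dsym_sobWeight (lt_two_add hs) (lt_one_add hs) (by linarith) j)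

/-- `∂ⱼ : H¹⁺ˢ → Hˢ`. -/
def d10 (j : Fin d) : Herm d →L[ℝ] Herm d :=
  mult (isMult_dsym_sobWeight (lt_one_add hs) hs (by linarith) j)

/-- `∂ⱼ : H²⁺ˢ → Hˢ`. -/
def d20 (j : Fin d) : Herm d →L[ℝ] Herm d :=
  mult (isMult_dsym_sobWeight (lt_two_add hs) hs (by linarith) j)

/-- `∂ⱼ` from `H²⁺ˢ` to the space of divergences. -/
def d2div (j : Fin d) : Herm d →L[ℝ] Herm d :=
  mult (isMult_dsym_divWeight (lt_two_add hs) (lt_two_add_sub_one hs) j)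

/-- `∂ⱼ : ℋ³⁺ˢ → H²⁺ˢ`. -/
def dη2 (j : Fin d) : Herm d →L[ℝ] Herm d :=
  mult (isMult_dsym_anisoSqrtWeight (lt_three_add hs) (lt_two_add hs) (by linarith) j)

/-- `∂ⱼ : ℋ³⁺ˢ → Hˢ`. -/
def dη0 (j : Fin d) : Herm d →L[ℝ] Herm d :=
  mult (isMult_dsym_anisoSqrtWeight (lt_three_add hs) hs (by linarith) j)

/-- `∂₁` from `ℋ³⁺ˢ` to the space of divergences. -/
def dηdiv : Herm d →L[ℝ] Herm d :=
  mult (isMult_dsym_zero_divWeight (lt_three_add hs) (lt_two_add_sub_one hs) (by linarith))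

/-- The inclusion `H²⁺ˢ → Hˢ`. -/
def i20 : Herm d →L[ℝ] Herm d :=
  mult (isMult_one_sobWeight (lt_two_add hs) hs (by linarith))

/-- The product of `Hˢ`. -/
def mul0 : Herm d →L[ℝ] Herm d →L[ℝ] Herm d := conv (isProd_sobWeight hs)

/-- The product `ℋ³⁺ˢ × Hˢ → Hˢ`. -/
def mulη0 : Herm d →L[ℝ] Herm d →L[ℝ] Herm d :=
  conv (isProd_anisoSqrtWeight (lt_three_add hs) hs (by linarith))

/-- The product `ℋ³⁺ˢ × H¹⁺ˢ → H¹⁺ˢ`. -/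
def mulη1 : Herm d →L[ℝ] Herm d →L[ℝ] Herm d :=
  conv (isProd_anisoSqrtWeight (lt_three_add hs) (lt_one_add hs) (by linarith))

/-- The product `ℋ³⁺ˢ × H²⁺ˢ → H²⁺ˢ`. -/
def mulη2 : Herm d →L[ℝ] Herm d →L[ℝ] Herm d :=
  conv (isProd_anisoSqrtWeight (lt_three_add hs) (lt_two_add hs) (by linarith))

theorem isSmooth_w2 : (w2 (d := d) hs).IsSmooth 2 :=
  isSmooth_sobWeight _ (by push_cast; linarith)

theorem isSmooth_w1 : (w1 (d := d) hs).IsSmooth 1 :=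
  isSmooth_sobWeight _ (by push_cast; linarith)

theorem isSmooth_wη : (wη (d := d) hs).IsSmooth 3 :=
  isSmooth_anisoSqrtWeight _ (by push_cast; linarith)

theorem pd_fn_w2 (j : Fin d) (h : Herm d) : pd j (fn (w2 hs) h) = fn (w1 hs) (d21 hs j h) :=
  pd_fn ((isSmooth_w2 hs).mono (by norm_num)) _ h

theorem pd_fn_w2' (j : Fin d) (h : Herm d) : pd j (fn (w2 hs) h) = fn (w0 hs) (d20 hs j h) :=
  pd_fn ((isSmooth_w2 hs).mono (by norm_num)) _ h

theorem pd_fn_w2_div (j : Fin d) (h : Herm d) :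
    pd j (fn (w2 hs) h) = fn (wdiv hs) (d2div hs j h) :=
  pd_fn ((isSmooth_w2 hs).mono (by norm_num)) _ h

theorem pd_fn_w1 (j : Fin d) (h : Herm d) : pd j (fn (w1 hs) h) = fn (w0 hs) (d10 hs j h) :=
  pd_fn (isSmooth_w1 hs) _ h

theorem pd_fn_wη (j : Fin d) (h : Herm d) : pd j (fn (wη hs) h) = fn (w2 hs) (dη2 hs j h) :=
  pd_fn ((isSmooth_wη hs).mono (by norm_num)) _ h

theorem pd_fn_wη' (j : Fin d) (h : Herm d) : pd j (fn (wη hs) h) = fn (w0 hs) (dη0 hs j h) :=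
  pd_fn ((isSmooth_wη hs).mono (by norm_num)) _ h

theorem pd_fn_wη_div (h : Herm d) : pd 0 (fn (wη hs) h) = fn (wdiv hs) (dηdiv hs h) :=
  pd_fn ((isSmooth_wη hs).mono (by norm_num)) _ h

theorem fn_i20 (h : Herm d) : fn (w0 hs) (i20 hs h) = fn (w2 hs) h := fn_mult_one _ h

theorem fn_mul0 (f g : Herm d) : fn (w0 hs) (mul0 hs f g) = fn (w0 hs) f * fn (w0 hs) g :=
  fn_conv _ f g

theorem fn_mulη0 (f g : Herm d) : fn (w0 hs) (mulη0 hs f g) = fn (wη hs) f * fn (w0 hs) g :=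
  fn_conv _ f g

theorem fn_mulη1 (f g : Herm d) : fn (w1 hs) (mulη1 hs f g) = fn (wη hs) f * fn (w1 hs) g :=
  fn_conv _ f g

theorem fn_mulη2 (f g : Herm d) : fn (w2 hs) (mulη2 hs f g) = fn (wη hs) f * fn (w2 hs) g :=
  fn_conv _ f g

/-- The encoded unknowns `(v, η)`. -/
abbrev HUnknowns (d : ℕ) : Type := (Fin d → Herm d) × Herm d

/-- The encoded coefficients `({τᵢ}, {φᵢ})`. -/
abbrev HCoeff (d ℓ : ℕ) : Type :=
  (Fin (ℓ + 1) → Fin d → Fin d → Herm d) × (Fin (ℓ + 1) → Fin d → Herm d)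

/-- The `i`-th component of the velocity. -/
def velL (i : Fin d) : HUnknowns d →L[ℝ] Herm d :=
  ContinuousLinearMap.proj i ∘L ContinuousLinearMap.fst ℝ _ _

/-- The viscous stress, in `H¹⁺ˢ`. -/
def stressL (i j : Fin d) : HUnknowns d →L[ℝ] Herm d :=
  d21 hs j ∘L velL i + d21 hs i ∘L velL j +
    if i = j then (2 : ℝ) • ∑ l, d21 hs l ∘L velL l else 0

/-- The component `∂ᵢ(η - σ²Δη)`, in `Hˢ`. -/
def surfL (σ : ℝ) (i : Fin d) : HUnknowns d →L[ℝ] Herm d :=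
  (dη0 hs i - σ ^ 2 • ∑ j, d10 hs j ∘L d21 hs j ∘L dη2 hs i) ∘L ContinuousLinearMap.snd ℝ _ _

theorem surfL_apply (σ : ℝ) (i : Fin d) (w : HUnknowns d) :
    surfL hs σ i w = dη0 hs i w.2 - σ ^ 2 • ∑ j, d10 hs j (d21 hs j (dη2 hs i w.2)) := by
  simp [surfL]

/-- The component `(v - γe₁)·∇vᵢ`, in `Hˢ`. -/
def advect (γ : ℝ) (i : Fin d) (w : HUnknowns d) : Herm d :=
  ∑ j, mul0 hs (i20 hs (w.1 j)) (d20 hs j (w.1 i)) - γ • d20 hs 0 (w.1 i)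

/-- The forcing `∑ₖ ηᵏ(τₖ∇η + φₖ)`, in `Hˢ`. -/
def forceH (c : HCoeff d ℓ) (i : Fin d) (w : HUnknowns d) : Herm d :=
  ∑ k : Fin (ℓ + 1), (mulη0 hs w.2)^[k] (∑ j, mul0 hs (c.1 k i j) (dη0 hs j w.2) + c.2 k i)

/-- The left side of the momentum equation, in `Hˢ`. The factors `1 + η` are expanded because the
constant `1` belongs to none of the spaces. -/
def momentumH (z : (Params × HCoeff d ℓ) × HUnknowns d) (i : Fin d) : Herm d :=
  (advect hs z.1.1.1 i z.2 + mulη0 hs z.2.2 (advect hs z.1.1.1 i z.2)) + i20 hs (z.2.1 i)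
    - z.1.1.2.1 ^ 2 • ∑ j, d10 hs j (stressL hs i j z.2 + mulη1 hs z.2.2 (stressL hs i j z.2))
    + (surfL hs z.1.1.2.2 i z.2 + mulη0 hs z.2.2 (surfL hs z.1.1.2.2 i z.2))
    + forceH hs z.1.2 i z.2

/-- The left side of the continuity equation, as a divergence. -/
def continuityH (z : (Params × HCoeff d ℓ) × HUnknowns d) : Herm d :=
  ∑ j, d2div hs j (z.2.1 j + mulη2 hs z.2.2 (z.2.1 j)) - z.1.1.1 • dηdiv hs z.2.2

/-- The left side of the system. -/
def systemH (z : (Params × HCoeff d ℓ) × HUnknowns d) : HUnknowns d :=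
  (momentumH hs z, continuityH hs z)

/-! ### The operator computes the classical system -/

theorem fn_continuityH (z : (Params × HCoeff d ℓ) × HUnknowns d) (x : Space d) :
    fn (wdiv hs) (continuityH hs z) x =
      div (fun j y => (1 + fn (wη hs) z.2.2 y) *
        relVel z.1.1.1 (fun j => fn (w2 hs) (z.2.1 j)) j y) x := by
  have e : ∀ j, (fun y => (1 + fn (wη hs) z.2.2 y) *
      relVel z.1.1.1 (fun j => fn (w2 hs) (z.2.1 j)) j y) =
      fun y => fn (w2 hs) (z.2.1 j + mulη2 hs z.2.2 (z.2.1 j)) y -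
        (if j = 0 then z.1.1.1 else 0) * fn (wη hs) z.2.2 y - (if j = 0 then z.1.1.1 else 0) := by
    intro j
    funext y
    rw [map_add, fn_mulη2, relVel, Pi.add_apply, Pi.mul_apply]
    ring
  simp only [div, e]
  simp only [pd_sub_mul_sub_const
    (differentiable_fn ((isSmooth_w2 hs).mono (by norm_num)) _)
    (differentiable_fn ((isSmooth_wη hs).mono (by norm_num)) _)]
  have h : fn (wdiv hs) (continuityH hs z) =
      ∑ j, fn (wdiv hs) (d2div hs j (z.2.1 j + mulη2 hs z.2.2 (z.2.1 j))) -
        z.1.1.1 • fn (wdiv hs) (dηdiv hs z.2.2) := by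
    simp only [continuityH, map_sub, map_smul, map_sum]
  rw [Finset.sum_sub_distrib, h]
  simp only [ite_mul, zero_mul, Finset.sum_ite_eq', Finset.mem_univ, if_true, pd_fn_wη_div,
    pd_fn_w2_div, Pi.sub_apply, Finset.sum_apply, Pi.smul_apply, smul_eq_mul]

theorem fn_stressL (i j : Fin d) (w : HUnknowns d) :
    fn (w1 hs) (stressL hs i j w) = stress (fun j => fn (w2 hs) (w.1 j)) i j := by
  funext x
  simp only [stress, div, pd_fn_w2]
  by_cases h : i = j
  · subst h
    simp [stressL, velL]
  · simp [stressL, velL, h]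

theorem fn_surfL (σ : ℝ) (i : Fin d) (w : HUnknowns d) (x : Space d) :
    fn (w0 hs) (surfL hs σ i w) x =
      pd i (fn (wη hs) w.2) x - σ ^ 2 * lap (pd i (fn (wη hs) w.2)) x := by
  simp only [lap]
  rw [pd_fn_wη']
  rw [← pd_fn_wη', pd_fn_wη]
  simp only [pd_fn_w2, pd_fn_w1]
  rw [← pd_fn_wη, pd_fn_wη']
  simp [surfL]

theorem fn_advect (γ : ℝ) (i : Fin d) (w : HUnknowns d) (x : Space d) :
    fn (w0 hs) (advect hs γ i w) x =
      ∑ j, relVel γ (fun j => fn (w2 hs) (w.1 j)) j x * pd j (fn (w2 hs) (w.1 i)) x := by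
  simp only [relVel, sub_mul, Finset.sum_sub_distrib, pd_fn_w2']
  simp [advect, fn_mul0, fn_i20]

theorem fn_iterate_mulη0 (E f : Herm d) (k : ℕ) (x : Space d) :
    fn (w0 hs) ((mulη0 hs E)^[k] f) x = fn (wη hs) E x ^ k * fn (w0 hs) f x := by
  induction k with
  | zero => simp
  | succ k ih =>
    rw [Function.iterate_succ_apply', fn_mulη0, Pi.mul_apply, ih]
    ring

theorem fn_forceH (c : HCoeff d ℓ) (i : Fin d) (w : HUnknowns d) (x : Space d) :
    fn (w0 hs) (forceH hs c i w) x =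
      forcing (fun k i j => fn (w0 hs) (c.1 k i j)) (fun k i => fn (w0 hs) (c.2 k i))
        (fn (wη hs) w.2) i x := by
  simp [forcing, forceH, fn_iterate_mulη0, fn_mul0, pd_fn_wη', mul_add]

theorem fn_momentumH (z : (Params × HCoeff d ℓ) × HUnknowns d) (i : Fin d) (x : Space d) :
    fn (w0 hs) (momentumH hs z i) x =
      (1 + fn (wη hs) z.2.2 x) * ∑ j, relVel z.1.1.1 (fun j => fn (w2 hs) (z.2.1 j)) j x *
          pd j (fn (w2 hs) (z.2.1 i)) x + fn (w2 hs) (z.2.1 i) x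
        - z.1.1.2.1 ^ 2 * div (fun j y => (1 + fn (wη hs) z.2.2 y) *
            stress (fun j => fn (w2 hs) (z.2.1 j)) i j y) x
        + (1 + fn (wη hs) z.2.2 x) * (pd i (fn (wη hs) z.2.2) x -
            z.1.1.2.2 ^ 2 * lap (pd i (fn (wη hs) z.2.2)) x)
        + forcing (fun k i j => fn (w0 hs) (z.1.2.1 k i j)) (fun k i => fn (w0 hs) (z.1.2.2 k i))
            (fn (wη hs) z.2.2) i x := by
  have e : ∀ j, (fun y => (1 + fn (wη hs) z.2.2 y) *
      stress (fun j => fn (w2 hs) (z.2.1 j)) i j y) =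
      fn (w1 hs) (stressL hs i j z.2 + mulη1 hs z.2.2 (stressL hs i j z.2)) := by
    intro j
    funext y
    rw [map_add, fn_mulη1, Pi.add_apply, Pi.mul_apply, fn_stressL]
    ring
  rw [← fn_surfL, ← fn_advect, ← fn_forceH, div]
  simp only [e, pd_fn_w1]
  simp only [momentumH, map_add, map_sub, map_smul, map_sum, fn_mulη0, fn_i20, Pi.add_apply,
    Pi.sub_apply, Pi.smul_apply, Pi.mul_apply, Finset.sum_apply, smul_eq_mul]
  ring

/-- The encoded operator vanishes exactly if the classical system holds. -/
theorem systemH_eq_zero_iff (z : (Params × HCoeff d ℓ) × HUnknowns d) :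
    systemH hs z = 0 ↔
      System z.1.1.1 z.1.1.2.1 z.1.1.2.2 (fun k i j => fn (w0 hs) (z.1.2.1 k i j))
        (fun k i => fn (w0 hs) (z.1.2.2 k i)) (fun j => fn (w2 hs) (z.2.1 j))
        (fn (wη hs) z.2.2) := by
  rw [systemH, Prod.mk_eq_zero, System, and_comm]
  refine and_congr ?_ ?_
  · rw [← fn_eq_zero_iff (wdiv hs)]
    simp only [fn_continuityH]
  · rw [funext_iff]
    refine forall_congr' fun i => ?_
    rw [Pi.zero_apply, ← fn_eq_zero_iff (w0 hs)]
    simp only [fn_momentumH]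

end

section

variable {d : ℕ} {ℓ : ℕ} {s : ℝ} [NeZero d] (hs : (d : ℝ) / 2 < s)

/-! ### Smoothness and linearization -/

theorem contDiff_iterate_mulη0 {V : Type*} [NormedAddCommGroup V] [NormedSpace ℝ V]
    {a b : V → Herm d} (ha : ContDiff ℝ ω a) (hb : ContDiff ℝ ω b) (k : ℕ) :
    ContDiff ℝ ω fun z => (mulη0 hs (a z))^[k] (b z) := by
  induction k with
  | zero => simpa using hb
  | succ k ih =>
    simp only [Function.iterate_succ_apply']
    fun_prop

theorem contDiff_advect (γ : ℝ) (i : Fin d) : ContDiff ℝ ω (advect hs γ i) := by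
  unfold advect
  fun_prop

theorem contDiff_surfL {V : Type*} [NormedAddCommGroup V] [NormedSpace ℝ V]
    {a : V → ℝ} {b : V → HUnknowns d} (ha : ContDiff ℝ ω a) (hb : ContDiff ℝ ω b) (i : Fin d) :
    ContDiff ℝ ω fun z => surfL hs (a z) i (b z) := by
  simp only [surfL_apply]
  fun_prop

theorem contDiff_systemH :
    ContDiff ℝ ω (systemH (d := d) (ℓ := ℓ) hs) := by
  refine ContDiff.prodMk (contDiff_pi.2 fun i => ?_) ?_
  · have h1 : ContDiff ℝ ω fun z : (Params × HCoeff d ℓ) × HUnknowns d =>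
        advect hs z.1.1.1 i z.2 := by
      unfold advect
      fun_prop
    have h2 : ContDiff ℝ ω fun z : (Params × HCoeff d ℓ) × HUnknowns d =>
        surfL hs z.1.1.2.2 i z.2 := contDiff_surfL hs (by fun_prop) (by fun_prop) i
    have h3 : ContDiff ℝ ω fun z : (Params × HCoeff d ℓ) × HUnknowns d =>
        forceH hs z.1.2 i z.2 := by
      unfold forceH
      refine ContDiff.sum fun k _ => contDiff_iterate_mulη0 hs (by fun_prop) (by fun_prop) k
    unfold momentumH
    fun_prop
  · unfold continuityH
    fun_prop

/-- The linearization of the momentum equation at rest. -/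
def linMomentum (p : Params) (i : Fin d) : HUnknowns d →L[ℝ] Herm d :=
  -p.1 • d20 hs 0 ∘L velL i + i20 hs ∘L velL i - p.2.1 ^ 2 • ∑ j, d10 hs j ∘L stressL hs i j
    + surfL hs p.2.2 i

/-- The linearization of the continuity equation at rest. -/
def linContinuity (γ : ℝ) : HUnknowns d →L[ℝ] Herm d :=
  ∑ j, d2div hs j ∘L velL j - γ • dηdiv hs ∘L ContinuousLinearMap.snd ℝ _ _

/-- The linearization of the system at rest. -/
def linSystem (p : Params) : HUnknowns d →L[ℝ] HUnknowns d :=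
  (ContinuousLinearMap.pi fun i => linMomentum hs p i).prod (linContinuity hs p.1)

theorem hasFDerivAt_bilin_zero {V H : Type*} [NormedAddCommGroup V] [NormedSpace ℝ V]
    [NormedAddCommGroup H] [NormedSpace ℝ H] (T : H →L[ℝ] H →L[ℝ] H) (a : V →L[ℝ] H) {b : V → H}
    (hb : DifferentiableAt ℝ b 0) (hb0 : b 0 = 0) :
    HasFDerivAt (fun w => T (a w) (b w)) (0 : V →L[ℝ] H) 0 := by
  have h := ((T ∘L a).hasFDerivAt (x := 0)).clm_apply hb.hasFDerivAt
  have e : (T ∘L a) 0 ∘L fderiv ℝ b 0 + (T ∘L a).flip (b 0) = 0 := by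
    simp only [hb0, map_zero, ContinuousLinearMap.zero_comp, add_zero]
  rwa [e] at h

theorem hasFDerivAt_clm_comp_zero {V H : Type*} [NormedAddCommGroup V] [NormedSpace ℝ V]
    [NormedAddCommGroup H] [NormedSpace ℝ H] (T : H →L[ℝ] H) {f : V → H}
    (hf : HasFDerivAt f (0 : V →L[ℝ] H) 0) :
    HasFDerivAt (fun w => T (f w)) (0 : V →L[ℝ] H) 0 := by
  have h := T.hasFDerivAt.comp 0 hf
  rwa [ContinuousLinearMap.comp_zero] at h

theorem hasFDerivAt_sum_zero {V H ι : Type*} [NormedAddCommGroup V] [NormedSpace ℝ V]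
    [NormedAddCommGroup H] [NormedSpace ℝ H] [Fintype ι] {f : ι → V → H}
    (hf : ∀ i, HasFDerivAt (f i) (0 : V →L[ℝ] H) 0) :
    HasFDerivAt (fun w => ∑ i, f i w) (0 : V →L[ℝ] H) 0 := by
  have h := HasFDerivAt.fun_sum (u := Finset.univ) fun i _ => hf i
  rwa [Finset.sum_const_zero] at h

theorem iterate_mulη0_zero (E : Herm d) (k : ℕ) : (mulη0 hs E)^[k] 0 = 0 :=
  Function.iterate_fixed (map_zero _) k

theorem forceH_zero (i : Fin d) (w : HUnknowns d) : forceH hs (0 : HCoeff d ℓ) i w = 0 := by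
  simp only [forceH, Prod.fst_zero, Prod.snd_zero, Pi.zero_apply, map_zero,
    zero_apply, Finset.sum_const_zero, add_zero, iterate_mulη0_zero]

/-- The quadratic and cubic part of the momentum equation. -/
def quadMomentum (p : Params) (i : Fin d) (w : HUnknowns d) : Herm d :=
  ∑ j, mul0 hs (i20 hs (w.1 j)) (d20 hs j (w.1 i)) + mulη0 hs w.2 (advect hs p.1 i w)
    - p.2.1 ^ 2 • ∑ j, d10 hs j (mulη1 hs w.2 (stressL hs i j w))
    + mulη0 hs w.2 (surfL hs p.2.2 i w)

theorem momentumH_eq (p : Params) (i : Fin d) (w : HUnknowns d) :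
    momentumH (ℓ := ℓ) hs ((p, 0), w) i = linMomentum hs p i w + quadMomentum hs p i w := by
  rw [momentumH, forceH_zero]
  simp only [linMomentum, quadMomentum, map_add, Finset.sum_add_distrib, smul_add,
    add_apply, sub_apply, smul_apply,
    sum_apply, ContinuousLinearMap.comp_apply, neg_smul]
  rw [advect]
  change _ = -(p.1 • d20 hs 0 (w.1 i)) + i20 hs (w.1 i) - _ + _ + _
  abel

theorem hasFDerivAt_quadMomentum (p : Params) (i : Fin d) :
    HasFDerivAt (quadMomentum hs p i) (0 : HUnknowns d →L[ℝ] Herm d) 0 := by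
  have q1 := hasFDerivAt_sum_zero fun j => hasFDerivAt_bilin_zero (mul0 hs) (i20 hs ∘L velL j)
    (d20 hs j ∘L velL i).differentiableAt (map_zero _)
  have q2 := hasFDerivAt_bilin_zero (mulη0 hs) (ContinuousLinearMap.snd ℝ (Fin d → Herm d) (Herm d))
    (b := advect hs p.1 i)
    ((contDiff_advect hs p.1 i).differentiable (by simp) 0) (by simp [advect])
  have q3 := hasFDerivAt_sum_zero fun j => hasFDerivAt_clm_comp_zero (d10 hs j) <|
    hasFDerivAt_bilin_zero (mulη1 hs) (ContinuousLinearMap.snd ℝ (Fin d → Herm d) (Herm d))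
      (stressL hs i j).differentiableAt (map_zero _)
  have q4 := hasFDerivAt_bilin_zero (mulη0 hs)
    (ContinuousLinearMap.snd ℝ (Fin d → Herm d) (Herm d))
    (surfL hs p.2.2 i).differentiableAt (map_zero _)
  have q := ((q1.add q2).sub (q3.const_smul (p.2.1 ^ 2))).add q4
  have e : (0 : HUnknowns d →L[ℝ] Herm d) + 0 - p.2.1 ^ 2 • 0 + 0 = 0 := by
    rw [smul_zero, add_zero, sub_zero, add_zero]
  rw [e] at q
  exact q

theorem continuityH_eq (p : Params) (w : HUnknowns d) :
    continuityH (ℓ := ℓ) hs ((p, 0), w) =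
      linContinuity hs p.1 w + ∑ j, d2div hs j (mulη2 hs w.2 (w.1 j)) := by
  rw [continuityH]
  simp only [linContinuity, map_add, Finset.sum_add_distrib,
    sub_apply, smul_apply,
    sum_apply, ContinuousLinearMap.comp_apply]
  change _ = ∑ j, d2div hs j (w.1 j) - p.1 • dηdiv hs w.2 + _
  abel

theorem hasFDerivAt_systemH (p : Params) :
    HasFDerivAt (fun w => systemH (d := d) (ℓ := ℓ) hs ((p, 0), w)) (linSystem hs p) 0 := by
  have hm : ∀ i, HasFDerivAt (fun w => momentumH (ℓ := ℓ) hs ((p, 0), w) i)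
      (linMomentum hs p i) 0 := by
    intro i
    have q := ((linMomentum hs p i).hasFDerivAt (x := 0)).add (hasFDerivAt_quadMomentum hs p i)
    rw [add_zero] at q
    exact q.congr_of_eventuallyEq (.of_forall fun w => momentumH_eq hs p i w)
  have hc : HasFDerivAt (fun w => continuityH (ℓ := ℓ) hs ((p, 0), w))
      (linContinuity hs p.1) 0 := by
    have q := ((linContinuity hs p.1).hasFDerivAt (x := 0)).add <|
      hasFDerivAt_sum_zero fun j => hasFDerivAt_clm_comp_zero (d2div hs j) <|
        hasFDerivAt_bilin_zero (mulη2 hs)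
          (ContinuousLinearMap.snd ℝ (Fin d → Herm d) (Herm d))
          (velL j).differentiableAt (map_zero _)
    rw [add_zero] at q
    exact q.congr_of_eventuallyEq (.of_forall fun w => continuityH_eq hs p w)
  exact (hasFDerivAt_pi.2 hm).prodMk hc

end

section

open Filter ComplexConjugate

/-! ### Symbols of the linearization -/

variable {d : ℕ}

/-- The symbol `-4π²|ξ|²` of the Laplacian. -/
def lapSym (ξ : Space d) : ℂ := ∑ j, dsym j ξ ^ 2

theorem lapSym_eq (ξ : Space d) : lapSym ξ = (-(2 * Real.pi * ‖ξ‖) ^ 2 : ℝ) := by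
  rw [mul_pow, EuclideanSpace.norm_sq_eq, lapSym, Finset.mul_sum, ← Finset.sum_neg_distrib,
    Complex.ofReal_sum]
  refine Finset.sum_congr rfl fun j _ => ?_
  rw [dsym, mul_pow, Complex.I_sq, Real.norm_eq_abs, sq_abs]
  push_cast
  ring

theorem lapSym_neg (ξ : Space d) : lapSym (-ξ) = conj (lapSym ξ) := by
  rw [lapSym_eq, lapSym_eq, norm_neg, Complex.conj_ofReal]

theorem measurable_lapSym : Measurable (lapSym (d := d)) := by
  have : lapSym (d := d) = fun ξ => ((-(2 * Real.pi * ‖ξ‖) ^ 2 : ℝ) : ℂ) := funext lapSym_eq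
  rw [this]
  fun_prop

theorem isMult_dsym_divWeight_sobWeight {s : ℝ} (hs : (d : ℝ) / 2 < s) (j : Fin d) : IsMult (divWeight (2 + s) (lt_two_add_sub_one hs)) (sobWeight s hs) (dsym j) :=
  isMult_dsym (C := 1) (fun ξ h0 => by
    have hn : 0 < ‖ξ‖ := norm_pos_iff.2 h0
    change jp s ξ * ‖ξ‖ ≤ 1 * (‖ξ‖⁻¹ * jp (2 + s) ξ)
    rw [one_mul, le_inv_mul_iff₀ hn]
    have := jp_mul_norm_pow_le (r := s) (r' := 2 + s) (m := 2) (by push_cast; linarith) ξ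
    calc ‖ξ‖ * (jp s ξ * ‖ξ‖) = jp s ξ * ‖ξ‖ ^ 2 := by ring
      _ ≤ _ := this) j

variable [NeZero d]

/-- The symbol of `1 - γ∂₁ - νΔ`. -/
def viscSym (γ ν : ℝ) (ξ : Space d) : ℂ := 1 - γ * dsym 0 ξ - ν * lapSym ξ

/-- The symbol of `1 - νΔ`. -/
def capSym (ν : ℝ) (ξ : Space d) : ℂ := 1 - ν * lapSym ξ

/-- The symbol of `γ∂₁(1 - γ∂₁ - 4μ²Δ) + Δ(1 - σ²Δ)`, the operator that acts on the surface height
after elimination of the velocity from the linearization. -/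
def detSym (p : Params) (ξ : Space d) : ℂ :=
  p.1 * dsym 0 ξ * viscSym p.1 (4 * p.2.1 ^ 2) ξ + lapSym ξ * capSym (p.2.2 ^ 2) ξ

theorem measurable_viscSym (γ ν : ℝ) : Measurable (viscSym (d := d) γ ν) :=
  ((measurable_dsym 0).const_mul _ |>.const_sub 1).sub (measurable_lapSym.const_mul _)

theorem measurable_detSym (p : Params) : Measurable (detSym (d := d) p) :=
  (((measurable_dsym 0).const_mul _).mul (measurable_viscSym _ _)).add
    (measurable_lapSym.mul (measurable_lapSym.const_mul _ |>.const_sub 1))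

theorem viscSym_neg (γ ν : ℝ) (ξ : Space d) : viscSym γ ν (-ξ) = conj (viscSym γ ν ξ) := by
  simp only [viscSym, lapSym_neg, dsym_neg, map_sub, map_mul, Complex.conj_ofReal, map_one]

theorem detSym_neg (p : Params) (ξ : Space d) : detSym p (-ξ) = conj (detSym p ξ) := by
  simp only [detSym, capSym, viscSym_neg, lapSym_neg, dsym_neg, map_add, map_sub, map_mul,
    Complex.conj_ofReal, map_one]

theorem viscSym_eq (γ ν : ℝ) (ξ : Space d) : viscSym γ ν ξ =
    ((1 + ν * (2 * Real.pi * ‖ξ‖) ^ 2 : ℝ) : ℂ) +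
      ((-(γ * (2 * Real.pi * ξ 0)) : ℝ) : ℂ) * Complex.I := by
  rw [viscSym, lapSym_eq, dsym]
  push_cast
  ring

/-- `1 - γ∂₁ - νΔ` is elliptic of second order. -/
theorem exists_jp_le_norm_viscSym (γ : ℝ) {ν : ℝ} (hν : 0 < ν) :
    ∃ C, 0 ≤ C ∧ ∀ ξ : Space d, jp 2 ξ ≤ C * ‖viscSym γ ν ξ‖ := by
  have hpi := Real.pi_pos
  refine ⟨1 + (ν * (2 * Real.pi) ^ 2)⁻¹, by positivity, fun ξ => ?_⟩
  have h : 1 + ν * (2 * Real.pi * ‖ξ‖) ^ 2 ≤ ‖viscSym γ ν ξ‖ := by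
    refine le_trans (le_of_eq ?_) (Complex.re_le_norm _)
    rw [viscSym_eq, Complex.add_re, Complex.ofReal_re, Complex.re_ofReal_mul, Complex.I_re]
    ring
  refine le_trans ?_ (mul_le_mul_of_nonneg_left h (by positivity))
  rw [jp_two]
  have e : (1 + (ν * (2 * Real.pi) ^ 2)⁻¹) * (1 + ν * (2 * Real.pi * ‖ξ‖) ^ 2) =
      1 + ‖ξ‖ ^ 2 + (ν * (2 * Real.pi) ^ 2)⁻¹ + ν * (2 * Real.pi * ‖ξ‖) ^ 2 := by
    field_simp
    ring
  rw [e, add_assoc (1 + _)]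
  exact le_add_of_nonneg_right (by positivity)

theorem viscSym_ne_zero (γ : ℝ) {ν : ℝ} (hν : 0 < ν) (ξ : Space d) : viscSym γ ν ξ ≠ 0 := by
  obtain ⟨C, -, hC⟩ := exists_jp_le_norm_viscSym (d := d) γ hν
  intro h
  have := hC ξ
  rw [h, norm_zero, mul_zero] at this
  exact absurd this (not_le.2 (jp_pos 2 ξ))

theorem exists_norm_viscSym_le (γ ν : ℝ) :
    ∃ C, 0 ≤ C ∧ ∀ ξ : Space d, ‖viscSym γ ν ξ‖ ≤ C * jp 2 ξ := by
  have hpi := Real.pi_pos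
  refine ⟨1 + |γ| * (2 * Real.pi) + |ν| * (2 * Real.pi) ^ 2, by positivity, fun ξ => ?_⟩
  have h1 : ‖viscSym γ ν ξ‖ ≤
      1 + |γ| * (2 * Real.pi * ‖ξ‖) + |ν| * (2 * Real.pi * ‖ξ‖) ^ 2 := by
    refine (norm_sub_le _ _).trans (add_le_add ((norm_sub_le _ _).trans (add_le_add ?_ ?_)) ?_)
    · simp
    · rw [norm_mul, Complex.norm_real, Real.norm_eq_abs, norm_dsym]
      gcongr
      exact abs_apply_le_norm ξ 0
    · rw [norm_mul, Complex.norm_real, Real.norm_eq_abs, lapSym_eq, Complex.norm_real, norm_neg,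
        norm_pow, Real.norm_of_nonneg (by positivity)]
  refine h1.trans ?_
  rw [jp_two]
  have h2 : ‖ξ‖ ≤ 1 + ‖ξ‖ ^ 2 := by nlinarith [sq_nonneg (‖ξ‖ - 1)]
  have h3 : |γ| * (2 * Real.pi) * ‖ξ‖ ≤ |γ| * (2 * Real.pi) * (1 + ‖ξ‖ ^ 2) := by gcongr
  have h4 : 0 ≤ |ν| * (2 * Real.pi) ^ 2 := by positivity
  nlinarith [sq_nonneg ‖ξ‖]

theorem detSym_eq (p : Params) (ξ : Space d) : detSym p ξ =
    (((p.1 * (2 * Real.pi * ξ 0)) ^ 2 -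
      (2 * Real.pi * ‖ξ‖) ^ 2 * (1 + p.2.2 ^ 2 * (2 * Real.pi * ‖ξ‖) ^ 2) : ℝ) : ℂ) +
    ((p.1 * (2 * Real.pi * ξ 0) * (1 + 4 * p.2.1 ^ 2 * (2 * Real.pi * ‖ξ‖) ^ 2) : ℝ) : ℂ) *
      Complex.I := by
  rw [detSym, capSym, viscSym, lapSym_eq, dsym]
  push_cast
  linear_combination (-((p.1 : ℂ) * (2 * Real.pi * ξ 0)) ^ 2) * Complex.I_sq

theorem sq_norm_detSym (p : Params) (ξ : Space d) : ‖detSym p ξ‖ ^ 2 =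
    ((p.1 * (2 * Real.pi * ξ 0)) ^ 2 -
      (2 * Real.pi * ‖ξ‖) ^ 2 * (1 + p.2.2 ^ 2 * (2 * Real.pi * ‖ξ‖) ^ 2)) ^ 2 +
    (p.1 * (2 * Real.pi * ξ 0)) ^ 2 * (1 + 4 * p.2.1 ^ 2 * (2 * Real.pi * ‖ξ‖) ^ 2) ^ 2 := by
  rw [detSym_eq, Complex.norm_add_mul_I, Real.sq_sqrt (by positivity), mul_pow _ (1 + _)]

/-- The elementary inequality behind the lower bound of the determinant: if `X` is small compared to
`P` the first square dominates, otherwise the second term does. -/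
theorem sq_le_of_le_mul_sq {X P Q C : ℝ} (hX : 0 ≤ X) (hP : 0 ≤ P) (hC : 0 ≤ C)
    (h : P ≤ C * Q ^ 2) : P ^ 2 ≤ (4 + 2 * C) * ((X - P) ^ 2 + X * Q ^ 2) := by
  have h1 : 0 ≤ X * Q ^ 2 := by positivity
  rcases le_total (2 * X) P with h2 | h2
  · nlinarith [sq_nonneg (X - P), mul_nonneg hC h1, mul_nonneg hC (sq_nonneg (X - P)),
      mul_nonneg hP (sub_nonneg.2 h2), mul_nonneg hX (sub_nonneg.2 h2)]
  · have h3 : P * P ≤ (2 * X) * (C * Q ^ 2) := mul_le_mul h2 h hP (by linarith)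
    nlinarith [mul_nonneg hC (sq_nonneg (X - P)), sq_nonneg (X - P)]

/-- The determinant is bounded below by the symbol of the gravity-capillary operator `Δ(1 - σ²Δ)`.
The transport term `γ²ξ₁²` may cancel that symbol in the real part, but then the viscosity in the
imaginary part takes over. -/
theorem exists_le_norm_detSym {p : Params} (hp : p ∈ posParams) :
    ∃ C, 0 ≤ C ∧ ∀ ξ : Space d,
      (2 * Real.pi * ‖ξ‖) ^ 2 * (1 + p.2.2 ^ 2 * (2 * Real.pi * ‖ξ‖) ^ 2) ≤ C * ‖detSym p ξ‖ := by
  obtain ⟨-, hμ, -⟩ := hp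
  set μ := p.2.1
  set σ := p.2.2
  set C := (8 * μ ^ 2)⁻¹ + σ ^ 2 * (16 * μ ^ 4)⁻¹ with hC
  have hC0 : 0 ≤ C := by positivity
  refine ⟨√(4 + 2 * C), by positivity, fun ξ => ?_⟩
  set t := (2 * Real.pi * ‖ξ‖) ^ 2
  have ht : 0 ≤ t := by positivity
  have h : t * (1 + σ ^ 2 * t) ≤ C * (1 + 4 * μ ^ 2 * t) ^ 2 := by
    have e : C * (1 + 4 * μ ^ 2 * t) ^ 2 = t * (1 + σ ^ 2 * t) + C +
        (8 * μ ^ 2)⁻¹ * (16 * μ ^ 4) * t ^ 2 + σ ^ 2 * (16 * μ ^ 4)⁻¹ * (8 * μ ^ 2) * t := by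
      rw [hC]
      field_simp
      ring
    rw [e]
    have : 0 ≤ (8 * μ ^ 2)⁻¹ * (16 * μ ^ 4) * t ^ 2 := by positivity
    have : 0 ≤ σ ^ 2 * (16 * μ ^ 4)⁻¹ * (8 * μ ^ 2) * t := by positivity
    linarith
  have h2 := sq_le_of_le_mul_sq (sq_nonneg (p.1 * (2 * Real.pi * ξ 0)))
    (show 0 ≤ t * (1 + σ ^ 2 * t) by positivity) hC0 h
  rw [← sq_norm_detSym] at h2
  refine abs_le_of_sq_le_sq' ?_ (by positivity) |>.2
  rwa [mul_pow (√_), Real.sq_sqrt (by positivity)]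

theorem le_norm_detSym (p : Params) (ξ : Space d) :
    |p.1 * (2 * Real.pi * ξ 0)| ≤ ‖detSym p ξ‖ := by
  refine abs_le_of_sq_le_sq ?_ (norm_nonneg _)
  rw [sq_norm_detSym]
  have h1 : 1 ≤ (1 + 4 * p.2.1 ^ 2 * (2 * Real.pi * ‖ξ‖) ^ 2) ^ 2 :=
    one_le_pow₀ (le_add_of_nonneg_right (by positivity))
  have h2 := le_mul_of_one_le_right (sq_nonneg (p.1 * (2 * Real.pi * ξ 0))) h1
  have h3 := sq_nonneg ((p.1 * (2 * Real.pi * ξ 0)) ^ 2 -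
      (2 * Real.pi * ‖ξ‖) ^ 2 * (1 + p.2.2 ^ 2 * (2 * Real.pi * ‖ξ‖) ^ 2))
  linarith

theorem detSym_ne_zero {p : Params} (hp : p ∈ posParams) {ξ : Space d} (h : ξ ≠ 0) :
    detSym p ξ ≠ 0 := by
  obtain ⟨C, -, hC⟩ := exists_le_norm_detSym (d := d) hp
  intro h0
  have := hC ξ
  rw [h0, norm_zero, mul_zero] at this
  have hn : 0 < ‖ξ‖ := norm_pos_iff.2 h
  have hpi := Real.pi_pos
  exact absurd this (not_le.2 (by positivity))

/-- The anisotropic weight is exactly what the determinant controls. -/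
theorem exists_anisoSqrtWeight_mul_norm_le {s : ℝ} (hs : (d : ℝ) / 2 < s) {p : Params}
    (hp : p ∈ posParams) :
    ∃ C, 0 ≤ C ∧ ∀ ξ : Space d, ξ ≠ 0 →
      wη hs ξ * ‖ξ‖ ≤ C * (jp s ξ * ‖detSym p ξ‖) := by
  obtain ⟨C, hC0, hC⟩ := exists_le_norm_detSym (d := d) hp
  obtain ⟨hγ, -, hσ⟩ := hp
  have hpi := Real.pi_pos
  have h2pi : 1 ≤ 2 * Real.pi := by linarith [Real.pi_gt_three]
  refine ⟨p.1⁻¹ + C + 4 * ((p.2.2 ^ 2)⁻¹ * C), by positivity, fun ξ h0 => ?_⟩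
  have hn : 0 < ‖ξ‖ := norm_pos_iff.2 h0
  have hM := norm_nonneg (detSym p ξ)
  have hw := (wη hs).nonneg ξ
  have hj := one_le_jp (order_nonneg hs) ξ
  have ht : ‖ξ‖ ≤ 2 * Real.pi * ‖ξ‖ := le_mul_of_one_le_left hn.le h2pi
  have ht2 : ‖ξ‖ ^ 2 ≤ (2 * Real.pi * ‖ξ‖) ^ 2 := by gcongr
  rcases lt_or_ge ‖ξ‖ 1 with h1 | h1
  · have e := anisoSqrtWeight_sq_of_lt_one (lt_three_add hs) h1 h0
    have b1 : |ξ 0| ≤ p.1⁻¹ * ‖detSym p ξ‖ := by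
      rw [le_inv_mul_iff₀ hγ]
      refine le_trans ?_ (le_norm_detSym p ξ)
      rw [abs_mul, abs_of_pos hγ, abs_mul, abs_of_pos Real.two_pi_pos]
      exact mul_le_mul_of_nonneg_left (le_mul_of_one_le_left (abs_nonneg _) h2pi) hγ.le
    have b2 : ‖ξ‖ ^ 2 ≤ C * ‖detSym p ξ‖ :=
      (ht2.trans (le_mul_of_one_le_right (by positivity)
        (le_add_of_nonneg_right (by positivity)))).trans (hC ξ)
    have b3 : wη hs ξ * ‖ξ‖ ≤ |ξ 0| + ‖ξ‖ ^ 2 := by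
      refine abs_le_of_sq_le_sq' ?_ (by positivity) |>.2
      rw [e, add_sq, sq_abs]
      nlinarith [mul_nonneg (abs_nonneg (ξ 0)) (sq_nonneg ‖ξ‖)]
    calc wη hs ξ * ‖ξ‖ ≤ (p.1⁻¹ + C) * ‖detSym p ξ‖ := by rw [add_mul]; linarith
      _ ≤ (p.1⁻¹ + C + 4 * ((p.2.2 ^ 2)⁻¹ * C)) * (jp s ξ * ‖detSym p ξ‖) := by
        refine mul_le_mul (le_add_of_nonneg_right (by positivity))
          (le_mul_of_one_le_left hM hj) hM (by positivity)
  · have e : wη hs ξ = jp (3 + s) ξ := anisoSqrtWeight_of_one_le (lt_three_add hs) h1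
    have b1 : ‖ξ‖ ^ 4 ≤ (p.2.2 ^ 2)⁻¹ * C * ‖detSym p ξ‖ := by
      rw [mul_assoc, le_inv_mul_iff₀ (by positivity)]
      refine le_trans ?_ (hC ξ)
      have : ‖ξ‖ ^ 4 ≤ (2 * Real.pi * ‖ξ‖) ^ 4 := by gcongr
      calc p.2.2 ^ 2 * ‖ξ‖ ^ 4 ≤ p.2.2 ^ 2 * (2 * Real.pi * ‖ξ‖) ^ 4 := by gcongr
        _ ≤ (2 * Real.pi * ‖ξ‖) ^ 2 + p.2.2 ^ 2 * (2 * Real.pi * ‖ξ‖) ^ 4 :=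
          le_add_of_nonneg_left (by positivity)
        _ = _ := by ring
    have b2 : jp 3 ξ * ‖ξ‖ ≤ 4 * ‖ξ‖ ^ 4 := by
      have h4 : jp 3 ξ * ‖ξ‖ ≤ jp 2 ξ * jp 2 ξ := by
        rw [← jp_add]
        simpa using jp_mul_norm_pow_le (r := 3) (r' := 2 + 2) (m := 1) (by norm_num) ξ
      refine h4.trans ?_
      rw [jp_two]
      have : 1 ≤ ‖ξ‖ ^ 2 := one_le_pow₀ h1
      nlinarith
    rw [e, jp_add]
    calc jp 3 ξ * jp s ξ * ‖ξ‖ = jp s ξ * (jp 3 ξ * ‖ξ‖) := by ring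
      _ ≤ jp s ξ * (4 * ((p.2.2 ^ 2)⁻¹ * C * ‖detSym p ξ‖)) := by
        refine mul_le_mul_of_nonneg_left (b2.trans ?_) (jp_pos _ _).le
        linarith
      _ = 4 * ((p.2.2 ^ 2)⁻¹ * C) * (jp s ξ * ‖detSym p ξ‖) := by ring
      _ ≤ _ := by
        refine mul_le_mul_of_nonneg_right (le_add_of_nonneg_left (by positivity)) ?_
        exact mul_nonneg (jp_pos _ _).le hM

variable {s : ℝ} (hs : (d : ℝ) / 2 < s)

theorem isMult_inv_viscSym (γ : ℝ) {ν : ℝ} (hν : 0 < ν) :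
    IsMult (w0 hs) (w2 hs) fun ξ => (viscSym γ ν ξ)⁻¹ := by
  obtain ⟨C, hC0, hC⟩ := exists_jp_le_norm_viscSym (d := d) γ hν
  refine ⟨(measurable_viscSym γ ν).inv, fun ξ => by rw [viscSym_neg, map_inv₀], C, fun ξ _ => ?_⟩
  change jp (2 + s) ξ * _ ≤ C * jp s ξ
  have hpos : 0 < ‖viscSym γ ν ξ‖ := norm_pos_iff.2 (viscSym_ne_zero γ hν ξ)
  rw [norm_inv, jp_add, ← div_eq_mul_inv, div_le_iff₀ hpos]
  calc jp 2 ξ * jp s ξ ≤ C * ‖viscSym γ ν ξ‖ * jp s ξ :=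
        mul_le_mul_of_nonneg_right (hC ξ) (jp_pos _ _).le
    _ = _ := by ring

theorem isMult_dsym_mul_inv_detSym {p : Params} (hp : p ∈ posParams) (j : Fin d) :
    IsMult (w0 hs) (wη hs) fun ξ => dsym j ξ * (detSym p ξ)⁻¹ := by
  obtain ⟨C, hC0, hC⟩ := exists_anisoSqrtWeight_mul_norm_le hs hp
  refine ⟨(measurable_dsym j).mul (measurable_detSym p).inv,
    fun ξ => by rw [dsym_neg, detSym_neg, map_mul, map_inv₀], 2 * Real.pi * C, fun ξ h0 => ?_⟩
  change _ ≤ _ * jp s ξ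
  have hpos : 0 < ‖detSym p ξ‖ := norm_pos_iff.2 (detSym_ne_zero hp h0)
  rw [norm_mul, norm_inv, ← mul_assoc, ← div_eq_mul_inv, div_le_iff₀ hpos, norm_dsym]
  have h1 : wη hs ξ * |ξ j| ≤ wη hs ξ * ‖ξ‖ :=
    mul_le_mul_of_nonneg_left (abs_apply_le_norm ξ j) ((wη hs).nonneg ξ)
  calc wη hs ξ * (2 * Real.pi * |ξ j|) = 2 * Real.pi * (wη hs ξ * |ξ j|) := by ring
    _ ≤ 2 * Real.pi * (C * (jp s ξ * ‖detSym p ξ‖)) :=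
      mul_le_mul_of_nonneg_left (h1.trans (hC ξ h0)) Real.two_pi_pos.le
    _ = _ := by ring

theorem isMult_viscSym_mul_inv_detSym {p : Params} (hp : p ∈ posParams) (γ ν : ℝ) :
    IsMult (wdiv hs) (wη hs) fun ξ => viscSym γ ν ξ * (detSym p ξ)⁻¹ := by
  obtain ⟨C, hC0, hC⟩ := exists_anisoSqrtWeight_mul_norm_le hs hp
  obtain ⟨B, hB0, hB⟩ := exists_norm_viscSym_le (d := d) γ ν
  refine ⟨(measurable_viscSym γ ν).mul (measurable_detSym p).inv,
    fun ξ => by rw [viscSym_neg, detSym_neg, map_mul, map_inv₀], B * C, fun ξ h0 => ?_⟩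
  change _ ≤ _ * (‖ξ‖⁻¹ * jp (2 + s) ξ)
  have hn : 0 < ‖ξ‖ := norm_pos_iff.2 h0
  have hpos : 0 < ‖detSym p ξ‖ := norm_pos_iff.2 (detSym_ne_zero hp h0)
  rw [norm_mul, norm_inv, ← mul_assoc, ← div_eq_mul_inv, div_le_iff₀ hpos, mul_left_comm,
    mul_assoc, le_inv_mul_iff₀ hn, jp_add]
  calc ‖ξ‖ * (wη hs ξ * ‖viscSym γ ν ξ‖) = (wη hs ξ * ‖ξ‖) * ‖viscSym γ ν ξ‖ := by ring
    _ ≤ (C * (jp s ξ * ‖detSym p ξ‖)) * (B * jp 2 ξ) := by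
      refine mul_le_mul (hC ξ h0) (hB ξ) (norm_nonneg _) ?_
      exact mul_nonneg hC0 (mul_nonneg (jp_pos _ _).le (norm_nonneg _))
    _ = _ := by ring

end

section

open Filter

/-! ### Inversion of the linearization -/

variable {d : ℕ}

/-- The ring of germs of functions on frequency space, modulo equality almost everywhere. -/
abbrev FreqGerm (d : ℕ) : Type := Germ (ae (volume : Measure (Space d))) ℂ

/-- The Fourier transform of an encoded function, as a germ: Fourier multipliers become products in
a commutative ring. -/
def hatG (k : Weight d) : Herm d →+ FreqGerm d where
  toFun h := (hat k h : Space d → ℂ)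
  map_zero' := Germ.coe_eq.2 (hat_zero k)
  map_add' h h' := Germ.coe_eq.2 (hat_add k h h')

/-- A real constant as a germ. -/
def constG (d : ℕ) (c : ℝ) : FreqGerm d := ((fun _ => (c : ℂ)) : Space d → ℂ)

theorem hatG_smul (k : Weight d) (c : ℝ) (h : Herm d) : hatG k (c • h) = constG d c * hatG k h :=
  Germ.coe_eq.2 (hat_smul k c h)

theorem constG_mul (c c' : ℝ) : constG d (c * c') = constG d c * constG d c' := by
  rw [constG]
  simp only [Complex.ofReal_mul]
  rfl

theorem constG_natCast (n : ℕ) : constG d n = n := by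
  rw [constG]
  simp only [Complex.ofReal_natCast]
  rfl

/-- The symbol of `∂ⱼ` as a germ. -/
def dsymG (j : Fin d) : FreqGerm d := (dsym j : Space d → ℂ)

theorem coe_lapSym : ((lapSym : Space d → ℂ) : FreqGerm d) = ∑ j, dsymG j ^ 2 := by
  have e : (lapSym : Space d → ℂ) = ∑ j, dsym j ^ 2 := by
    funext ξ
    simp [lapSym]
  rw [e]
  exact map_sum (Germ.coeRingHom _) _ _

variable [NeZero d]

theorem hatG_mult {k k' : Weight d} {m : Space d → ℂ} (hm : IsMult k k' m) (h : Herm d) :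
    hatG k' (mult hm h) = (m : FreqGerm d) * hatG k h :=
  Germ.coe_eq.2 (hat_mult hm h)

theorem hatG_injective (k : Weight d) : Function.Injective (hatG k) := fun _ _ h =>
  hat_injective k (Germ.coe_eq.1 h)

theorem coe_viscSym (γ ν : ℝ) : ((viscSym γ ν : Space d → ℂ) : FreqGerm d) =
    1 - constG d γ * dsymG 0 - constG d ν * ∑ j, dsymG j ^ 2 := by
  rw [← coe_lapSym]
  rfl

theorem coe_detSym (p : Params) : ((detSym p : Space d → ℂ) : FreqGerm d) =
    constG d p.1 * dsymG 0 *
      (1 - constG d p.1 * dsymG 0 - constG d (4 * p.2.1 ^ 2) * ∑ j, dsymG j ^ 2) +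
      (∑ j, dsymG j ^ 2) * (1 - constG d (p.2.2 ^ 2) * ∑ j, dsymG j ^ 2) := by
  rw [← coe_viscSym, ← coe_lapSym]
  rfl

variable {s : ℝ} (hs : (d : ℝ) / 2 < s)

theorem hatG_stressL (i j : Fin d) (w : HUnknowns d) : hatG (w1 hs) (stressL hs i j w) =
    dsymG j * hatG (w2 hs) (w.1 i) + dsymG i * hatG (w2 hs) (w.1 j) +
      if i = j then 2 * ∑ l, dsymG l * hatG (w2 hs) (w.1 l) else 0 := by
  have e : stressL hs i j w = d21 hs j (w.1 i) + d21 hs i (w.1 j) +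
      if i = j then (2 : ℝ) • ∑ l, d21 hs l (w.1 l) else 0 := by
    rw [stressL]
    by_cases h : i = j
    · simp only [if_pos h, add_apply, smul_apply, sum_apply]
      rfl
    · simp only [if_neg h, add_apply, zero_apply]
      rfl
  have hd : ∀ l h, hatG (w1 hs) (d21 hs l h) = dsymG l * hatG (w2 hs) h := fun l h =>
    hatG_mult _ _
  have h2 : constG d 2 = 2 := constG_natCast 2
  rw [e, map_add, map_add, hd, hd]
  split_ifs
  · rw [hatG_smul, map_sum, h2]
    simp only [hd]
  · rw [map_zero]

theorem hatG_surfL (σ : ℝ) (i : Fin d) (w : HUnknowns d) : hatG (w0 hs) (surfL hs σ i w) =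
    dsymG i * (1 - constG d (σ ^ 2) * ∑ j, dsymG j ^ 2) * hatG (wη hs) w.2 := by
  have hd : ∀ j, hatG (w0 hs) (d10 hs j (d21 hs j (dη2 hs i w.2))) =
      dsymG j * (dsymG j * (dsymG i * hatG (wη hs) w.2)) := fun j => by
    rw [d10, hatG_mult, d21, hatG_mult, dη2, hatG_mult]
    rfl
  have h0 : hatG (w0 hs) (dη0 hs i w.2) = dsymG i * hatG (wη hs) w.2 := hatG_mult _ _
  rw [surfL_apply, map_sub, hatG_smul, map_sum, h0]
  simp only [hd, ← mul_assoc, ← pow_two, ← Finset.sum_mul]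
  ring

theorem hatG_linMomentum (p : Params) (i : Fin d) (w : HUnknowns d) :
    hatG (w0 hs) (linMomentum hs p i w) =
      (1 - constG d p.1 * dsymG 0 - constG d (p.2.1 ^ 2) * ∑ j, dsymG j ^ 2) *
          hatG (w2 hs) (w.1 i)
        - 3 * constG d (p.2.1 ^ 2) * dsymG i * ∑ l, dsymG l * hatG (w2 hs) (w.1 l)
        + dsymG i * (1 - constG d (p.2.2 ^ 2) * ∑ j, dsymG j ^ 2) * hatG (wη hs) w.2 := by
  have e : linMomentum hs p i w = i20 hs (w.1 i) - p.1 • d20 hs 0 (w.1 i)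
      - p.2.1 ^ 2 • ∑ j, d10 hs j (stressL hs i j w) + surfL hs p.2.2 i w := by
    simp only [linMomentum, neg_smul, add_apply, sub_apply, smul_apply, sum_apply,
      ContinuousLinearMap.comp_apply]
    change -(p.1 • d20 hs 0 (w.1 i)) + i20 hs (w.1 i) - _ + _ = _
    abel
  have h10 : ∀ l h, hatG (w0 hs) (d10 hs l h) = dsymG l * hatG (w1 hs) h := fun l h =>
    hatG_mult _ _
  have h20 : hatG (w0 hs) (d20 hs 0 (w.1 i)) = dsymG 0 * hatG (w2 hs) (w.1 i) := hatG_mult _ _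
  have hi : hatG (w0 hs) (i20 hs (w.1 i)) = 1 * hatG (w2 hs) (w.1 i) := hatG_mult _ _
  have hsum : ∑ j, dsymG j * hatG (w1 hs) (stressL hs i j w) =
      (∑ j, dsymG j ^ 2) * hatG (w2 hs) (w.1 i) +
        3 * (dsymG i * ∑ l, dsymG l * hatG (w2 hs) (w.1 l)) := by
    simp only [hatG_stressL, mul_add, mul_ite, mul_zero, Finset.sum_add_distrib,
      Finset.sum_ite_eq, Finset.mem_univ, if_true]
    rw [Finset.sum_mul, Finset.mul_sum Finset.univ _ (dsymG i)]
    have e1 : ∀ j, dsymG j * (dsymG j * hatG (w2 hs) (w.1 i)) =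
      dsymG j ^ 2 * hatG (w2 hs) (w.1 i) := fun j => by ring
    have e2 : ∀ j, dsymG j * (dsymG i * hatG (w2 hs) (w.1 j)) =
      dsymG i * (dsymG j * hatG (w2 hs) (w.1 j)) := fun j => by ring
    simp only [e1, e2, ← Finset.mul_sum]
    ring
  rw [e, map_add, map_sub, map_sub, hatG_smul, hatG_smul, map_sum, hatG_surfL, h20, hi]
  simp only [h10]
  rw [hsum]
  ring

theorem hatG_linContinuity (γ : ℝ) (w : HUnknowns d) :
    hatG (wdiv hs) (linContinuity hs γ w) =
      ∑ l, dsymG l * hatG (w2 hs) (w.1 l) - constG d γ * dsymG 0 * hatG (wη hs) w.2 := by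
  have e : linContinuity hs γ w = ∑ j, d2div hs j (w.1 j) - γ • dηdiv hs w.2 := by
    simp only [linContinuity, sub_apply, smul_apply, sum_apply, ContinuousLinearMap.comp_apply]
    rfl
  have h1 : ∀ l, hatG (wdiv hs) (d2div hs l (w.1 l)) = dsymG l * hatG (w2 hs) (w.1 l) := fun l =>
    hatG_mult _ _
  have h2 : hatG (wdiv hs) (dηdiv hs w.2) = dsymG 0 * hatG (wη hs) w.2 := hatG_mult _ _
  rw [e, map_sub, map_sum, hatG_smul, h2]
  simp only [h1]
  ring

/-- Solution of the linear system in a commutative ring by elimination of the velocity. Here `z j` are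
the symbols of the derivatives, `g` is that of `γ∂₁`, `m = μ²`, `e` is the symbol of `1 - σ²Δ`, and
`a'`, `M'` are inverses of the symbol `a` and of the determinant. -/
theorem eq_of_linear_system {R ι : Type*} [CommRing R] [Fintype ι] {z V F : ι → R}
    {g m e η a' M' G D Z : R} (a : R) (hZ : Z = ∑ j, z j ^ 2) (hD : D = ∑ j, z j * V j)
    (ha : a * a' = 1) (hM : (g * (a - 3 * m * Z) + Z * e) * M' = 1)
    (hF : ∀ i, a * V i - 3 * m * z i * D + z i * e * η = F i) (hG : D - g * η = G) :
    η = M' * (∑ j, z j * F j - (a - 3 * m * Z) * G) ∧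
      ∀ i, V i = a' * (F i + 3 * m * z i * (G + g * η) - z i * e * η) := by
  have hsum : ∑ j, z j * F j = (a - 3 * m * Z) * D + Z * e * η := by
    have : ∀ j, z j * F j = a * (z j * V j) - 3 * m * D * z j ^ 2 + e * η * z j ^ 2 := fun j => by
      rw [← hF j]
      ring
    simp only [this, Finset.sum_add_distrib, Finset.sum_sub_distrib, ← Finset.mul_sum, ← hZ, ← hD]
    ring
  constructor
  · rw [hsum, ← hG]
    linear_combination (-η) * hM
  · intro i
    rw [← hF i, ← hG]
    linear_combination (-V i) * ha

/-- The formulas of `eq_of_linear_system` define a solution. -/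
theorem linear_system_of_eq {R ι : Type*} [CommRing R] [Fintype ι] {z V F : ι → R}
    {g m e η a' M' G Z : R} (a : R) (hZ : Z = ∑ j, z j ^ 2)
    (ha : a * a' = 1) (hM : (g * (a - 3 * m * Z) + Z * e) * M' = 1)
    (hη : η = M' * (∑ j, z j * F j - (a - 3 * m * Z) * G))
    (hV : ∀ i, V i = a' * (F i + 3 * m * z i * (G + g * η) - z i * e * η)) :
    (∀ i, a * V i - 3 * m * z i * (∑ j, z j * V j) + z i * e * η = F i) ∧
      ∑ j, z j * V j - g * η = G := by
  have hS : (g * (a - 3 * m * Z) + Z * e) * η = ∑ j, z j * F j - (a - 3 * m * Z) * G := by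
    rw [hη]
    linear_combination (∑ j, z j * F j - (a - 3 * m * Z) * G) * hM
  have hD : ∑ j, z j * V j = G + g * η := by
    have e1 : ∀ j, z j * V j = a' * (z j * F j) + a' * (3 * m * (G + g * η)) * z j ^ 2 -
        a' * (e * η) * z j ^ 2 := fun j => by
      rw [hV j]
      ring
    simp only [e1, Finset.sum_add_distrib, Finset.sum_sub_distrib, ← Finset.mul_sum, ← hZ]
    linear_combination (-a') * hS + (G + g * η) * ha
  refine ⟨fun i => ?_, by rw [hD]; ring⟩
  rw [hD, hV i]
  linear_combination (F i + 3 * m * z i * (G + g * η) - z i * e * η) * ha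

theorem coe_viscSym_mul_inv (γ : ℝ) {ν : ℝ} (hν : 0 < ν) :
    (1 - constG d γ * dsymG 0 - constG d ν * ∑ j, dsymG j ^ 2) *
      ((fun ξ => (viscSym γ ν ξ)⁻¹ : Space d → ℂ) : FreqGerm d) = 1 := by
  rw [← coe_viscSym]
  exact Germ.coe_eq.2 (Eventually.of_forall fun ξ => mul_inv_cancel₀ (viscSym_ne_zero γ hν ξ))

theorem coe_detSym_mul_inv {p : Params} (hp : p ∈ posParams) :
    (constG d p.1 * dsymG 0 *
      ((1 - constG d p.1 * dsymG 0 - constG d (p.2.1 ^ 2) * ∑ j, dsymG j ^ 2) -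
        3 * constG d (p.2.1 ^ 2) * ∑ j, dsymG j ^ 2) +
      (∑ j, dsymG j ^ 2) * (1 - constG d (p.2.2 ^ 2) * ∑ j, dsymG j ^ 2)) *
      ((fun ξ => (detSym p ξ)⁻¹ : Space d → ℂ) : FreqGerm d) = 1 := by
  have h4 : constG d (4 * p.2.1 ^ 2) = 4 * constG d (p.2.1 ^ 2) := by
    rw [constG_mul]
    exact congrArg (· * _) (constG_natCast 4)
  have e := coe_detSym (d := d) p
  rw [h4] at e
  have h1 : ((detSym p : Space d → ℂ) : FreqGerm d) *
      ((fun ξ => (detSym p ξ)⁻¹ : Space d → ℂ) : FreqGerm d) = 1 :=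
    Germ.coe_eq.2 (ae_ne_zero.mono fun ξ h => mul_inv_cancel₀ (detSym_ne_zero hp h))
  rw [e] at h1
  linear_combination h1

/-- The surface height that solves the linear system. -/
def invSurface {p : Params} (hp : p ∈ posParams) (w : HUnknowns d) : Herm d :=
  ∑ j, mult (isMult_dsym_mul_inv_detSym hs hp j) (w.1 j) -
    mult (isMult_viscSym_mul_inv_detSym hs hp p.1 (4 * p.2.1 ^ 2)) w.2

/-- The velocity that solves the linear system, for a given surface height `E`. -/
def invVelocity {p : Params} (hp : p ∈ posParams) (w : HUnknowns d) (E : Herm d) (i : Fin d) :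
    Herm d :=
  mult (isMult_inv_viscSym hs p.1 (pow_pos hp.2.1 2)) (w.1 i + (3 * p.2.1 ^ 2) •
    mult (isMult_dsym_divWeight_sobWeight hs i) (w.2 + p.1 • dηdiv hs E) -
      surfL hs p.2.2 i (0, E))

theorem hatG_invSurface {p : Params} (hp : p ∈ posParams) (w : HUnknowns d) :
    hatG (wη hs) (invSurface hs hp w) =
      ((fun ξ => (detSym p ξ)⁻¹ : Space d → ℂ) : FreqGerm d) *
        (∑ j, dsymG j * hatG (w0 hs) (w.1 j) -
          ((1 - constG d p.1 * dsymG 0 - constG d (p.2.1 ^ 2) * ∑ j, dsymG j ^ 2) -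
            3 * constG d (p.2.1 ^ 2) * ∑ j, dsymG j ^ 2) * hatG (wdiv hs) w.2) := by
  have h4 : constG d (4 * p.2.1 ^ 2) = 4 * constG d (p.2.1 ^ 2) := by
    rw [constG_mul]
    exact congrArg (· * _) (constG_natCast 4)
  have h1 : ∀ j, hatG (wη hs) (mult (isMult_dsym_mul_inv_detSym hs hp j) (w.1 j)) =
      ((fun ξ => (detSym p ξ)⁻¹ : Space d → ℂ) : FreqGerm d) *
        (dsymG j * hatG (w0 hs) (w.1 j)) := fun j => by
    rw [hatG_mult, ← mul_assoc]
    refine congrArg (· * _) ?_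
    rw [mul_comm]
    rfl
  have h2 : hatG (wη hs) (mult (isMult_viscSym_mul_inv_detSym hs hp p.1 (4 * p.2.1 ^ 2)) w.2) =
      ((viscSym p.1 (4 * p.2.1 ^ 2) : Space d → ℂ) : FreqGerm d) *
        ((fun ξ => (detSym p ξ)⁻¹ : Space d → ℂ) : FreqGerm d) * hatG (wdiv hs) w.2 :=
    hatG_mult _ _
  rw [invSurface, map_sub, map_sum, h2, coe_viscSym, h4]
  simp only [h1, ← Finset.mul_sum]
  ring

theorem hatG_invVelocity {p : Params} (hp : p ∈ posParams) (w : HUnknowns d) (E : Herm d)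
    (i : Fin d) : hatG (w2 hs) (invVelocity hs hp w E i) =
      ((fun ξ => (viscSym p.1 (p.2.1 ^ 2) ξ)⁻¹ : Space d → ℂ) : FreqGerm d) *
        (hatG (w0 hs) (w.1 i) + 3 * constG d (p.2.1 ^ 2) * dsymG i *
          (hatG (wdiv hs) w.2 + constG d p.1 * dsymG 0 * hatG (wη hs) E) -
          dsymG i * (1 - constG d (p.2.2 ^ 2) * ∑ j, dsymG j ^ 2) * hatG (wη hs) E) := by
  have h3 : constG d (3 * p.2.1 ^ 2) = 3 * constG d (p.2.1 ^ 2) := by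
    rw [constG_mul]
    exact congrArg (· * _) (constG_natCast 3)
  have h1 : ∀ h, hatG (w0 hs) (mult (isMult_dsym_divWeight_sobWeight hs i) h) =
      dsymG i * hatG (wdiv hs) h := fun h => hatG_mult _ _
  have h2 : hatG (wdiv hs) (dηdiv hs E) = dsymG 0 * hatG (wη hs) E := hatG_mult _ _
  rw [invVelocity, hatG_mult, map_sub, map_add, hatG_smul, h1, map_add, hatG_smul, h2, hatG_surfL,
    h3]
  ring

theorem linSystem_eq_iff {p : Params} (w f : HUnknowns d) : linSystem hs p w = f ↔
    (∀ i, (1 - constG d p.1 * dsymG 0 - constG d (p.2.1 ^ 2) * ∑ j, dsymG j ^ 2) *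
          hatG (w2 hs) (w.1 i)
        - 3 * constG d (p.2.1 ^ 2) * dsymG i * ∑ l, dsymG l * hatG (w2 hs) (w.1 l)
        + dsymG i * (1 - constG d (p.2.2 ^ 2) * ∑ j, dsymG j ^ 2) * hatG (wη hs) w.2
        = hatG (w0 hs) (f.1 i)) ∧
      ∑ l, dsymG l * hatG (w2 hs) (w.1 l) - constG d p.1 * dsymG 0 * hatG (wη hs) w.2 =
        hatG (wdiv hs) f.2 := by
  simp only [← hatG_linMomentum, ← hatG_linContinuity, (hatG_injective _).eq_iff]
  rw [Prod.ext_iff, funext_iff]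
  rfl

/-- The linearization at rest is an isomorphism for positive parameters. -/
theorem bijective_linSystem {p : Params} (hp : p ∈ posParams) :
    Function.Bijective (linSystem hs p) := by
  have ha := coe_viscSym_mul_inv (d := d) p.1 (pow_pos hp.2.1 2)
  have hM := coe_detSym_mul_inv (d := d) hp
  constructor
  · rw [injective_iff_map_eq_zero]
    intro w hw
    obtain ⟨h1, h2⟩ := (linSystem_eq_iff hs w 0).1 hw
    obtain ⟨h3, h4⟩ := eq_of_linear_system _ rfl rfl ha hM h1 h2
    simp only [Prod.fst_zero, Prod.snd_zero, Pi.zero_apply, map_zero, mul_zero,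
      Finset.sum_const_zero, sub_zero] at h3
    have hη : w.2 = 0 := hatG_injective (wη hs) (h3.trans (map_zero _).symm)
    refine Prod.ext (funext fun i => hatG_injective (w2 hs) ?_) hη
    rw [h4 i, hη]
    simp
  · intro f
    refine ⟨(invVelocity hs hp f (invSurface hs hp f), invSurface hs hp f),
      (linSystem_eq_iff hs _ f).2 ?_⟩
    exact linear_system_of_eq _ rfl ha hM (hatG_invSurface hs hp f)
      fun i => hatG_invVelocity hs hp f _ i

/-- The linearization at rest as a continuous linear equivalence. -/
def linEquiv {p : Params} (hp : p ∈ posParams) : HUnknowns d ≃L[ℝ] HUnknowns d :=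
  ContinuousLinearEquiv.ofBijective (linSystem hs p)
    (LinearMap.ker_eq_bot.2 (bijective_linSystem hs hp).1)
    (LinearMap.range_eq_top.2 (bijective_linSystem hs hp).2)

end

section

/-! ### Transfer to the function spaces -/

variable {d : ℕ} [NeZero d] {ℓ : ℕ} {s : ℝ}

theorem completeSpace_sobolev {r : ℝ} (hr : (d : ℝ) / 2 < r) : CompleteSpace (Sobolev d r) :=
  (Sobolev.equiv hr).toIsometryEquiv.completeSpace

theorem completeSpace_aniso {r : ℝ} (hr : (d : ℝ) / 2 < r) : CompleteSpace (Aniso d r) :=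
  (Aniso.equiv hr).toIsometryEquiv.completeSpace

variable (hs : (d : ℝ) / 2 < s)

/-- The encoding of the coefficients. -/
def encCoeff : ((Fin (ℓ + 1) → Fin d → Fin d → Sobolev d s) × (Fin (ℓ + 1) → Fin d → Sobolev d s))
    ≃L[ℝ] HCoeff d ℓ :=
  (ContinuousLinearEquiv.piCongrRight fun _ => ContinuousLinearEquiv.piCongrRight fun _ =>
    ContinuousLinearEquiv.piCongrRight fun _ =>
      (Sobolev.equiv hs).toContinuousLinearEquiv).prodCongr
  (ContinuousLinearEquiv.piCongrRight fun _ => ContinuousLinearEquiv.piCongrRight fun _ =>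
      (Sobolev.equiv hs).toContinuousLinearEquiv)

/-- The encoding of the unknowns. -/
def encUnknowns : Unknowns d s ≃L[ℝ] HUnknowns d :=
  (ContinuousLinearEquiv.piCongrRight fun _ =>
    (Sobolev.equiv (lt_two_add hs)).toContinuousLinearEquiv).prodCongr
  (Aniso.equiv (lt_three_add hs)).toContinuousLinearEquiv

/-- The operator of the system, as a function of the data and the unknowns. -/
def operator (z : Data d ℓ s × Unknowns d s) : HUnknowns d :=
  systemH hs ((z.1.1, encCoeff hs z.1.2), encUnknowns hs z.2)

theorem contDiff_operator : ContDiff ℝ ω (operator (ℓ := ℓ) hs) :=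
  (contDiff_systemH hs).comp <|
    (contDiff_fst.fst.prodMk ((encCoeff hs).contDiff.comp contDiff_fst.snd)).prodMk
      ((encUnknowns hs).contDiff.comp contDiff_snd)

theorem isClassicalSolution_iff (D : Data d ℓ s) (w : Unknowns d s) :
    IsClassicalSolution D w ↔ operator hs (D, w) = 0 := by
  have hτ := fun k i j f => represents_iff (f := f) (Sobolev.isGivenBy_equiv hs (D.2.1 k i j))
  have hφ := fun k i f => represents_iff (f := f) (Sobolev.isGivenBy_equiv hs (D.2.2 k i))
  have hv := fun i f => represents_iff (f := f) (Sobolev.isGivenBy_equiv (lt_two_add hs) (w.1 i))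
  have hη := fun f => represents_iff (f := f) (Aniso.isGivenBy_equiv (lt_three_add hs) w.2)
  rw [operator, systemH_eq_zero_iff]
  constructor
  · rintro ⟨τ, φ, v, η, h1, h2, h3, h4, h5⟩
    obtain rfl : τ = _ := funext fun k => funext fun i => funext fun j => (hτ k i j _).1 (h1 k i j)
    obtain rfl : φ = _ := funext fun k => funext fun i => (hφ k i _).1 (h2 k i)
    obtain rfl : v = _ := funext fun i => (hv i _).1 (h3 i).1
    obtain rfl : η = _ := (hη _).1 h4.1
    exact h5
  · intro h
    exact ⟨_, _, _, _, fun k i j => (hτ k i j _).2 rfl, fun k i => (hφ k i _).2 rfl,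
      fun i => ⟨(hv i _).2 rfl, contDiff_fn (isSmooth_w2 hs) _⟩,
      ⟨(hη _).2 rfl, contDiff_fn (isSmooth_wη hs) _⟩, h⟩

theorem operator_zero (p : Params) : operator (ℓ := ℓ) hs ((p, 0), 0) = 0 := by
  rw [operator, (encCoeff hs).map_zero, (encUnknowns hs).map_zero]
  refine Prod.ext (funext fun i => ?_) ?_
  · refine (momentumH_eq hs p i 0).trans ?_
    simp [quadMomentum, advect]
  · refine (continuityH_eq hs p 0).trans ?_
    simp

theorem hasFDerivAt_operator {p : Params} (hp : p ∈ posParams) :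
    HasFDerivAt (fun w => operator (ℓ := ℓ) hs ((p, 0), w))
      (((encUnknowns hs).trans (linEquiv hs hp) : Unknowns d s ≃L[ℝ] HUnknowns d) :
        Unknowns d s →L[ℝ] HUnknowns d) 0 := by
  have h1 : HasFDerivAt (fun w => systemH (ℓ := ℓ) hs ((p, 0), w)) (linSystem hs p)
      (encUnknowns hs 0) := by
    rw [map_zero]
    exact hasFDerivAt_systemH hs p
  have h2 := h1.comp 0 (encUnknowns hs).hasFDerivAt
  have e : (fun w => operator (ℓ := ℓ) hs ((p, 0), w)) =
      (fun w => systemH (ℓ := ℓ) hs ((p, 0), w)) ∘ encUnknowns hs := by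
    funext w
    rw [operator, (encCoeff hs).map_zero]
    rfl
  rw [e]
  exact h2

theorem isOpen_posParams : IsOpen posParams :=
  (isOpen_lt continuous_const continuous_fst).inter
    ((isOpen_lt continuous_const continuous_snd.fst).inter
      (isOpen_lt continuous_const continuous_snd.snd))

theorem zero_notMem_posParams : (0 : Params) ∉ posParams := fun h => lt_irrefl _ h.1

end

end ShallowWater

end

theorem theorem1 (d ℓ s : ℕ) [NeZero d] (hs : (d : ℝ) / 2 < (s : ℝ)) :
    ∃ (U : Set (ShallowWater.Data d ℓ (s : ℝ)))
      (V : ShallowWater.Params → Set (ShallowWater.Unknowns d (s : ℝ)))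
      (sol : ShallowWater.Data d ℓ (s : ℝ) → ShallowWater.Unknowns d (s : ℝ)),
      IsOpen U ∧
      (∀ p ∈ ShallowWater.posParams, ((p, 0, 0) : ShallowWater.Data d ℓ (s : ℝ)) ∈ U) ∧
      (∀ D ∈ U, D.1 ∈ ShallowWater.posParams) ∧
      (∀ p ∈ ShallowWater.posParams, IsOpen (V p) ∧ 0 ∈ V p) ∧
      ContDiffOn ℝ (⊤ : ℕ∞) sol U ∧
      ∀ D ∈ U, sol D ∈ V D.1 ∧ ShallowWater.IsClassicalSolution D (sol D) ∧
        ∀ w ∈ V D.1, ShallowWater.IsClassicalSolution D w → w = sol D := by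
  have := ShallowWater.completeSpace_sobolev hs
  have := ShallowWater.completeSpace_sobolev (ShallowWater.lt_two_add hs)
  have := ShallowWater.completeSpace_aniso (ShallowWater.lt_three_add hs)
  simp only [ShallowWater.isClassicalSolution_iff hs]
  exact ShallowWater.exists_solution_map (ShallowWater.contDiff_operator hs)
    ShallowWater.isOpen_posParams ⟨0, ShallowWater.zero_notMem_posParams⟩
    (fun p _ => ShallowWater.operator_zero hs p)
    fun p hp => ⟨_, ShallowWater.hasFDerivAt_operator hs hp⟩
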